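/- **Conventions.** All groups are abelian. A Polish group $G$ has the *division closure property* if $kG$ is closed in $G$ for every $k\in\mathbb N$. A *group with a Polish cover* is a quotient $\hat A/N$ of a Polish group $\hat A$ by a subgroup $N$ that is the image of a continuous homomorphism from a Polish group; its *asymptotic group* is $\overline N/N$. A homomorphism $\hat A/N\to\hat B/M$ is *continuously definable* if it is induced by a continuous function $\hat A\to\hat B$ (not necessarily a homomorphism). For a countable group $A$, $\mathrm{Hom}(A,G)$ has the topology of pointwise convergence, $\mathrm{Ext}(A,G)$ is the group of normalized symmetric $2$-cocycles $A\times A\to G$ (a closed subgroup of $G^{A\times A}$) modulo coboundaries, and $\mathrm{PExt}(A,G)$ is its asymptotic group. A *pair of polyhedra* $(X,X')=(|K|,|K'|)$ is given by a countable, locally finite simplicial complex $K$ and a subcomplex $K'$. Let $C_\bullet(K)$ be the ordered chain complex ($C_n(K)$ is free on the tuples $(v_0,\dots,v_n)$ whose set of entries is a simplex of $K$) and $C_\bullet(X,X')=C_\bullet(K)/C_\bullet(K')$. Then $H_\bullet(X,X')$ is the homology of $C_\bullet(X,X')$, and $H^n(X,X';G)$ is the group of $n$-cocycles of $\mathrm{Hom}(C_\bullet(X,X'),G)$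 modulo the $n$-coboundaries, a group with a Polish cover; $H^n_\infty(X,X';G)$ is its asymptotic group. A polyhedron $X$ is identified with the pair $(X,\varnothing)$. A *polyhedral cofiltration* of $(X,X')$ is a sequence $(X_m,X'_m)=(|K_m|,|K'_m|)$, $m\in\mathbb N$, where $(K_m)$ and $(K'_m)$ are increasing sequences of finite subcomplexes with unions $K$ and $K'$, and $K'_m\subseteq K_m$ for every $m$. A *chain map of pairs* from $(X,X')=(|K|,|K'|)$ to $(Y,Y')=(|L|,|L'|)$ consists of chain maps $C_\bullet(K)\to C_\bullet(L)$ and $C_\bullet(K')\to C_\bullet(L')$ that are compatible with the inclusions. A continuous map of pairs $\alpha:(X,X')\to(Y,Y')$ determines a homotopy class of chain maps of pairs, namely those $\varphi$ for which $\varphi\circ g_\#$ is homotopic to $f_\#$, where $f$ and $g$ are simplicial approximations of $\alpha$ and of $\mathrm{id}_X$ defined on a subdivision of $(K,K')$; the homomorphisms on homology and cohomology induced by $\alpha$ are those induced by such a $\varphi$. *Natural* means natural with respect to all chain maps of pairs, and in particular with respect to all continuous maps of pairs. For the map $\mathrm{Local}$ below, it means compatibility with chain maps of pairs $(X_m,X'_m)\to(Y_t,Y'_t)$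 that agree up to homotopy with the given one, for cofiltrations $(X_m,X'_m)$ and $(Y_t,Y'_t)$. **Theorem.** Let $G$ be a Polish group with the division closure property. For every pair of polyhedra $(X,X')$ and every $n\in\mathbb Z$ there is a natural exact sequence of continuously definable homomorphisms (the *UCT exact sequence* of $(X,X')$) $$0\to \mathrm{Ext}(H_{n-1}(X,X'),G)\xrightarrow{\mathrm{coIndex}} H^n(X,X';G)\xrightarrow{\mathrm{Index}} \mathrm{Hom}(H_n(X,X'),G)\to 0,$$ which splits by continuously definable homomorphisms: there are a left inverse $r$ of $\mathrm{coIndex}$ and a right inverse $s$ of $\mathrm{Index}$ with $\mathrm{coIndex}\circ r+s\circ \mathrm{Index}=\mathrm{id}$. Here $\mathrm{Index}([z])([a])=z(a)$, and $\mathrm{coIndex}([c])=[(-1)^n\rho\circ\partial]$ for every function $\rho$ from the $(n-1)$-cycles to $G$ with $\rho(x+y)=\rho(x)+\rho(y)+c([x],[y])$. The map $\mathrm{coIndex}$ restricts to a natural isomorphism $\mathrm{coIndex}_\infty:\mathrm{PExt}(H_{n-1}(X,X'),G)\to H^n_\infty(X,X';G)$ that is continuously definable together with its inverse. For every polyhedral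 cofiltration $(X_m,X'_m)_m$ of $(X,X')$ the subgroups of coboundaries that define the groups $H^n(X_m,X'_m;G)$ are closed, and there is a natural exact sequence of continuously definable homomorphisms $$0\to \mathrm{PExt}(H_{n-1}(X,X'),G)\xrightarrow{\mathrm{coIndex}_\infty} H^n(X,X';G)\xrightarrow{\mathrm{Local}} \varprojlim_m H^n(X_m,X'_m;G)\to 0,$$ where $\mathrm{Local}$ is given by restriction. Furthermore, there are natural connecting homomorphisms $d^n:H^n(X';G)\to H^{n+1}(X,X';G)$, which are continuously definable, and $d_n:H_n(X,X')\to H_{n-1}(X')$, given by the usual formulas ($d^n[z]=[\tilde z\circ\partial]$ for any cochain $\tilde z$ on $X$ that extends $z$, and $d_n[x]=[\partial x]$), that fit into long exact sequences $$\cdots\to H^n(X,X';G)\xrightarrow{H^n(j)} H^n(X;G)\xrightarrow{H^n(i)} H^n(X';G)\xrightarrow{d^n}H^{n+1}(X,X';G)\to\cdots,$$ $$\cdots\to H_n(X')\xrightarrow{H_n(i)} H_n(X)\xrightarrow{H_n(j)} H_n(X,X')\xrightarrow{d_n}H_{n-1}(X')\to\cdots,$$ where $i:X'\to X$ and $j:X\to(X,X')$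 are the inclusions. They define a natural morphism, of degree $1$, from the UCT exact sequence of $X'$ to that of $(X,X')$: $$d^n\circ\mathrm{coIndex}_{X'}=\mathrm{coIndex}_{(X,X')}\circ\mathrm{Ext}(d_n,G),\qquad \mathrm{Index}_{(X,X')}\circ d^n=\mathrm{Hom}(d_{n+1},G)\circ\mathrm{Index}_{X'}.$$ -/

import Mathlib

open Topology

universe u v

section PolishGroups

/-- The division closure property of a topological abelian group: every subgroup `k G` is closed. -/
def DivisionClosure (G : Type v) [AddCommGroup G] [TopologicalSpace G] : Prop :=
  ∀ k : ℕ, IsClosed {x : G | ∃ g : G, x = k • g}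

/-- A subgroup is Polishable if it is the image of a continuous homomorphism from a Polish group. -/
def IsPolishable {A : Type u} [AddCommGroup A] [TopologicalSpace A] (N : AddSubgroup A) : Prop :=
  ∃ (H : Type u) (_ : AddCommGroup H) (_ : TopologicalSpace H) (_ : IsTopologicalAddGroup H)
    (_ : PolishSpace H) (φ : H →+ A), Continuous φ ∧ φ.range = N

/-- An (abelian) group with a Polish cover: a Polish group `carrier` together with a Polishable
subgroup `sub`; it presents the definable group `carrier ⧸ sub`. -/
structure PolishCover : Type (u + 1) where
  carrier : Type u
  [grp : AddCommGroup carrier]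
  [top : TopologicalSpace carrier]
  [topGrp : IsTopologicalAddGroup carrier]
  [polish : PolishSpace carrier]
  sub : AddSubgroup carrier
  polishable : IsPolishable sub

attribute [instance] PolishCover.grp PolishCover.top PolishCover.topGrp PolishCover.polish

namespace PolishCover

/-- The definable group presented by a group with a Polish cover. -/
abbrev Q (A : PolishCover.{u}) : Type u := A.carrier ⧸ A.sub

/-- The class in `A.Q` of an element of the Polish cover. -/
abbrev cls (A : PolishCover.{u}) (x : A.carrier) : A.Q := QuotientAddGroup.mk x

/-- A homomorphism is continuously-definable if it has a continuous lift, which is a function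
between the covers that need not be a homomorphism. -/
def ContDef {A B : PolishCover.{u}} (f : A.Q →+ B.Q) : Prop :=
  ∃ g : A.carrier → B.carrier, Continuous g ∧ ∀ x, f (A.cls x) = B.cls (g x)

/-- A continuous homomorphism between the covers that respects the subgroups. -/
structure StrictHom (A B : PolishCover.{u}) where
  toHom : A.carrier →+ B.carrier
  cont : Continuous toHom
  le_comap : A.sub ≤ B.sub.comap toHom

/-- The homomorphism of definable groups induced by a homomorphism of the covers. -/
def StrictHom.map {A B : PolishCover.{u}} (f : StrictHom A B) : A.Q →+ B.Q :=
  QuotientAddGroup.map A.sub B.sub f.toHom f.le_comap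

/-- The asymptotic group: the closure of the subgroup modulo the subgroup. -/
def asymptotic (A : PolishCover.{u}) : PolishCover.{u} where
  carrier := A.sub.topologicalClosure
  polish := A.sub.isClosed_topologicalClosure.polishSpace
  sub := A.sub.addSubgroupOf A.sub.topologicalClosure
  polishable := by
    obtain ⟨H, i1, i2, i3, i4, φ, hφ, hr⟩ := A.polishable
    have hmem : ∀ x, φ x ∈ A.sub.topologicalClosure := fun x =>
      A.sub.le_topologicalClosure (hr ▸ ⟨x, rfl⟩)
    refine ⟨H, i1, i2, i3, i4, φ.codRestrict _ hmem, hφ.subtype_mk hmem, ?_⟩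
    ext y
    rw [AddSubgroup.mem_addSubgroupOf]
    constructor
    · rintro ⟨x, rfl⟩
      exact hr.le ⟨x, rfl⟩
    · intro hy
      obtain ⟨x, hx⟩ := hr.ge hy
      exact ⟨x, Subtype.ext hx⟩

/-- The inclusion of the asymptotic group. -/
def asymptoticIncl (A : PolishCover.{u}) : StrictHom A.asymptotic A where
  toHom := A.sub.topologicalClosure.subtype
  cont := continuous_subtype_val
  le_comap := fun _ hx => hx

/-- Functoriality of the asymptotic group. -/
def StrictHom.asymptotic {A B : PolishCover.{u}} (f : StrictHom A B) :
    StrictHom A.asymptotic B.asymptotic where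
  toHom := (f.toHom.comp A.sub.topologicalClosure.subtype).codRestrict B.sub.topologicalClosure
    (fun x => map_mem_closure (f := f.toHom) f.cont x.2 (fun _ hy => f.le_comap hy))
  cont := (f.cont.comp continuous_subtype_val).subtype_mk _
  le_comap := fun _ hx => f.le_comap hx

/-- The product of a sequence of groups with a Polish cover. -/
def pi (A : ℕ → PolishCover.{u}) : PolishCover.{u} where
  carrier := ∀ m, (A m).carrier
  sub := AddSubgroup.pi Set.univ (fun m => (A m).sub)
  polishable := by
    choose H i1 i2 i3 i4 φ hφ hr using fun m => (A m).polishable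
    refine ⟨∀ m, H m, inferInstance, inferInstance, inferInstance, inferInstance,
      AddMonoidHom.piMap φ, ?_, ?_⟩
    · exact continuous_pi fun m => (hφ m).comp (continuous_apply m)
    · ext y
      constructor
      · rintro ⟨x, rfl⟩ m -
        exact (hr m).le ⟨x m, rfl⟩
      · intro hy
        have : ∀ m, ∃ x, φ m x = y m := fun m => (hr m).ge (hy m (Set.mem_univ m))
        choose x hx using this
        exact ⟨x, funext hx⟩

/-- The coordinate projections of a product. -/
def proj (A : ℕ → PolishCover.{u}) (m : ℕ) : StrictHom (pi A) (A m) where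
  toHom := Pi.evalAddMonoidHom (fun m => (A m).carrier) m
  cont := continuous_apply m
  le_comap := fun _ hx => hx m (Set.mem_univ m)

/-- The homomorphism into a product with given components. -/
def toPi {B : PolishCover.{u}} (A : ℕ → PolishCover.{u}) (f : ∀ m, StrictHom B (A m)) :
    StrictHom B (pi A) where
  toHom := AddMonoidHom.pi (fun m => (f m).toHom)
  cont := continuous_pi fun m => (f m).cont
  le_comap := fun _ hx m _ => (f m).le_comap hx

/-- The inverse limit of a tower, as a subgroup of the product. -/
def limSubgroup (A : ℕ → PolishCover.{u}) (p : ∀ m, StrictHom (A (m + 1)) (A m)) :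
    AddSubgroup (pi A).Q :=
  ⨅ m, (((p m).map.comp (proj A (m + 1)).map) - (proj A m).map).ker

end PolishCover

end PolishGroups

section HomExt

/-- The topology of pointwise convergence on `Hom(A, G)`. -/
instance homPointwiseTopology (A : Type u) (G : Type v) [AddCommGroup A] [AddCommGroup G]
    [TopologicalSpace G] : TopologicalSpace (A →+ G) :=
  TopologicalSpace.induced (fun (f : A →+ G) (a : A) => f a) inferInstance

theorem continuous_eval_hom {A : Type u} {G : Type v} [AddCommGroup A] [AddCommGroup G]
    [TopologicalSpace G] (a : A) : Continuous (fun f : A →+ G => f a) :=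
  (continuous_apply a).comp continuous_induced_dom

theorem continuous_into_hom {A : Type u} {G : Type v} [AddCommGroup A] [AddCommGroup G]
    [TopologicalSpace G] {T : Type*} [TopologicalSpace T] {F : T → A →+ G}
    (h : ∀ a, Continuous (fun t => F t a)) : Continuous F :=
  continuous_induced_rng.2 (continuous_pi h)

instance homTopologicalAddGroup (A : Type u) (G : Type v) [AddCommGroup A] [AddCommGroup G]
    [TopologicalSpace G] [IsTopologicalAddGroup G] : IsTopologicalAddGroup (A →+ G) where
  continuous_add := continuous_into_hom fun a =>
    ((continuous_eval_hom a).comp continuous_fst).add ((continuous_eval_hom a).comp continuous_snd)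
  continuous_neg := continuous_into_hom fun a => (continuous_eval_hom a).neg

instance homPolishSpace (A : Type u) (G : Type v) [AddCommGroup A] [AddCommGroup G]
    [TopologicalSpace G] [IsTopologicalAddGroup G] [PolishSpace G] [Countable A] :
    PolishSpace (A →+ G) := by
  have hr : Set.range (fun (f : A →+ G) (a : A) => f a) =
      ⋂ (a : A) (b : A), {g : A → G | g (a + b) = g a + g b} := by
    ext g
    simp only [Set.mem_range, Set.mem_iInter, Set.mem_ofPred_eq]
    constructor
    · rintro ⟨f, rfl⟩ a b
      exact map_add f a b
    · intro h
      exact ⟨AddMonoidHom.mk' g h, rfl⟩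
  have he : IsClosedEmbedding (fun (f : A →+ G) (a : A) => f a) := by
    refine ⟨⟨⟨rfl⟩, DFunLike.coe_injective⟩, ?_⟩
    rw [hr]
    exact isClosed_iInter fun a => isClosed_iInter fun b =>
      isClosed_eq (by fun_prop) (by fun_prop)
  exact he.polishSpace

/-- The Polish group `Hom(A, G)`, as a definable group. -/
def homCover (A : Type u) (G : Type v) [AddCommGroup A] [AddCommGroup G]
    [TopologicalSpace G] [IsTopologicalAddGroup G] [PolishSpace G] [Countable A] :
    PolishCover.{max u v} where
  carrier := A →+ G
  sub := ⊥
  polishable := ⟨A →+ G, inferInstance, inferInstance, inferInstance, inferInstance, 0,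
    continuous_const, by ext; simp⟩

/-- `Hom(f, G)`. -/
def homMap {A B : Type u} (G : Type v) [AddCommGroup A] [AddCommGroup B] [AddCommGroup G]
    [TopologicalSpace G] [IsTopologicalAddGroup G] [PolishSpace G] [Countable A] [Countable B]
    (f : A →+ B) : PolishCover.StrictHom (homCover B G) (homCover A G) where
  toHom := AddMonoidHom.compHom' f
  cont := continuous_into_hom fun a => continuous_eval_hom (f a)
  le_comap := fun x hx => by
    obtain rfl : x = 0 := hx
    exact map_zero _

/-- Normalized symmetric 2-cocycles on `A` with values in `G`. -/
def extCocycles (A : Type u) (G : Type v) [AddCommGroup A] [AddCommGroup G] :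
    AddSubgroup (A × A → G) where
  carrier := {c | (∀ x, c (x, 0) = 0) ∧ (∀ x y, c (x, y) = c (y, x)) ∧
    ∀ x y z, c (x, y) + c (x + y, z) = c (x, z) + c (x + z, y)}
  zero_mem' := by simp
  add_mem' := by
    rintro c d ⟨h1, h2, h3⟩ ⟨k1, k2, k3⟩
    refine ⟨fun x => by simp [h1, k1], fun x y => by simp [h2 x y, k2 x y], fun x y z => ?_⟩
    have := congrArg₂ (· + ·) (h3 x y z) (k3 x y z)
    simp only [Pi.add_apply] at this ⊢
    rw [add_add_add_comm, this, add_add_add_comm]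
  neg_mem' := by
    rintro c ⟨h1, h2, h3⟩
    refine ⟨fun x => by simp [h1], fun x y => by simp [h2 x y], fun x y z => ?_⟩
    have := congrArg Neg.neg (h3 x y z)
    simpa only [Pi.neg_apply, neg_add] using this

/-- Functions `A → G` that vanish at `0`. -/
def normalizedFun (A : Type u) (G : Type v) [AddCommGroup A] [AddCommGroup G] :
    AddSubgroup (A → G) where
  carrier := {h | h 0 = 0}
  zero_mem' := rfl
  add_mem' := fun {h k} hh hk => by
    simp only [Set.mem_ofPred_eq] at hh hk ⊢
    simp [hh, hk]
  neg_mem' := fun {h} hh => by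
    simp only [Set.mem_ofPred_eq] at hh ⊢
    simp [hh]

/-- The coboundary map: `h` is sent to `(x, y) ↦ h x + h y - h (x + y)`. -/
def extCobMap (A : Type u) (G : Type v) [AddCommGroup A] [AddCommGroup G] :
    normalizedFun A G →+ extCocycles A G where
  toFun h := ⟨fun p => h.1 p.1 + h.1 p.2 - h.1 (p.1 + p.2), by
    have h0 : h.1 0 = 0 := h.2
    refine ⟨fun x => by simp [h0], fun x y => by simp [add_comm], fun x y z => ?_⟩
    simp only [add_right_comm x y z]
    abel⟩
  map_zero' := by ext; simp
  map_add' h k := by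
    ext p
    simp only [AddSubgroup.coe_add, Pi.add_apply]
    abel

/-- `Ext(A, G)`: cocycles modulo coboundaries. -/
def extCover (A : Type u) (G : Type v) [AddCommGroup A] [AddCommGroup G]
    [TopologicalSpace G] [IsTopologicalAddGroup G] [PolishSpace G] [Countable A] :
    PolishCover.{max u v} where
  carrier := extCocycles A G
  polish := by
    have : IsClosed (extCocycles A G : Set (A × A → G)) := by
      have hs : (extCocycles A G : Set (A × A → G)) =
          (⋂ x, {c | c (x, 0) = 0}) ∩ ((⋂ x, ⋂ y, {c | c (x, y) = c (y, x)}) ∩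
            ⋂ x, ⋂ y, ⋂ z, {c | c (x, y) + c (x + y, z) = c (x, z) + c (x + z, y)}) := by
        ext c
        simp [extCocycles]
      rw [hs]
      refine IsClosed.inter ?_ (IsClosed.inter ?_ ?_)
      · exact isClosed_iInter fun x => isClosed_eq (by fun_prop) (by fun_prop)
      · exact isClosed_iInter fun x => isClosed_iInter fun y =>
          isClosed_eq (by fun_prop) (by fun_prop)
      · exact isClosed_iInter fun x => isClosed_iInter fun y => isClosed_iInter fun z =>
          isClosed_eq (by fun_prop) (by fun_prop)
    exact this.polishSpace
  sub := (extCobMap A G).range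
  polishable := by
    have hN : IsClosed (normalizedFun A G : Set (A → G)) :=
      isClosed_eq (f := fun h : A → G => h 0) (g := fun _ => 0) (by fun_prop) (by fun_prop)
    refine ⟨normalizedFun A G, inferInstance, inferInstance, inferInstance, hN.polishSpace,
      extCobMap A G, ?_, rfl⟩
    refine Continuous.subtype_mk (continuous_pi fun p => ?_) _
    have hc : ∀ a : A, Continuous (fun h : normalizedFun A G => h.1 a) :=
      fun a => (continuous_apply a).comp continuous_subtype_val
    exact ((hc _).add (hc _)).sub (hc _)

/-- `PExt(A, G)`: the closure of the group of coboundaries modulo coboundaries. -/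
def pextCover (A : Type u) (G : Type v) [AddCommGroup A] [AddCommGroup G]
    [TopologicalSpace G] [IsTopologicalAddGroup G] [PolishSpace G] [Countable A] :
    PolishCover.{max u v} :=
  (extCover A G).asymptotic

/-- `Ext(f, G)`. -/
def extMap {A B : Type u} (G : Type v) [AddCommGroup A] [AddCommGroup B] [AddCommGroup G]
    [TopologicalSpace G] [IsTopologicalAddGroup G] [PolishSpace G] [Countable A] [Countable B]
    (f : A →+ B) : PolishCover.StrictHom (extCover B G) (extCover A G) where
  toHom :=
    { toFun := fun c => ⟨fun p => c.1 (f p.1, f p.2), by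
        obtain ⟨h1, h2, h3⟩ := c.2
        exact ⟨fun x => by simp [h1], fun x y => h2 _ _, fun x y z => by simp [h3]⟩⟩
      map_zero' := rfl
      map_add' := fun _ _ => rfl }
  cont := by
    refine Continuous.subtype_mk (f := fun (c : extCocycles B G) (p : A × A) =>
      c.1 (f p.1, f p.2)) (continuous_pi fun p => ?_) _
    exact (continuous_apply (f p.1, f p.2)).comp continuous_subtype_val
  le_comap := by
    rintro _ ⟨h, rfl⟩
    refine ⟨⟨fun a => h.1 (f a), ?_⟩, ?_⟩
    · show h.1 (f 0) = 0
      rw [map_zero]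
      exact h.2
    · apply Subtype.ext
      funext p
      show h.1 (f p.1) + h.1 (f p.2) - h.1 (f (p.1 + p.2)) =
        h.1 (f p.1) + h.1 (f p.2) - h.1 (f p.1 + f p.2)
      rw [map_add]

end HomExt

section ChainComplexes

/-- A chain complex of abelian groups indexed by the integers; `d h` is the differential
`X i → X j` for `j + 1 = i`. -/
structure ChainCx : Type (u + 1) where
  X : ℤ → Type u
  [grp : ∀ n, AddCommGroup (X n)]
  d : ∀ {i j : ℤ}, j + 1 = i → (X i →+ X j)
  d_d : ∀ {i j k : ℤ} (h : j + 1 = i) (h' : k + 1 = j) (x : X i), d h' (d h x) = 0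

attribute [instance] ChainCx.grp

namespace ChainCx

/-- Chain maps. -/
structure Map (A B : ChainCx.{u}) where
  f : ∀ n, A.X n →+ B.X n
  comm : ∀ {i j : ℤ} (h : j + 1 = i) (x : A.X i), f j (A.d h x) = B.d h (f i x)

/-- Composition of chain maps: `g` after `f`. -/
def Map.comp {A B C : ChainCx.{u}} (g : Map B C) (f : Map A B) : Map A C where
  f n := (g.f n).comp (f.f n)
  comm h x := by simp [f.comm, g.comm]

/-- The zero chain map. -/
def Map.zero (A B : ChainCx.{u}) : Map A B where
  f _ := 0
  comm _ _ := by simp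

/-- The quotient complex by the image of a chain map. -/
def coker {A B : ChainCx.{u}} (f : Map A B) : ChainCx.{u} where
  X n := B.X n ⧸ (f.f n).range
  d {i j} h := QuotientAddGroup.map _ _ (B.d h) (by
    rintro _ ⟨x, rfl⟩
    exact ⟨A.d h x, f.comm h x⟩)
  d_d h h' x := by
    induction x using QuotientAddGroup.induction_on with
    | H x =>
      exact congrArg (QuotientAddGroup.mk) (B.d_d h h' x)

/-- A commutative square of chain maps induces a chain map of the quotients. -/
def cokerMap {A B A₁ B₁ : ChainCx.{u}} (f : Map A B) (f₁ : Map A₁ B₁) (a : Map A A₁) (b : Map B B₁)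
    (hc : ∀ n x, b.f n (f.f n x) = f₁.f n (a.f n x)) : Map (coker f) (coker f₁) where
  f n := QuotientAddGroup.map _ _ (b.f n) (by
    rintro _ ⟨x, rfl⟩
    exact ⟨a.f n x, (hc n x).symm⟩)
  comm {i j} h x := by
    induction x using QuotientAddGroup.induction_on with
    | H x => exact congrArg (QuotientAddGroup.mk) (b.comm h x)

variable (C : ChainCx.{u})

/-- The group of `n`-cycles. -/
def cycles (n : ℤ) : AddSubgroup (C.X n) := (C.d (sub_add_cancel n 1)).ker

/-- The group of `n`-boundaries. -/
def boundaries (n : ℤ) : AddSubgroup (C.X n) := (C.d (rfl : n + 1 = n + 1)).range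

/-- The `n`-th homology group. -/
abbrev H (n : ℤ) : Type u := C.cycles n ⧸ (C.boundaries n).addSubgroupOf (C.cycles n)

instance countable_H [∀ n, Countable (C.X n)] (n : ℤ) : Countable (C.H n) :=
  Function.Surjective.countable (QuotientAddGroup.mk_surjective)

instance countable_coker {A B : ChainCx.{u}} (f : Map A B) [∀ n, Countable (B.X n)] (n : ℤ) :
    Countable ((coker f).X n) :=
  Function.Surjective.countable (f := (QuotientAddGroup.mk : B.X n → B.X n ⧸ (f.f n).range))
    (QuotientAddGroup.mk_surjective)

/-- The homology class of a cycle. -/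
abbrev hcls {n : ℤ} (x : C.cycles n) : C.H n := QuotientAddGroup.mk x

variable {C}

theorem d_of_cycle {n m : ℤ} (h : m + 1 = n) {x : C.X n} (hx : x ∈ C.cycles n) : C.d h x = 0 := by
  obtain rfl : m = n - 1 := by omega
  exact hx

theorem d_mem_boundaries {n m : ℤ} (h : m + 1 = n) (x : C.X n) : C.d h x ∈ C.boundaries m := by
  subst h
  exact ⟨x, rfl⟩

/-- The map on cycles induced by a chain map. -/
def Map.onCycles {A B : ChainCx.{u}} (f : Map A B) (n : ℤ) : A.cycles n →+ B.cycles n :=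
  ((f.f n).comp (A.cycles n).subtype).codRestrict (B.cycles n) (fun x => by
    show B.d _ (f.f n x) = 0
    rw [← f.comm, d_of_cycle _ x.2, map_zero])

/-- The map on homology induced by a chain map. -/
def Map.onH {A B : ChainCx.{u}} (f : Map A B) (n : ℤ) : A.H n →+ B.H n :=
  QuotientAddGroup.map _ _ (f.onCycles n) (by
    rintro x ⟨y, hy⟩
    exact ⟨f.f (n + 1) y, (f.comm rfl y).symm.trans (congrArg (f.f n) hy)⟩)

section Dual

variable (C) (G : Type v) [AddCommGroup G]

/-- The codifferential of the `G`-dual cochain complex `Hom(C, G)`. -/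
def codiff {i j : ℤ} (h : j + 1 = i) : (C.X j →+ G) →+ (C.X i →+ G) :=
  AddMonoidHom.compHom' (C.d h)

/-- The `n`-cocycles of `Hom(C, G)`. -/
def cocycles (n : ℤ) : AddSubgroup (C.X n →+ G) := (C.codiff G (rfl : n + 1 = n + 1)).ker

/-- The `n`-coboundaries of `Hom(C, G)`. -/
def coboundaries (n : ℤ) : AddSubgroup (C.X n →+ G) := (C.codiff G (sub_add_cancel n 1)).range

variable {C G}

theorem cocycle_d {n m : ℤ} (h : n + 1 = m) {z : C.X n →+ G} (hz : z ∈ C.cocycles G n)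
    (x : C.X m) : z (C.d h x) = 0 := by
  subst h
  exact DFunLike.congr_fun (show (C.codiff G rfl) z = 0 from hz) x

theorem coboundaries_le_cocycles (n : ℤ) : C.coboundaries G n ≤ C.cocycles G n := by
  rintro _ ⟨y, rfl⟩
  show (C.codiff G rfl) (C.codiff G (sub_add_cancel n 1) y) = 0
  ext x
  show y (C.d _ (C.d _ x)) = 0
  rw [C.d_d, map_zero]

variable (C G) [TopologicalSpace G] [IsTopologicalAddGroup G] [PolishSpace G]
  [hC : ∀ n, Countable (C.X n)]

/-- The definable cohomology group `Hⁿ(Hom(C, G))`: cocycles modulo coboundaries, where `Hom(C, G)`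
carries the topology of pointwise convergence. -/
def coh (n : ℤ) : PolishCover.{max u v} where
  carrier := C.cocycles G n
  polish := by
    have : IsClosed (C.cocycles G n : Set (C.X n →+ G)) := by
      have hs : (C.cocycles G n : Set (C.X n →+ G)) =
          ⋂ x : C.X (n + 1), {z : C.X n →+ G | z (C.d rfl x) = 0} := by
        ext z
        simp only [Set.mem_iInter]
        exact ⟨fun hz x => cocycle_d rfl hz x, fun hz => AddMonoidHom.ext hz⟩
      rw [hs]
      exact isClosed_iInter fun x => isClosed_eq (continuous_eval_hom _) continuous_const
    exact this.polishSpace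
  sub := (C.coboundaries G n).addSubgroupOf (C.cocycles G n)
  polishable := by
    refine ⟨C.X (n - 1) →+ G, inferInstance, inferInstance, inferInstance, inferInstance,
      (C.codiff G (sub_add_cancel n 1)).codRestrict _
        (fun y => coboundaries_le_cocycles n ⟨y, rfl⟩), ?_, ?_⟩
    · exact Continuous.subtype_mk (f := fun y => C.codiff G (sub_add_cancel n 1) y)
        (continuous_into_hom fun a => continuous_eval_hom _) _
    · ext z
      rw [AddSubgroup.mem_addSubgroupOf]
      constructor
      · rintro ⟨y, rfl⟩
        exact ⟨y, rfl⟩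
      · rintro ⟨y, hy⟩
        exact ⟨y, Subtype.ext hy⟩

/-- The index homomorphism `[z] ↦ ([a] ↦ z a)` from cohomology to `Hom(Hₙ, G)`. -/
def index (n : ℤ) : PolishCover.StrictHom (C.coh G n) (homCover (C.H n) G) where
  toHom :=
    { toFun := fun z => QuotientAddGroup.lift _ (z.1.comp (C.cycles n).subtype) (by
        rintro x ⟨y, hy⟩
        show z.1 x.1 = 0
        rw [show x.1 = C.d rfl y from hy.symm]
        exact cocycle_d rfl z.2 y)
      map_zero' := by
        refine AddMonoidHom.ext fun a => ?_
        induction a using QuotientAddGroup.induction_on with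
        | H x => rfl
      map_add' := fun z w => by
        refine AddMonoidHom.ext fun a => ?_
        induction a using QuotientAddGroup.induction_on with
        | H x => rfl }
  cont := by
    refine continuous_into_hom fun a => ?_
    induction a using QuotientAddGroup.induction_on with
    | H x => exact (continuous_eval_hom x.1).comp continuous_subtype_val
  le_comap := by
    rintro z ⟨y, hy⟩
    show _ = _
    refine AddMonoidHom.ext fun a => ?_
    induction a using QuotientAddGroup.induction_on with
    | H x =>
      show z.1 x.1 = 0
      rw [show z.1 = C.codiff G (sub_add_cancel n 1) y from hy.symm]
      show y (C.d _ x.1) = 0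
      rw [d_of_cycle _ x.2, map_zero]

variable {C}

/-- The map on definable cohomology induced by a chain map. -/
def Map.onCoh {A B : ChainCx.{u}} [∀ n, Countable (A.X n)] [∀ n, Countable (B.X n)]
    (f : Map A B) (n : ℤ) : PolishCover.StrictHom (B.coh G n) (A.coh G n) where
  toHom := ((AddMonoidHom.compHom' (f.f n)).comp (B.cocycles G n).subtype).codRestrict
    (A.cocycles G n) (fun z => by
      show (A.codiff G rfl) (z.1.comp (f.f n)) = 0
      ext x
      show z.1 (f.f n (A.d _ x)) = 0
      rw [f.comm]
      exact cocycle_d rfl z.2 _)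
  cont := Continuous.subtype_mk (f := fun z : B.cocycles G n => z.1.comp (f.f n))
    (continuous_into_hom fun a => (continuous_eval_hom (f.f n a)).comp continuous_subtype_val) _
  le_comap := by
    rintro z ⟨y, hy⟩
    refine ⟨y.comp (f.f (n - 1)), ?_⟩
    ext x
    show y (f.f (n - 1) (A.d _ x)) = z.1 (f.f n x)
    rw [f.comm, show z.1 = B.codiff G (sub_add_cancel n 1) y from hy.symm]
    rfl

end Dual

end ChainCx

end ChainComplexes

section Simplicial

/-- The elementary `n`-chains of a simplicial complex `K`: tuples `(v₀, …, vₙ)` whose set of entries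
is a simplex of `K`. There are none for `n < 0`. -/
def elemChains {V : Type u} (K : PreAbstractSimplicialComplex V) (n : ℤ) : Set (List V) :=
  {l | (l.length : ℤ) = n + 1 ∧ ∃ s ∈ K.faces, ∀ v, v ∈ s ↔ v ∈ l}

/-- The free abelian group on the elementary `n`-chains of `K`. -/
noncomputable def chainGroup {V : Type u} (K : PreAbstractSimplicialComplex V) (n : ℤ) :
    AddSubgroup (List V →₀ ℤ) :=
  (Finsupp.supported ℤ ℤ (elemChains K n)).toAddSubgroup

/-- The boundary of a tuple: `∑ₖ (-1)ᵏ (v₀, …, v̂ₖ, …, vₙ)` for `n > 0`, and `0` for `n = 0`. -/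
noncomputable def tupleBdry {V : Type u} (l : List V) : List V →₀ ℤ :=
  if l.length ≤ 1 then 0
  else ∑ k ∈ Finset.range l.length, Finsupp.single (l.eraseIdx k) ((-1) ^ k)

/-- The linear extension of `tupleBdry`. -/
noncomputable def bdry (V : Type u) : (List V →₀ ℤ) →+ (List V →₀ ℤ) :=
  (Finsupp.linearCombination ℤ (tupleBdry (V := V))).toAddMonoidHom

theorem bdry_single {V : Type u} (l : List V) (a : ℤ) :
    bdry V (Finsupp.single l a) = a • tupleBdry l := by
  simp [bdry]

theorem bdry_mem {V : Type u} (K : PreAbstractSimplicialComplex V) {i j : ℤ} (h : j + 1 = i)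
    {x : List V →₀ ℤ} (hx : x ∈ chainGroup K i) : bdry V x ∈ chainGroup K j := by
  have hx' : x ∈ Submodule.span ℤ ((fun l => Finsupp.single l (1 : ℤ)) '' elemChains K i) := by
    rw [← Finsupp.supported_eq_span_single]
    exact hx
  clear hx
  induction hx' using Submodule.span_induction with
  | mem x hx =>
    obtain ⟨l, ⟨hl, s, hs, hsl⟩, rfl⟩ := hx
    simp only [bdry_single, one_smul, tupleBdry]
    split_ifs with h1
    · exact zero_mem _
    · refine sum_mem fun k hk => ?_
      rw [Finset.mem_range] at hk
      refine Finsupp.single_mem_supported ℤ _ ⟨?_, ?_⟩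
      · rw [List.length_eraseIdx_of_lt hk]
        omega
      · classical
        refine ⟨(l.eraseIdx k).toFinset, (K.isRelLowerSet_faces hs).2 ?_ ?_, by simp⟩
        · intro v hv
          rw [List.mem_toFinset] at hv
          exact (hsl v).2 (List.mem_of_mem_eraseIdx hv)
        · rw [List.toFinset_nonempty_iff]
          intro h0
          have := List.length_eraseIdx_of_lt hk
          rw [h0] at this
          simp at this
          omega
  | zero => rw [map_zero]; exact zero_mem _
  | add x y _ _ h1 h2 => rw [map_add]; exact add_mem h1 h2
  | smul a x _ h1 => rw [map_zsmul]; exact zsmul_mem h1 a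

/-- The augmented boundary, which also maps a one-element tuple to the empty tuple. -/
noncomputable def augBdry {V : Type u} (l : List V) : List V →₀ ℤ :=
  ∑ k ∈ Finset.range l.length, Finsupp.single (l.eraseIdx k) ((-1) ^ k)

theorem augBdry_cons {V : Type u} (v : V) (l : List V) :
    augBdry (v :: l) = Finsupp.single l 1 - Finsupp.lmapDomain ℤ ℤ (List.cons v) (augBdry l) := by
  simp only [augBdry, List.length_cons, Finset.sum_range_succ', List.eraseIdx_cons_succ,
    List.eraseIdx_zero, List.tail_cons, pow_zero, map_sum, Finsupp.lmapDomain_apply,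
    Finsupp.mapDomain_single, pow_succ, mul_neg, mul_one, Finsupp.single_neg,
    Finset.sum_neg_distrib]
  abel

theorem augBdry_augBdry {V : Type u} (l : List V) :
    Finsupp.linearCombination ℤ (augBdry (V := V)) (augBdry l) = 0 := by
  induction l with
  | nil => simp [augBdry]
  | cons v l ih =>
    have key : ∀ x : List V →₀ ℤ, Finsupp.linearCombination ℤ (augBdry (V := V))
        (Finsupp.lmapDomain ℤ ℤ (List.cons v) x) = x - Finsupp.lmapDomain ℤ ℤ (List.cons v)
          (Finsupp.linearCombination ℤ (augBdry (V := V)) x) := by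
      intro x
      induction x using Finsupp.induction_linear with
      | zero => simp
      | add x y hx hy =>
        rw [map_add, map_add, hx, hy, map_add, map_add]
        abel
      | single l a =>
        rw [Finsupp.lmapDomain_apply, Finsupp.mapDomain_single, Finsupp.linearCombination_single,
          Finsupp.linearCombination_single, augBdry_cons, map_smul, smul_sub, Finsupp.smul_single]
        simp
    rw [augBdry_cons, map_sub, key, ih, map_zero, sub_zero, Finsupp.linearCombination_single,
      one_smul, sub_self]

theorem bdry_bdry {V : Type u} (x : List V →₀ ℤ) : bdry V (bdry V x) = 0 := by
  induction x using Finsupp.induction_linear with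
  | zero => simp
  | add x y hx hy => rw [map_add, map_add, hx, hy, add_zero]
  | single l a =>
    rw [bdry_single, map_zsmul]
    suffices h : bdry V (tupleBdry l) = 0 by rw [h, smul_zero]
    by_cases h1 : l.length ≤ 1
    · simp [tupleBdry, h1]
    · have h2 : tupleBdry l = augBdry l := by simp [tupleBdry, h1, augBdry]
      by_cases h3 : l.length = 2
      · rw [h2, augBdry, map_sum]
        refine Finset.sum_eq_zero fun k hk => ?_
        rw [Finset.mem_range] at hk
        rw [bdry_single, tupleBdry, if_pos, smul_zero]
        rw [List.length_eraseIdx_of_lt hk]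
        omega
      · rw [← augBdry_augBdry l, h2, augBdry, map_sum, map_sum]
        refine Finset.sum_congr rfl fun k hk => ?_
        rw [Finset.mem_range] at hk
        rw [bdry_single, Finsupp.linearCombination_single, tupleBdry, if_neg, augBdry]
        rw [List.length_eraseIdx_of_lt hk]
        omega

/-- The chain complex of a simplicial complex. -/
noncomputable def simplicialCx {V : Type u} (K : PreAbstractSimplicialComplex V) :
    ChainCx.{u} where
  X n := chainGroup K n
  d {i j} h := ((bdry V).comp (chainGroup K i).subtype).codRestrict (chainGroup K j)
    (fun x => bdry_mem K h x.2)
  d_d _ _ x := Subtype.ext (bdry_bdry x.1)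

instance simplicialCx_countable {V : Type u} [Countable V] (K : PreAbstractSimplicialComplex V)
    (n : ℤ) : Countable ((simplicialCx K).X n) :=
  inferInstanceAs (Countable (chainGroup K n))

/-- The inclusion of the chain complex of a subcomplex. -/
noncomputable def simplicialIncl {V : Type u} {K L : PreAbstractSimplicialComplex V} (h : K ≤ L) :
    ChainCx.Map (simplicialCx K) (simplicialCx L) where
  f _ := AddSubgroup.inclusion (Finsupp.supported_mono (R := ℤ) (M := ℤ)
    (fun _ hl => ⟨hl.1, hl.2.imp fun _ hs => ⟨h hs.1, hs.2⟩⟩))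
  comm _ _ := rfl

/-- A function on vertices is a simplicial map if it maps simplices onto simplices. -/
def IsSimplicialMap {V W : Type u} (K : PreAbstractSimplicialComplex V)
    (L : PreAbstractSimplicialComplex W) (f : V → W) : Prop :=
  ∀ s ∈ K.faces, ∃ t ∈ L.faces, ∀ w, w ∈ t ↔ ∃ v ∈ s, f v = w

/-- The chain map `(v₀, …, vₙ) ↦ (f v₀, …, f vₙ)` induced by a simplicial map. -/
noncomputable def simplicialMap {V W : Type u} {K : PreAbstractSimplicialComplex V}
    {L : PreAbstractSimplicialComplex W} (f : V → W) (hf : IsSimplicialMap K L f) :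
    ChainCx.Map (simplicialCx K) (simplicialCx L) where
  f n := ((Finsupp.mapDomain.addMonoidHom (List.map f)).comp (chainGroup K n).subtype).codRestrict
    (chainGroup L n) (fun x => by
      refine Finsupp.supported_mono (R := ℤ) (M := ℤ) ?_
        ((Finsupp.lmapDomain_supported (M := ℤ) (R := ℤ) (List.map f) (elemChains K n)).le
          ⟨x.1, x.2, rfl⟩)
      rintro _ ⟨l, ⟨hl, s, hs, hsl⟩, rfl⟩
      obtain ⟨t, ht, htw⟩ := hf s hs
      refine ⟨by simpa using hl, t, ht, fun w => ?_⟩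
      rw [htw, List.mem_map]
      simp only [hsl])
  comm {i j} _ x := by
    apply Subtype.ext
    show Finsupp.mapDomain.addMonoidHom (List.map f) (bdry V x.1) =
      bdry W (Finsupp.mapDomain.addMonoidHom (List.map f) x.1)
    generalize x.1 = y
    induction y using Finsupp.induction_linear with
    | zero => simp
    | add x y hx hy => simp only [map_add, hx, hy]
    | single l a =>
      rw [bdry_single, map_zsmul]
      simp only [Finsupp.mapDomain.addMonoidHom_apply, Finsupp.mapDomain_single, bdry_single]
      congr 1
      simp only [tupleBdry, List.length_map]
      split_ifs
      · simp
      · rw [← Finsupp.mapDomain.addMonoidHom_apply, map_sum]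
        simp [Finsupp.mapDomain_single, List.eraseIdx_map]

end Simplicial

section Pairs

/-- A pair of simplicial complexes: a complex `tot` and a subcomplex `sub`. -/
structure SimplicialPair : Type (u + 1) where
  V : Type u
  tot : PreAbstractSimplicialComplex V
  sub : PreAbstractSimplicialComplex V
  le : sub ≤ tot

namespace SimplicialPair

/-- The relative chain complex `C(K, K') = C(K) / C(K')`. -/
noncomputable def cx (P : SimplicialPair.{u}) : ChainCx.{u} :=
  ChainCx.coker (simplicialIncl P.le)

/-- The class in `C(K, K')` of a chain of `K`. -/
noncomputable def relCls (P : SimplicialPair.{u}) (n : ℤ) :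
    (simplicialCx P.tot).X n →+ P.cx.X n :=
  QuotientAddGroup.mk' _

/-- The pair `(K', ∅)`. -/
def subPair (P : SimplicialPair.{u}) : SimplicialPair.{u} := ⟨P.V, P.sub, ⊥, bot_le⟩

/-- The pair `(K, ∅)`. -/
def totPair (P : SimplicialPair.{u}) : SimplicialPair.{u} := ⟨P.V, P.tot, ⊥, bot_le⟩

/-- A chain map of pairs: chain maps `C(K) → C(L)` and `C(K') → C(L')` that are compatible with the
inclusions. -/
structure Map (P Q : SimplicialPair.{u}) where
  big : ChainCx.Map (simplicialCx P.tot) (simplicialCx Q.tot)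
  small : ChainCx.Map (simplicialCx P.sub) (simplicialCx Q.sub)
  comm : ∀ n x, big.f n ((simplicialIncl P.le).f n x) = (simplicialIncl Q.le).f n (small.f n x)

namespace Map

variable {P Q R : SimplicialPair.{u}}

/-- The chain map `C(K, K') → C(L, L')` induced by a chain map of pairs. -/
noncomputable def rel (φ : Map P Q) : ChainCx.Map P.cx Q.cx :=
  ChainCx.cokerMap _ _ φ.small φ.big φ.comm

/-- Composition: `ψ` after `φ`. -/
noncomputable def comp (ψ : Map Q R) (φ : Map P Q) : Map P R where
  big := ψ.big.comp φ.big
  small := ψ.small.comp φ.small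
  comm n x := by
    show ψ.big.f n (φ.big.f n _) = _
    rw [φ.comm, ψ.comm]
    rfl

/-- The chain map of pairs `(K', ∅) → (L', ∅)` given by restriction. -/
noncomputable def onSub (φ : Map P Q) : Map P.subPair Q.subPair where
  big := φ.small
  small := ChainCx.Map.zero _ _
  comm n x := by
    have hx : x = 0 := by
      apply Subtype.ext
      have h0 : elemChains (⊥ : PreAbstractSimplicialComplex P.V) n = ∅ := by
        ext l
        simp only [elemChains, Set.mem_ofPred_eq, Set.mem_empty_iff_false, iff_false]
        rintro ⟨-, s, hs, -⟩
        exact hs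
      have hx' := x.2
      change x.1 ∈ Finsupp.supported ℤ ℤ (elemChains (⊥ : PreAbstractSimplicialComplex P.V) n)
        at hx'
      rw [h0, Finsupp.supported_empty] at hx'
      exact hx'
    subst hx
    simp only [map_zero]

/-- The chain map of pairs induced by an inclusion of pairs of complexes on the same vertices. -/
noncomputable def incl {V : Type u} {K K₁ L L₁ : PreAbstractSimplicialComplex V} (hK : K₁ ≤ K)
    (hL : L₁ ≤ L) (h : K ≤ L) (h₁ : K₁ ≤ L₁) : Map ⟨V, K, K₁, hK⟩ ⟨V, L, L₁, hL⟩ where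
  big := simplicialIncl h
  small := simplicialIncl h₁
  comm _ _ := rfl

/-- The chain map of pairs induced by a simplicial map of pairs. -/
noncomputable def ofSimplicial (f : P.V → Q.V) (hf : IsSimplicialMap P.tot Q.tot f)
    (hf₁ : IsSimplicialMap P.sub Q.sub f) : Map P Q where
  big := simplicialMap f hf
  small := simplicialMap f hf₁
  comm _ _ := rfl

/-- Two chain maps of pairs are homotopic if there are chain homotopies on the complexes and on the
subcomplexes that are compatible with the inclusions. -/
def Homotopic (φ ψ : Map P Q) : Prop :=
  ∃ (D : ∀ {i j : ℤ}, i + 1 = j → ((simplicialCx P.tot).X i →+ (simplicialCx Q.tot).X j))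
    (D₁ : ∀ {i j : ℤ}, i + 1 = j → ((simplicialCx P.sub).X i →+ (simplicialCx Q.sub).X j)),
    (∀ {i j : ℤ} (h : i + 1 = j) (x : (simplicialCx P.sub).X i),
      D h ((simplicialIncl P.le).f i x) = (simplicialIncl Q.le).f j (D₁ h x)) ∧
    (∀ {i j k : ℤ} (h : i + 1 = j) (h' : j + 1 = k) (x : (simplicialCx P.tot).X j),
      (simplicialCx Q.tot).d h' (D h' x) + D h ((simplicialCx P.tot).d h x) =
        ψ.big.f j x - φ.big.f j x) ∧
    (∀ {i j k : ℤ} (h : i + 1 = j) (h' : j + 1 = k) (x : (simplicialCx P.sub).X j),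
      (simplicialCx Q.sub).d h' (D₁ h' x) + D₁ h ((simplicialCx P.sub).d h x) =
        ψ.small.f j x - φ.small.f j x)

end Map

/-- The inclusion `i : (K', ∅) → (K, ∅)`. -/
noncomputable def mapI (P : SimplicialPair.{u}) : Map P.subPair P.totPair :=
  Map.incl bot_le bot_le P.le le_rfl

/-- The inclusion `j : (K, ∅) → (K, K')`. -/
noncomputable def mapJ (P : SimplicialPair.{u}) : Map P.totPair P :=
  Map.incl bot_le P.le le_rfl bot_le

end SimplicialPair

/-- A (triangulated) pair of polyhedra: a pair of countable, locally finite simplicial complexes.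
The vertices are taken in a nonempty countable set `V`, not all of whose elements need be vertices;
in particular the complexes may be empty. -/
structure PolyPair : Type (u + 1) extends SimplicialPair.{u} where
  countable : Countable V
  nonempty : Nonempty V
  locFin : ∀ v, {s | s ∈ tot.faces ∧ v ∈ s}.Finite

namespace PolyPair

/-- The pair `(X', ∅)`, which is identified with the polyhedron `X'`. -/
def subP (P : PolyPair.{u}) : PolyPair.{u} where
  toSimplicialPair := P.toSimplicialPair.subPair
  countable := P.countable
  nonempty := P.nonempty
  locFin v := (P.locFin v).subset fun _ hs => ⟨P.le hs.1, hs.2⟩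

/-- The pair `(X, ∅)`, which is identified with the polyhedron `X`. -/
def totP (P : PolyPair.{u}) : PolyPair.{u} where
  toSimplicialPair := P.toSimplicialPair.totPair
  countable := P.countable
  nonempty := P.nonempty
  locFin := P.locFin

/-- Chain maps between the pairs of chain complexes of two pairs of polyhedra. -/
abbrev ChainMap (P Q : PolyPair.{u}) : Type u :=
  SimplicialPair.Map P.toSimplicialPair Q.toSimplicialPair

instance countable_cx (P : PolyPair.{u}) (n : ℤ) : Countable (P.cx.X n) :=
  haveI := P.countable
  ChainCx.countable_coker (simplicialIncl P.le) n

/-- The integral homology `Hₙ(X, X')`. -/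
noncomputable abbrev H (P : PolyPair.{u}) (n : ℤ) : Type u := P.cx.H n

section Coefficients

variable (P : PolyPair.{u}) (G : Type v) [AddCommGroup G] [TopologicalSpace G]
  [IsTopologicalAddGroup G] [PolishSpace G]

/-- The definable cohomology `Hⁿ(X, X'; G)`. -/
noncomputable abbrev coh (n : ℤ) : PolishCover.{max u v} := P.cx.coh G n

/-- The definable group `Hom(Hₙ(X, X'), G)`. -/
noncomputable abbrev homH (n : ℤ) : PolishCover.{max u v} := homCover (P.H n) G

/-- The definable group `Ext(Hₙ(X, X'), G)`. -/
noncomputable abbrev extH (n : ℤ) : PolishCover.{max u v} := extCover (P.H n) G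

/-- The definable group `PExt(Hₙ(X, X'), G)`. -/
noncomputable abbrev pextH (n : ℤ) : PolishCover.{max u v} := pextCover (P.H n) G

/-- The index homomorphism `Hⁿ(X, X'; G) → Hom(Hₙ(X, X'), G)`. -/
noncomputable abbrev index (n : ℤ) : (P.coh G n).Q →+ (P.homH G n).Q := (P.cx.index G n).map

end Coefficients

/-- The map on homology induced by a chain map of pairs. -/
noncomputable abbrev ChainMap.onH {P Q : PolyPair.{u}} (φ : ChainMap P Q) (n : ℤ) :
    P.H n →+ Q.H n :=
  φ.rel.onH n

/-- The map on definable cohomology induced by a chain map of pairs. -/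
noncomputable abbrev ChainMap.onCoh {P Q : PolyPair.{u}} (φ : ChainMap P Q) (G : Type v)
    [AddCommGroup G] [TopologicalSpace G] [IsTopologicalAddGroup G] [PolishSpace G] (n : ℤ) :
    PolishCover.StrictHom (Q.coh G n) (P.coh G n) :=
  ChainCx.Map.onCoh G φ.rel n

/-- The restriction of a chain map of pairs to a chain map from `(X', ∅)` to `(Y', ∅)`. -/
noncomputable abbrev ChainMap.onSub {P Q : PolyPair.{u}} (φ : ChainMap P Q) :
    ChainMap P.subP Q.subP :=
  SimplicialPair.Map.onSub φ

/-- The inclusion `i : X' → X`. -/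
noncomputable abbrev i (P : PolyPair.{u}) : ChainMap P.subP P.totP := P.toSimplicialPair.mapI

/-- The inclusion `j : X → (X, X')`. -/
noncomputable abbrev j (P : PolyPair.{u}) : ChainMap P.totP P := P.toSimplicialPair.mapJ

/-- A polyhedral cofiltration of a pair of polyhedra. -/
structure Cofiltration (P : PolyPair.{u}) where
  tot : ℕ → PreAbstractSimplicialComplex P.V
  sub : ℕ → PreAbstractSimplicialComplex P.V
  le : ∀ m, sub m ≤ tot m
  finite : ∀ m, (tot m).faces.Finite
  tot_mono : Monotone tot
  sub_mono : Monotone sub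
  tot_union : ∀ s, s ∈ P.tot.faces ↔ ∃ m, s ∈ (tot m).faces
  sub_union : ∀ s, s ∈ P.sub.faces ↔ ∃ m, s ∈ (sub m).faces

namespace Cofiltration

variable {P : PolyPair.{u}} (F : P.Cofiltration)

/-- The pair of compact polyhedra `(Xₘ, X'ₘ)`. -/
def pair (m : ℕ) : PolyPair.{u} where
  V := P.V
  tot := F.tot m
  sub := F.sub m
  le := F.le m
  countable := P.countable
  nonempty := P.nonempty
  locFin _ := (F.finite m).subset fun _ hs => hs.1

/-- The inclusion `(Xₘ, X'ₘ) → (X, X')`. -/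
noncomputable def incl (m : ℕ) : ChainMap (F.pair m) P :=
  SimplicialPair.Map.incl (F.le m) P.le (fun s hs => (F.tot_union s).2 ⟨m, hs⟩)
    (fun s hs => (F.sub_union s).2 ⟨m, hs⟩)

/-- The inclusion `(Xₘ, X'ₘ) → (Xₘ₊₁, X'ₘ₊₁)`. -/
noncomputable def bond (m : ℕ) : ChainMap (F.pair m) (F.pair (m + 1)) :=
  SimplicialPair.Map.incl (F.le m) (F.le (m + 1)) (F.tot_mono m.le_succ) (F.sub_mono m.le_succ)

variable (G : Type v) [AddCommGroup G] [TopologicalSpace G]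
  [IsTopologicalAddGroup G] [PolishSpace G]

/-- The product `∏ₘ Hⁿ(Xₘ, X'ₘ; G)`. -/
noncomputable abbrev prodCoh (n : ℤ) : PolishCover.{max u v} :=
  PolishCover.pi fun m => (F.pair m).coh G n

/-- The homomorphism `Hⁿ(X, X'; G) → ∏ₘ Hⁿ(Xₘ, X'ₘ; G)` given by restriction. -/
noncomputable def localMap (n : ℤ) : (P.coh G n).Q →+ (F.prodCoh G n).Q :=
  (PolishCover.toPi (fun m => (F.pair m).coh G n)
    (fun m => ChainMap.onCoh (F.incl m) G n)).map

/-- The inverse limit `limₘ Hⁿ(Xₘ, X'ₘ; G)`, as a subgroup of the product. -/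
noncomputable def limCoh (n : ℤ) : AddSubgroup (F.prodCoh G n).Q :=
  PolishCover.limSubgroup (fun m => (F.pair m).coh G n)
    (fun m => ChainMap.onCoh (F.bond m) G n)

/-- The coordinate projection `∏ₘ Hⁿ(Xₘ, X'ₘ; G) → Hⁿ(Xₘ, X'ₘ; G)`. -/
noncomputable def projCoh (n : ℤ) (m : ℕ) : (F.prodCoh G n).Q →+ ((F.pair m).coh G n).Q :=
  (PolishCover.proj (fun m => (F.pair m).coh G n) m).map

end Cofiltration

end PolyPair

end Pairs

section ContinuousMaps

/-- The Hilbert space with orthonormal basis indexed by the vertices. -/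
abbrev VertexSpace (V : Type u) : Type u := lp (fun _ : V => ℝ) 2

/-- The closed simplex spanned by the basis vectors of a finite set of vertices. -/
noncomputable def closedSimplex {V : Type u} (s : Finset V) : Set (VertexSpace V) :=
  open scoped Classical in
  convexHull ℝ ((fun v => lp.single 2 v (1 : ℝ)) '' (s : Set V))

/-- The geometric realization of a simplicial complex. -/
noncomputable def realization {V : Type u} (K : PreAbstractSimplicialComplex V) :
    Set (VertexSpace V) :=
  ⋃ s ∈ K.faces, closedSimplex s

/-- A geometric simplicial complex `S` is a subdivision of `K` if each simplex of `S` lies in a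
simplex of `K` and each simplex of `K` is a finite union of simplices of `S`. -/
def IsSubdivision {V : Type u} (K : PreAbstractSimplicialComplex V)
    (S : Geometry.SimplicialComplex ℝ (VertexSpace V)) : Prop :=
  (∀ t ∈ S.faces, ∃ s ∈ K.faces, convexHull ℝ (t : Set (VertexSpace V)) ⊆ closedSimplex s) ∧
  ∀ s ∈ K.faces, ∃ T : Set (Finset (VertexSpace V)), T.Finite ∧ T ⊆ S.faces ∧
    closedSimplex s = ⋃ t ∈ T, convexHull ℝ (t : Set (VertexSpace V))

/-- The pair of complexes given by a geometric complex `S` and its simplices that lie in `|K'|`. -/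
def subdivisionPair {V : Type u} (S : Geometry.SimplicialComplex ℝ (VertexSpace V))
    (K : PreAbstractSimplicialComplex V) : SimplicialPair.{u} where
  V := VertexSpace V
  tot := S.toPreAbstractSimplicialComplex
  sub :=
    { faces := {t | t ∈ S.faces ∧ convexHull ℝ (t : Set (VertexSpace V)) ⊆ realization K}
      isRelLowerSet_faces := fun {_} ht => ⟨(S.isRelLowerSet_faces ht.1).1, fun _ hr hne =>
        ⟨(S.isRelLowerSet_faces ht.1).2 hr hne,
          (convexHull_mono (Finset.coe_subset.2 hr)).trans ht.2⟩⟩ }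
  le := fun _ ht => ht.1

/-- The open star of a vertex `p` of `S`: the points all of whose simplices contain `p`. -/
def openStar {V : Type u} (S : Geometry.SimplicialComplex ℝ (VertexSpace V)) (p : VertexSpace V) :
    Set (VertexSpace V) :=
  {x | x ∈ S.space ∧ ∀ t ∈ S.faces, x ∈ convexHull ℝ (t : Set (VertexSpace V)) → p ∈ t}

/-- A vertex map `f` from `S` to `L` is a simplicial approximation of `α` if `α` maps the open star
of each vertex `p` to the open star of `f p`, the set of points with nonzero coordinate at `f p`. -/
def IsSimplicialApprox {V W : Type u} {K : PreAbstractSimplicialComplex V}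
    {L : PreAbstractSimplicialComplex W} (S : Geometry.SimplicialComplex ℝ (VertexSpace V))
    (f : VertexSpace V → W) (α : realization K → realization L) : Prop :=
  ∀ p, {p} ∈ S.faces → ∀ x : realization K, x.1 ∈ openStar S p → (α x).1 (f p) ≠ 0

/-- A continuous map of pairs of polyhedra `(X, X') → (Y, Y')`. -/
structure PolyPair.ContMap (P Q : PolyPair.{u}) where
  toFun : realization P.tot → realization Q.tot
  cont : Continuous toFun
  maps_sub : ∀ x, x.1 ∈ realization P.sub → (toFun x).1 ∈ realization Q.sub

/-- The chain map of pairs `φ` belongs to the homotopy class assigned to the continuous map `α`: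
there are a subdivision of `(K, K')`, a simplicial approximation `f` of `α` and a simplicial
approximation `g` of the identity, both defined on the subdivision, such that `φ ∘ g` is homotopic
to `f`. The homomorphisms that `α` induces on homology and on cohomology are those of `φ`. -/
def PolyPair.ContMap.Induces {P Q : PolyPair.{u}} (α : P.ContMap Q) (φ : P.ChainMap Q) : Prop :=
  ∃ (S : Geometry.SimplicialComplex ℝ (VertexSpace P.V)) (f : VertexSpace P.V → Q.V)
    (g : VertexSpace P.V → P.V)
    (hf : IsSimplicialMap (subdivisionPair S P.sub).tot Q.tot f)
    (hf₁ : IsSimplicialMap (subdivisionPair S P.sub).sub Q.sub f)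
    (hg : IsSimplicialMap (subdivisionPair S P.sub).tot P.tot g)
    (hg₁ : IsSimplicialMap (subdivisionPair S P.sub).sub P.sub g),
    IsSubdivision P.tot S ∧ IsSimplicialApprox S f α.toFun ∧
    IsSimplicialApprox S g (id : realization P.tot → realization P.tot) ∧
    SimplicialPair.Map.Homotopic
      (φ.comp (SimplicialPair.Map.ofSimplicial (P := subdivisionPair S P.sub) g hg hg₁))
      (SimplicialPair.Map.ofSimplicial (P := subdivisionPair S P.sub) f hf hf₁)

end ContinuousMaps

section UCTMaps

/-- Families of homomorphisms indexed by the pairs of polyhedra and the degrees. -/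
structure UCTMaps (G : Type v) [AddCommGroup G] [TopologicalSpace G]
    [IsTopologicalAddGroup G] [PolishSpace G] where
  coIndex : ∀ (P : PolyPair.{u}) {m n : ℤ}, m + 1 = n → ((P.extH G m).Q →+ (P.coh G n).Q)
  coIndexInf : ∀ (P : PolyPair.{u}) {m n : ℤ}, m + 1 = n →
    ((P.pextH G m).Q ≃+ (P.coh G n).asymptotic.Q)
  dCoh : ∀ (P : PolyPair.{u}) {m n : ℤ}, m + 1 = n → ((P.subP.coh G m).Q →+ (P.coh G n).Q)
  dHom : ∀ (P : PolyPair.{u}) {m n : ℤ}, m + 1 = n → (P.H n →+ P.subP.H m)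

variable {G : Type v} [AddCommGroup G] [TopologicalSpace G]
  [IsTopologicalAddGroup G] [PolishSpace G]

/-- The formula for the co-index homomorphism. The identification of `Ext(Hₘ, G)` with
`Hom(Bₘ, G) / Hom(Zₘ | Bₘ, G)` sends the class of a cocycle `c` to the class of `ρ` restricted to
`Bₘ`, where `ρ : Zₘ → G` satisfies `ρ (x + y) = ρ x + ρ y + c ([x], [y])`; the co-index sends the
class of `ρ` to the class of the cocycle `(-1)ⁿ ρ ∘ ∂`. -/
def IsCoIndex (P : PolyPair.{u}) {m n : ℤ} (h : m + 1 = n)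
    (f : (P.extH G m).Q →+ (P.coh G n).Q) : Prop :=
  ∀ (c : extCocycles (P.H m) G) (ρ : P.cx.cycles m → G) (w : P.cx.cocycles G n),
    (∀ x y, ρ (x + y) = ρ x + ρ y + c.1 (P.cx.hcls x, P.cx.hcls y)) →
    (∀ (x : P.cx.X n) (y : P.cx.cycles m), y.1 = P.cx.d h x →
      w.1 x = (n.negOnePow : ℤ) • ρ y) →
    f ((P.extH G m).cls c) = (P.coh G n).cls w

/-- The formula for the connecting homomorphism in cohomology: a cocycle `z` on `X'` is extended to
a cochain `e` on `X`, and the class of `z` is sent to the class of `e ∘ ∂`. -/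
def IsConnectingCoh (P : PolyPair.{u}) {m n : ℤ} (h : m + 1 = n)
    (f : (P.subP.coh G m).Q →+ (P.coh G n).Q) : Prop :=
  ∀ (z : P.subP.cx.cocycles G m) (e : (simplicialCx P.tot).X m →+ G) (w : P.cx.cocycles G n),
    (∀ y, e ((simplicialIncl P.le).f m y) = z.1 (P.subP.relCls m y)) →
    (∀ x, w.1 (P.relCls n x) = e ((simplicialCx P.tot).d h x)) →
    f ((P.subP.coh G m).cls z) = (P.coh G n).cls w

/-- The formula for the connecting homomorphism in homology: the class of a relative cycle given by
a chain `x` of `X` is sent to the class of `∂ x`, a cycle of `X'`. -/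
def IsConnectingHom (P : PolyPair.{u}) {m n : ℤ} (h : m + 1 = n)
    (f : P.H n →+ P.subP.H m) : Prop :=
  ∀ (x : (simplicialCx P.tot).X n) (y : (simplicialCx P.sub).X m)
    (hx : P.relCls n x ∈ P.cx.cycles n) (hy : P.subP.relCls m y ∈ P.subP.cx.cycles m),
    (simplicialIncl P.le).f m y = (simplicialCx P.tot).d h x →
    f (P.cx.hcls ⟨_, hx⟩) = P.subP.cx.hcls ⟨_, hy⟩

/-- All homomorphisms in the statement commute with the homomorphisms induced by `φ`. -/
def UCTMaps.NaturalAt (D : UCTMaps.{u} G) {P Q : PolyPair.{u}} (φ : P.ChainMap Q) : Prop :=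
  (∀ {m n : ℤ} (h : m + 1 = n) (x : (Q.extH G m).Q),
    D.coIndex P h ((extMap G (φ.onH m)).map x) = (φ.onCoh G n).map (D.coIndex Q h x)) ∧
  (∀ (n : ℤ) (x : (Q.coh G n).Q),
    P.index G n ((φ.onCoh G n).map x) = (homMap G (φ.onH n)).map (Q.index G n x)) ∧
  (∀ {m n : ℤ} (h : m + 1 = n) (x : (Q.pextH G m).Q),
    D.coIndexInf P h ((extMap G (φ.onH m)).asymptotic.map x) =
      (φ.onCoh G n).asymptotic.map (D.coIndexInf Q h x)) ∧
  (∀ (F : P.Cofiltration) (E : Q.Cofiltration) (m t : ℕ) (ψ : (F.pair m).ChainMap (E.pair t)),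
    SimplicialPair.Map.Homotopic (φ.comp (F.incl m)) ((E.incl t).comp ψ) →
    ∀ (n : ℤ) (x : (Q.coh G n).Q),
      F.projCoh G n m (F.localMap G n ((φ.onCoh G n).map x)) =
        (ψ.onCoh G n).map (E.projCoh G n t (E.localMap G n x))) ∧
  (∀ {m n : ℤ} (h : m + 1 = n) (x : (Q.subP.coh G m).Q),
    D.dCoh P h ((φ.onSub.onCoh G m).map x) = (φ.onCoh G n).map (D.dCoh Q h x)) ∧
  ∀ {m n : ℤ} (h : m + 1 = n) (x : P.H n),
    D.dHom Q h (φ.onH n x) = φ.onSub.onH m (D.dHom P h x)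

end UCTMaps

/-! ### Subgroups of free abelian groups and splitting over free quotients. -/

section FreeModules

/-! Everything is obtained on explicit cocycles, from the freeness of relative chain groups.
Boundaries are then free, so the cycles are a direct summand of the chains. If `c` is a symmetric
cocycle on `H_m`, its pullback to the free group of cycles splits, say with primitive `ρ`; then `ρ`
is additive on adding a boundary, and `±ρ ∘ ∂` is a cochain cocycle. Applying the splitting once to
the tautological cocycle, with values in the continuous homomorphisms from cocycles to `G`, makes
`ρ` depend on `c` additively and continuously (`exists_continuous_primitive`), so that `coIndex`
lifts to a continuous homomorphism of Polish covers.

The inverse direction restricts a cochain cocycle to boundaries through a section of `∂`, and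
evaluates the result on `t a + t b - t (a + b)`, where `t` picks cycles representing homology
classes. A retraction of chains onto cycles gives the section of `index`. All exactness statements
of the UCT sequence follow from the identities in `coIndexRetraction_coIndex`, `index_indexSection`
and `coIndex_add_indexSection`. Since `{0}` is closed in `Hom(H_n, G)`, the index kills the
asymptotic group, and the same splitting restricts to an isomorphism from `PExt`.

For `Local`, Smith normal form turns being a coboundary on a finite complex into vanishing on cycles
together with finitely many divisibility conditions, and these are closed by the division closure
property (`isClosed_coh_sub`). Restrictions of cochains to an exhausting sequence of summands are
surjective; hence a cocycle that is locally a coboundary is a limit of coboundaries, and locally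
compatible classes can be corrected to glue (`mem_closure_of_forall_coboundary`, `exists_glue`). The
relative chains of `(K_m, K'_m)` need not embed in those of `(K, K')`, because `K'_m` may be smaller
than `K_m ∩ K'`. Replacing `K'_m` by this intersection gives an interleaved tower to which the
argument applies.

For the long exact sequences, a degreewise splitting of the chain sequence gives a degree `-1` map
that anticommutes with the differentials and induces both connecting homomorphisms. That sign is
what the factor `(-1)^n` in `coIndex` compensates. Naturality holds because the formulas do not
depend on the choice of `ρ` or of the cochain extension. -/

/-- A submodule of a free module over a principal ideal domain is free. -/
theorem Submodule.free_of_finsupp {R ι : Type*} [CommRing R] [IsDomain R] [IsPrincipalIdealRing R]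
    (N : Submodule R (ι →₀ R)) : Module.Free R N := by
  classical
  obtain ⟨_, _⟩ := exists_wellFoundedLT ι
  -- For a well-ordering of the index set, `I i` is the ideal of leading coefficients at `i`.
  -- Elements `b i` realizing generators of these ideals form a triangular family, whose nonzero
  -- leading terms give the basis.
  let I : ι → Ideal R := fun i =>
    (N ⊓ Finsupp.supported R R (Set.Iic i)).map (Finsupp.lapply i)
  have hb : ∀ i, ∃ b : N, (∀ j, i < j → b.1 j = 0) ∧ I i = Ideal.span {b.1 i} := by
    intro i
    obtain ⟨a, ha⟩ := IsPrincipalIdealRing.principal (I i)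
    have : a ∈ I i := by rw [ha]; exact Submodule.mem_span_singleton_self a
    obtain ⟨x, ⟨hx, hx'⟩, rfl⟩ := this
    refine ⟨⟨x, hx⟩, fun j hj => ?_, ha⟩
    by_contra h0
    exact absurd (hx' (Finsupp.mem_support_iff.2 h0)) (not_le.2 hj)
  choose b hb0 hbI using hb
  let J := {i // (b i).1 i ≠ 0}
  have hspan : ∀ i, ∀ x : N, (∀ j, i < j → x.1 j = 0) →
      x ∈ Submodule.span R (Set.range fun k : J => b k.1) := by
    intro i
    induction i using WellFoundedLT.induction with
    | ind i ih =>
      intro x hx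
      have hxI : x.1 i ∈ I i := by
        refine ⟨x.1, ⟨x.2, fun j hj => ?_⟩, rfl⟩
        by_contra h0
        exact Finsupp.mem_support_iff.1 hj (hx j (not_le.1 h0))
      rw [hbI, Ideal.mem_span_singleton'] at hxI
      obtain ⟨c, hc⟩ := hxI
      have hmem : c • b i ∈ Submodule.span R (Set.range fun k : J => b k.1) := by
        -- If `I i = 0`, the chosen `b i` is left out of the basis but need not vanish. Its leading
        -- index is then below `i`, so the induction hypothesis covers it.
        by_cases h0 : (b i).1 i = 0
        · have : b i ∈ Submodule.span R (Set.range fun k : J => b k.1) := by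
            by_cases hbi : (b i).1 = 0
            · rw [show b i = 0 from Subtype.ext hbi]
              exact zero_mem _
            · have hne : (b i).1.support.Nonempty := Finsupp.support_nonempty_iff.2 hbi
              set k := (b i).1.support.max' hne with hk
              have hk1 : (b i).1 k ≠ 0 :=
                Finsupp.mem_support_iff.1 (Finset.max'_mem _ hne)
              have hki : k < i := by
                rcases lt_trichotomy k i with h | h | h
                · exact h
                · rw [h] at hk1
                  exact absurd h0 hk1
                · exact absurd (hb0 i k h) hk1
              refine ih k hki (b i) fun j hj => ?_
              by_contra h1
              exact absurd (Finset.le_max' _ _ (Finsupp.mem_support_iff.2 h1)) (not_le.2 hj)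
          exact Submodule.smul_mem _ _ this
        · exact Submodule.smul_mem _ _ (Submodule.subset_span ⟨⟨i, h0⟩, rfl⟩)
      suffices h : x - c • b i ∈ Submodule.span R (Set.range fun k : J => b k.1) by
        rw [← sub_add_cancel x (c • b i)]
        exact Submodule.add_mem _ h hmem
      have hy : ∀ j, i ≤ j → (x - c • b i).1 j = 0 := by
        intro j hj
        rcases hj.eq_or_lt with rfl | hj
        · simp [hc]
        · simp [hx j hj, hb0 i j hj]
      generalize x - c • b i = y at hy
      by_cases hy0 : y.1 = 0
      · rw [show y = 0 from Subtype.ext hy0]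
        exact zero_mem _
      have hne : y.1.support.Nonempty := Finsupp.support_nonempty_iff.2 hy0
      refine ih (y.1.support.max' hne) ?_ y fun j hj => ?_
      · by_contra h
        exact Finsupp.mem_support_iff.1 (Finset.max'_mem _ hne) (hy _ (not_lt.1 h))
      · by_contra h1
        exact absurd (Finset.le_max' _ _ (Finsupp.mem_support_iff.2 h1)) (not_le.2 hj)
  have hli : LinearIndependent R (fun k : J => b k.1) := by
    refine LinearIndependent.of_comp N.subtype ?_
    refine linearIndependent_iff.2 fun l hl => ?_
    by_contra hl0
    have hne : l.support.Nonempty := Finsupp.support_nonempty_iff.2 hl0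
    set k := l.support.max' hne with hk
    -- At the largest index `k` of the relation only the `k`-th term contributes, by triangularity.
    have h1 : Finsupp.linearCombination R (N.subtype ∘ fun k : J => b k.1) l k.1 =
        l k * (b k.1).1 k.1 := by
      rw [Finsupp.linearCombination_apply, Finsupp.sum]
      simp only [Finsupp.coe_finsetSum, Finset.sum_apply]
      rw [Finset.sum_eq_single k]
      · simp
      · intro j hj hjk
        have : j < k := lt_of_le_of_ne (Finset.le_max' _ _ hj) hjk
        simp [hb0 j.1 k.1 this]
      · intro h
        exact absurd (Finset.max'_mem _ hne) h
    rw [hl] at h1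
    exact mul_ne_zero (Finsupp.mem_support_iff.1 (Finset.max'_mem _ hne)) k.2 h1.symm
  refine Module.Free.of_basis (Module.Basis.mk hli ?_)
  intro x _
  by_cases hx0 : x.1 = 0
  · rw [show x = 0 from Subtype.ext hx0]
    exact zero_mem _
  have hne : x.1.support.Nonempty := Finsupp.support_nonempty_iff.2 hx0
  refine hspan (x.1.support.max' hne) x fun j hj => ?_
  by_contra h1
  exact absurd (Finset.le_max' _ _ (Finsupp.mem_support_iff.2 h1)) (not_le.2 hj)

/-- A group that embeds into a free abelian group is free abelian. -/
theorem AddMonoidHom.free_of_injective {A F : Type*} [AddCommGroup A] [AddCommGroup F]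
    [Module.Free ℤ F] (f : A →+ F) (hf : Function.Injective f) : Module.Free ℤ A := by
  let e := (Module.Free.chooseBasis ℤ F).repr
  let g : A →ₗ[ℤ] (Module.Free.ChooseBasisIndex ℤ F →₀ ℤ) := e.toLinearMap ∘ₗ f.toIntLinearMap
  have hg : Function.Injective g := e.injective.comp hf
  have := Submodule.free_of_finsupp (LinearMap.range g)
  exact Module.Free.of_equiv (LinearEquiv.ofInjective g hg).symm

instance AddSubgroup.free_int {F : Type*} [AddCommGroup F] [Module.Free ℤ F]
    (A : AddSubgroup F) : Module.Free ℤ A :=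
  A.subtype.free_of_injective A.subtype_injective

/-- A surjective homomorphism onto a free abelian group has a section. -/
theorem AddMonoidHom.exists_section {E Z : Type*} [AddCommGroup E] [AddCommGroup Z]
    [Module.Free ℤ Z] (f : E →+ Z) (hf : Function.Surjective f) :
    ∃ s : Z →+ E, ∀ z, f (s z) = z := by
  obtain ⟨s, hs⟩ := Module.projective_lifting_property f.toIntLinearMap LinearMap.id hf
  exact ⟨s.toAddMonoidHom, fun z => LinearMap.congr_fun hs z⟩

end FreeModules

/-! ### Symmetric cocycles, extensions and primitives over free groups. -/

section Extensions

/-- The extension of `A` by `M` determined by a normalized symmetric 2-cocycle. -/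
structure CocycleExtension {A M : Type*} [AddCommGroup A] [AddCommGroup M]
    (c : extCocycles A M) where
  fst : M
  snd : A

namespace CocycleExtension

variable {A M : Type*} [AddCommGroup A] [AddCommGroup M] (c : extCocycles A M)

attribute [ext] CocycleExtension

instance : Add (CocycleExtension c) :=
  ⟨fun x y => ⟨x.fst + y.fst + c.1 (x.snd, y.snd), x.snd + y.snd⟩⟩
instance : Zero (CocycleExtension c) := ⟨⟨0, 0⟩⟩
instance : Neg (CocycleExtension c) := ⟨fun x => ⟨-x.fst - c.1 (x.snd, -x.snd), -x.snd⟩⟩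

variable {c}

theorem fst_add (x y : CocycleExtension c) :
    (x + y).fst = x.fst + y.fst + c.1 (x.snd, y.snd) := rfl
theorem snd_add (x y : CocycleExtension c) : (x + y).snd = x.snd + y.snd := rfl
theorem fst_zero : (0 : CocycleExtension c).fst = 0 := rfl
theorem snd_zero : (0 : CocycleExtension c).snd = 0 := rfl
theorem fst_neg (x : CocycleExtension c) : (-x).fst = -x.fst - c.1 (x.snd, -x.snd) := rfl
theorem snd_neg (x : CocycleExtension c) : (-x).snd = -x.snd := rfl

instance : AddCommGroup (CocycleExtension c) where
  add_assoc x y z := by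
    ext
    · simp only [fst_add, snd_add]
      -- The cocycle identity is stated in the form that exchanges the last two arguments. With the
      -- first two arguments permuted and symmetry applied, it becomes the usual associativity
      -- identity.
      have h := c.2.2.2 y.snd x.snd z.snd
      rw [c.2.2.1 y.snd x.snd, add_comm y.snd x.snd, c.2.2.1 (y.snd + z.snd)] at h
      calc _ = x.fst + y.fst + z.fst + (c.1 (x.snd, y.snd) + c.1 (x.snd + y.snd, z.snd)) := by abel
        _ = _ := by rw [h]; abel
    · simp only [snd_add, add_assoc]
  zero_add x := by
    ext
    · simp [fst_add, fst_zero, snd_zero, c.2.2.1 0, c.2.1]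
    · simp [snd_add, snd_zero]
  add_zero x := by
    ext
    · simp [fst_add, fst_zero, snd_zero, c.2.1]
    · simp [snd_add, snd_zero]
  add_comm x y := by
    ext
    · simp only [fst_add, c.2.2.1 x.snd, add_comm x.fst]
    · simp only [snd_add, add_comm]
  neg_add_cancel x := by
    ext
    · simp only [fst_add, fst_neg, snd_neg, fst_zero, c.2.2.1 (-x.snd)]
      abel
    · simp [snd_add, snd_neg, snd_zero]
  nsmul := nsmulRec
  zsmul := zsmulRec

/-- The projection of the extension onto the quotient. -/
def proj (c : extCocycles A M) : CocycleExtension c →+ A where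
  toFun := snd
  map_zero' := rfl
  map_add' _ _ := rfl

end CocycleExtension

/-- A symmetric cocycle on a free abelian group is a coboundary. -/
theorem exists_primitive_of_free {A M : Type*} [AddCommGroup A] [AddCommGroup M]
    [Module.Free ℤ A] (c : extCocycles A M) :
    ∃ ρ : A → M, ∀ x y, ρ (x + y) = ρ x + ρ y + c.1 (x, y) := by
  -- The extension splits over a free group, and the additivity of the section says precisely that
  -- its first coordinate is a primitive of `c`.
  obtain ⟨s, hs⟩ := (CocycleExtension.proj c).exists_section fun a => ⟨⟨0, a⟩, rfl⟩
  have hs' : ∀ a, (s a).snd = a := hs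
  refine ⟨fun a => (s a).fst, fun x y => ?_⟩
  simp only [map_add, CocycleExtension.fst_add, hs']

/-- The coefficients at a point form a continuous homomorphism on the group of cocycles. -/
def extCocycles.eval {A : Type u} {G : Type v} [AddCommGroup A] [AddCommGroup G]
    [TopologicalSpace G] [IsTopologicalAddGroup G] (p : A × A) :
    ContinuousAddMonoidHom (extCocycles A G) G where
  toFun c := c.1 p
  map_zero' := rfl
  map_add' _ _ := rfl
  continuous_toFun := (continuous_apply p).comp continuous_subtype_val

/-- The pullbacks of cocycles to a free abelian group are the coboundaries of functions that depend
on the cocycle by continuous homomorphisms. -/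
theorem exists_continuous_primitive {Z : Type*} {A : Type u} {G : Type v} [AddCommGroup Z]
    [Module.Free ℤ Z] [AddCommGroup A] [AddCommGroup G] [TopologicalSpace G]
    [IsTopologicalAddGroup G] (π : Z →+ A) :
    ∃ ρ : Z → ContinuousAddMonoidHom (extCocycles A G) G, ∀ (c : extCocycles A G) (x y : Z),
      ρ (x + y) c = ρ x c + ρ y c + c.1 (π x, π y) := by
  -- The universal cocycle: its value at a pair is evaluation of cocycles at that pair. A primitive
  -- of it serves all `c` at once and depends continuously and additively on `c`.
  let C : extCocycles Z (ContinuousAddMonoidHom (extCocycles A G) G) :=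
    ⟨fun p => extCocycles.eval (π p.1, π p.2), by
      refine ⟨fun x => ?_, fun x y => ?_, fun x y z => ?_⟩
      · ext c
        show c.1 (π x, π 0) = 0
        rw [map_zero, c.2.1]
      · ext c
        exact c.2.2.1 _ _
      · ext c
        show c.1 (π x, π y) + c.1 (π (x + y), π z) = c.1 (π x, π z) + c.1 (π (x + z), π y)
        rw [map_add, map_add, c.2.2.2]⟩
  obtain ⟨ρ, hρ⟩ := exists_primitive_of_free C
  exact ⟨ρ, fun c x y => DFunLike.congr_fun (hρ x y) c⟩

end Extensions

theorem Int.negOnePow_smul_smul {G : Type*} [AddCommGroup G] (n : ℤ) (g : G) :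
    (n.negOnePow : ℤ) • (n.negOnePow : ℤ) • g = g := by
  rw [smul_smul, ← Units.val_mul, Int.units_mul_self, Units.val_one, one_smul]

/-! ### Asymptotic groups of groups with a Polish cover. -/

namespace PolishCover

theorem cls_eq_iff (A : PolishCover.{u}) {x y : A.carrier} :
    A.cls x = A.cls y ↔ x - y ∈ A.sub :=
  QuotientAddGroup.eq_iff_sub_mem

theorem cls_surjective (A : PolishCover.{u}) : Function.Surjective A.cls :=
  QuotientAddGroup.mk_surjective

theorem StrictHom.contDef {A B : PolishCover.{u}} (f : StrictHom A B) : ContDef f.map :=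
  ⟨f.toHom, f.cont, fun _ => rfl⟩

theorem StrictHom.map_cls {A B : PolishCover.{u}} (f : StrictHom A B) (x : A.carrier) :
    f.map (A.cls x) = B.cls (f.toHom x) := rfl

theorem asymptoticIncl_injective (A : PolishCover.{u}) :
    Function.Injective A.asymptoticIncl.map := by
  rw [injective_iff_map_eq_zero]
  intro x hx
  obtain ⟨x, rfl⟩ := A.asymptotic.cls_surjective x
  rw [StrictHom.map_cls] at hx
  exact (QuotientAddGroup.eq_zero_iff _).2
    ((QuotientAddGroup.eq_zero_iff (A.asymptoticIncl.toHom x)).1 hx)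

theorem StrictHom.asymptoticIncl_map {A B : PolishCover.{u}} (f : StrictHom A B)
    (x : A.asymptotic.Q) :
    B.asymptoticIncl.map (f.asymptotic.map x) = f.map (A.asymptoticIncl.map x) := by
  obtain ⟨x, rfl⟩ := A.asymptotic.cls_surjective x
  rfl

/-- A continuous lift carries the closure of `A.sub` into the closure of `B.sub`, which is `B.sub`
itself. -/
theorem StrictHom.asymptoticIncl_map_eq_zero {A B : PolishCover.{u}} (f : StrictHom A B)
    (hB : IsClosed (B.sub : Set B.carrier)) (x : A.asymptotic.Q) :
    f.map (A.asymptoticIncl.map x) = 0 := by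
  obtain ⟨x, rfl⟩ := A.asymptotic.cls_surjective x
  refine (QuotientAddGroup.eq_zero_iff (f.toHom x.1)).2 ?_
  have := (f.asymptotic.toHom x).2
  rwa [← SetLike.mem_coe, AddSubgroup.topologicalClosure_coe, hB.closure_eq] at this

theorem exists_asymptoticIncl_map_eq (A : PolishCover.{u}) (x : A.Q) :
    (∃ y, A.asymptoticIncl.map y = x) ↔ ∃ z ∈ A.sub.topologicalClosure, A.cls z = x := by
  constructor
  · rintro ⟨y, rfl⟩
    obtain ⟨y, rfl⟩ := A.asymptotic.cls_surjective y
    exact ⟨y.1, y.2, rfl⟩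
  · rintro ⟨z, hz, rfl⟩
    exact ⟨A.asymptotic.cls ⟨z, hz⟩, rfl⟩

end PolishCover

/-! ### Cycles, boundaries and cohomology classes in arbitrary adjacent degrees. -/

namespace ChainCx

variable (C : ChainCx.{u})

theorem mem_cycles {m n : ℤ} (h : m + 1 = n) {x : C.X n} : x ∈ C.cycles n ↔ C.d h x = 0 := by
  obtain rfl : m = n - 1 := by omega
  exact Iff.rfl

theorem mem_boundaries {m n : ℤ} (h : m + 1 = n) {x : C.X m} :
    x ∈ C.boundaries m ↔ ∃ y, C.d h y = x := by
  subst h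
  exact Iff.rfl

theorem d_mem_cycles {m n : ℤ} (h : m + 1 = n) (x : C.X n) : C.d h x ∈ C.cycles m :=
  (C.mem_cycles (sub_add_cancel m 1)).2 (C.d_d _ _ _)

theorem mem_cocycles {G : Type v} [AddCommGroup G] {m n : ℤ} (h : m + 1 = n) {z : C.X m →+ G} :
    z ∈ C.cocycles G m ↔ ∀ x, z (C.d h x) = 0 := by
  subst h
  exact DFunLike.ext_iff

theorem mem_coboundaries {G : Type v} [AddCommGroup G] {m n : ℤ} (h : m + 1 = n)
    {z : C.X n →+ G} :
    z ∈ C.coboundaries G n ↔ ∃ y : C.X m →+ G, ∀ x, z x = y (C.d h x) := by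
  obtain rfl : m = n - 1 := by omega
  exact ⟨fun ⟨y, hy⟩ => ⟨y, fun x => DFunLike.congr_fun hy.symm x⟩,
    fun ⟨y, hy⟩ => ⟨y, AddMonoidHom.ext fun x => (hy x).symm⟩⟩

theorem hcls_eq_iff {m n : ℤ} (h : m + 1 = n) {x y : C.cycles m} :
    C.hcls x = C.hcls y ↔ ∃ b, C.d h b = x.1 - y.1 := by
  rw [← C.mem_boundaries h]
  exact QuotientAddGroup.eq_iff_sub_mem

theorem hcls_eq_zero_iff {m n : ℤ} (h : m + 1 = n) {x : C.cycles m} :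
    C.hcls x = 0 ↔ ∃ b, C.d h b = x.1 := by
  rw [← C.mem_boundaries h]
  exact QuotientAddGroup.eq_zero_iff x

theorem hcls_surjective (n : ℤ) : Function.Surjective (C.hcls (n := n)) :=
  QuotientAddGroup.mk_surjective

section Coh

variable {C} {G : Type v} [AddCommGroup G] [TopologicalSpace G] [IsTopologicalAddGroup G]
  [PolishSpace G] [hC : ∀ n, Countable (C.X n)]

theorem coh_cls_eq_iff {m n : ℤ} (h : m + 1 = n) {z w : C.cocycles G n} :
    (C.coh G n).cls z = (C.coh G n).cls w ↔
      ∃ y : C.X m →+ G, ∀ x, z.1 x - w.1 x = y (C.d h x) :=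
  ((C.coh G n).cls_eq_iff (x := z) (y := w)).trans (C.mem_coboundaries h)

theorem coh_cls_eq_zero_iff {m n : ℤ} (h : m + 1 = n) {z : C.cocycles G n} :
    (C.coh G n).cls z = 0 ↔ ∃ y : C.X m →+ G, ∀ x, z.1 x = y (C.d h x) :=
  (QuotientAddGroup.eq_zero_iff (N := (C.coh G n).sub) z).trans (C.mem_coboundaries h)

/-- Functions on the cycles with the same cocycle define cohomologous cocycles. -/
theorem coh_cls_eq_of_primitive [∀ n, Module.Free ℤ (C.X n)] {m n : ℤ} (h : m + 1 = n) (k : ℤ)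
    {ρ ρ' : C.cycles m → G} {f : C.cycles m → C.cycles m → G}
    (hρ : ∀ x y, ρ (x + y) = ρ x + ρ y + f x y)
    (hρ' : ∀ x y, ρ' (x + y) = ρ' x + ρ' y + f x y) {w w' : C.cocycles G n}
    (hw : ∀ x, w.1 x = k • ρ ⟨_, C.d_mem_cycles h x⟩)
    (hw' : ∀ x, w'.1 x = k • ρ' ⟨_, C.d_mem_cycles h x⟩) :
    (C.coh G n).cls w = (C.coh G n).cls w' := by
  -- The defects of additivity of `ρ` and `ρ'` cancel, so their difference is a homomorphism on
  -- cycles. It extends to all chains through the retraction `p`, and the extension bounds `w - w'`.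
  let τ : C.cycles m →+ G := AddMonoidHom.mk' (fun x => ρ x - ρ' x) fun x y => by
    rw [hρ, hρ']
    abel
  obtain ⟨s, hs⟩ := (C.d (sub_add_cancel m 1)).rangeRestrict.exists_section
    (AddMonoidHom.rangeRestrict_surjective _)
  have hs' : ∀ b, C.d (sub_add_cancel m 1) (s b) = b.1 := fun b => congrArg Subtype.val (hs b)
  let p : C.X m →+ C.cycles m :=
    (AddMonoidHom.id _ - s.comp (C.d (sub_add_cancel m 1)).rangeRestrict).codRestrict _ fun x => by
      rw [C.mem_cycles (sub_add_cancel m 1)]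
      simp [hs']
  refine (coh_cls_eq_iff h).2 ⟨k • τ.comp p, fun x => ?_⟩
  have hp : p (C.d h x) = ⟨_, C.d_mem_cycles h x⟩ := by
    apply Subtype.ext
    have h0 : (C.d (sub_add_cancel m 1)).rangeRestrict (C.d h x) = 0 :=
      Subtype.ext (C.d_d _ _ _)
    show C.d h x - s ((C.d (sub_add_cancel m 1)).rangeRestrict (C.d h x)) = C.d h x
    rw [h0, map_zero, sub_zero]
  rw [hw, hw', ← smul_sub]
  show _ = k • τ (p (C.d h x))
  rw [hp]
  rfl

end Coh

/-! ### The split universal coefficient sequence of a free chain complex. -/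

section UCT

variable {m n : ℤ}

/-- The normalization at `0` makes the cocycle built from the representatives normalized, and makes
`repDiff` fix boundaries. -/
theorem exists_cycleRep (m : ℤ) :
    ∃ t : C.H m → C.cycles m, (∀ a, C.hcls (t a) = a) ∧ t 0 = 0 := by
  classical
  refine ⟨fun a => if a = 0 then 0 else (C.hcls_surjective m a).choose, fun a => ?_, if_pos rfl⟩
  dsimp only
  split_ifs with h0
  · rw [h0]
    rfl
  · exact (C.hcls_surjective m a).choose_spec

/-- A choice of cycles that represent the homology classes. -/
noncomputable def cycleRep (a : C.H m) : C.cycles m := (C.exists_cycleRep m).choose a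

theorem hcls_cycleRep (a : C.H m) : C.hcls (C.cycleRep a) = a :=
  (C.exists_cycleRep m).choose_spec.1 a

theorem hcls_cycleRep_add (a b : C.H m) : C.hcls (C.cycleRep a + C.cycleRep b) = a + b := by
  show C.hcls _ + C.hcls _ = _
  rw [hcls_cycleRep, hcls_cycleRep]

theorem cycleRep_zero : C.cycleRep (0 : C.H m) = 0 := (C.exists_cycleRep m).choose_spec.2

variable (h : m + 1 = n)

/-- The difference of a cycle and the chosen representative of its class, as a boundary. -/
noncomputable def repDiff (x : C.cycles m) : (C.d h).range :=
  ⟨x.1 - (C.cycleRep (C.hcls x)).1, (C.hcls_eq_iff h).1 (C.hcls_cycleRep _).symm⟩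

/-- The failure of additivity of `x ↦ x - t [x]` is the boundary `t [x] + t [y] - t [x + y]`, which
depends on the homology classes only. -/
theorem repDiff_add (x y : C.cycles m) :
    C.repDiff h (x + y) = C.repDiff h x + C.repDiff h y +
      C.repDiff h (C.cycleRep (C.hcls x) + C.cycleRep (C.hcls y)) := by
  apply Subtype.ext
  have hxy : C.hcls (C.cycleRep (C.hcls x) + C.cycleRep (C.hcls y)) = C.hcls (x + y) := by
    show C.hcls _ + C.hcls _ = _
    rw [hcls_cycleRep, hcls_cycleRep]
    rfl
  show x.1 + y.1 - _ = x.1 - _ + (y.1 - _) + ((C.cycleRep (C.hcls x)).1 +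
    (C.cycleRep (C.hcls y)).1 - _)
  rw [hxy]
  abel

variable {G : Type v} [AddCommGroup G]

/-- The cocycle on homology determined by a homomorphism on boundaries. -/
noncomputable def boundaryCocycle : ((C.d h).range →+ G) →+ extCocycles (C.H m) G where
  toFun β := ⟨fun p => β (C.repDiff h (C.cycleRep p.1 + C.cycleRep p.2)), by
    refine ⟨fun x => ?_, fun x y => ?_, fun x y z => ?_⟩
    · have h0 : C.repDiff h (C.cycleRep x) = 0 := by
        apply Subtype.ext
        show (C.cycleRep x).1 - (C.cycleRep (C.hcls (C.cycleRep x))).1 = 0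
        rw [hcls_cycleRep, sub_self]
      show β (C.repDiff h (C.cycleRep x + C.cycleRep 0)) = 0
      rw [cycleRep_zero, add_zero, h0, map_zero]
    · show β (C.repDiff h (C.cycleRep x + C.cycleRep y)) =
        β (C.repDiff h (C.cycleRep y + C.cycleRep x))
      rw [add_comm]
    · show β _ + β _ = β _ + β _
      -- Both sides measure the passage from `t a + t b + t c` to `t (a + b + c)`. The right side is
      -- symmetric in `b` and `c`, which gives the cocycle identity.
      have key : ∀ a b c : C.H m, C.repDiff h (C.cycleRep a + C.cycleRep b) +
          C.repDiff h (C.cycleRep (a + b) + C.cycleRep c) =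
          C.repDiff h (C.cycleRep a + C.cycleRep b + C.cycleRep c) := by
        intro a b c
        have h0 : C.repDiff h (C.cycleRep c) = 0 := by
          apply Subtype.ext
          show (C.cycleRep c).1 - (C.cycleRep (C.hcls (C.cycleRep c))).1 = 0
          rw [hcls_cycleRep, sub_self]
        have h1 : C.hcls (C.cycleRep a + C.cycleRep b) = a + b :=
        C.hcls_cycleRep_add _ _
        rw [C.repDiff_add h (C.cycleRep a + C.cycleRep b) (C.cycleRep c), h0, h1, hcls_cycleRep,
          add_zero]
      rw [← map_add, ← map_add, key, key, add_right_comm]⟩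
  map_zero' := rfl
  map_add' _ _ := rfl

/-- This makes `β ∘ repDiff` an admissible choice of `ρ` for the cocycle of `β`, one that extends
`β` from boundaries to cycles. -/
theorem onBoundaries_repDiff_add (β : (C.d h).range →+ G) (x y : C.cycles m) :
    β (C.repDiff h (x + y)) = β (C.repDiff h x) + β (C.repDiff h y) +
      (C.boundaryCocycle h β).1 (C.hcls x, C.hcls y) := by
  rw [repDiff_add, map_add, map_add]
  rfl

variable [hF : ∀ n, Module.Free ℤ (C.X n)]

theorem exists_boundarySection :
    ∃ s : (C.d h).range →+ C.X n, ∀ b, C.d h (s b) = b.1 := by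
  obtain ⟨s, hs⟩ := (C.d h).rangeRestrict.exists_section (AddMonoidHom.rangeRestrict_surjective _)
  exact ⟨s, fun b => congrArg Subtype.val (hs b)⟩

/-- A homomorphic section of the differential over the group of boundaries. -/
noncomputable def boundarySection : (C.d h).range →+ C.X n := (C.exists_boundarySection h).choose

theorem d_boundarySection (b : (C.d h).range) : C.d h (C.boundarySection h b) = b.1 :=
  (C.exists_boundarySection h).choose_spec b

/-- A homomorphic retraction of the chains onto the cycles. -/
noncomputable def cycleProj : C.X n →+ C.cycles n :=
  (AddMonoidHom.id _ - (C.boundarySection h).comp (C.d h).rangeRestrict).codRestrict _ fun x => by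
    rw [C.mem_cycles h]
    simp [d_boundarySection]

theorem coe_cycleProj (x : C.X n) :
    (C.cycleProj h x).1 = x - C.boundarySection h ⟨C.d h x, x, rfl⟩ := rfl

theorem cycleProj_of_d_eq_zero (x : C.X n) (hx : C.d h x = 0) : (C.cycleProj h x).1 = x := by
  rw [coe_cycleProj]
  have : (⟨C.d h x, x, rfl⟩ : (C.d h).range) = 0 := Subtype.ext hx
  rw [this, map_zero, sub_zero]

theorem cycleProj_cycle (x : C.cycles n) : C.cycleProj h x.1 = x :=
  Subtype.ext (C.cycleProj_of_d_eq_zero h _ ((C.mem_cycles h).1 x.2))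

/-- The cocycle `k ρ ∘ ∂` on chains, for `ρ` whose coboundary is a cocycle on homology. -/
def primitiveCocycle (c : extCocycles (C.H m) G) (ρ : C.cycles m → G)
    (hρ : ∀ x y, ρ (x + y) = ρ x + ρ y + c.1 (C.hcls x, C.hcls y)) (k : ℤ) : C.cocycles G n :=
  ⟨AddMonoidHom.mk' (fun x => k • ρ ⟨_, C.d_mem_cycles h x⟩) fun x y => by
      have h1 : (⟨_, C.d_mem_cycles h (x + y)⟩ : C.cycles m) =
          ⟨_, C.d_mem_cycles h x⟩ + ⟨_, C.d_mem_cycles h y⟩ := Subtype.ext (map_add _ _ _)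
      -- Boundaries have trivial homology class, where the normalized cocycle `c` vanishes; hence
      -- `ρ` is additive on them.
      have h2 : C.hcls (⟨_, C.d_mem_cycles h y⟩ : C.cycles m) = 0 :=
        (C.hcls_eq_zero_iff h).2 ⟨y, rfl⟩
      rw [h1, hρ, h2, c.2.1, add_zero, smul_add], by
    refine (C.mem_cocycles rfl).2 fun x => ?_
    have h1 : (⟨_, C.d_mem_cycles h (C.d rfl x)⟩ : C.cycles m) = 0 := Subtype.ext (C.d_d _ _ _)
    have h2 : ρ 0 = 0 := by
      have := hρ 0 0
      rw [show C.hcls (0 : C.cycles m) = 0 from rfl, c.2.1] at this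
      simpa using this
    show k • ρ _ = 0
    rw [h1, h2, smul_zero]⟩

/-- The homomorphism on boundaries determined by a cocycle on chains. -/
noncomputable def onBoundaries : (C.X n →+ G) →+ ((C.d h).range →+ G) :=
  (n.negOnePow : ℤ) • AddMonoidHom.compHom' (C.boundarySection h)

/-- The two signs cancel and `∂` undoes its section, so the values of `ρ` on boundaries are
recovered from the cochain. -/
theorem onBoundaries_primitive (c : extCocycles (C.H m) G) (ρ : C.cycles m → G)
    (hρ : ∀ x y, ρ (x + y) = ρ x + ρ y + c.1 (C.hcls x, C.hcls y)) (b : (C.d h).range)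
    (y : C.cycles m) (hy : y.1 = b.1) :
    C.onBoundaries h (C.primitiveCocycle h c ρ hρ n.negOnePow).1 b = ρ y := by
  show (n.negOnePow : ℤ) • (n.negOnePow : ℤ) • ρ ⟨C.d h (C.boundarySection h b), _⟩ = ρ y
  rw [Int.negOnePow_smul_smul]
  congr 1
  exact Subtype.ext ((C.d_boundarySection h b).trans hy.symm)

variable (G) [TopologicalSpace G] [IsTopologicalAddGroup G]

theorem exists_cyclePrimitive (m : ℤ) :
    ∃ ρ : C.cycles m → ContinuousAddMonoidHom (extCocycles (C.H m) G) G,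
      ∀ (c : extCocycles (C.H m) G) (x y : C.cycles m),
        ρ (x + y) c = ρ x c + ρ y c + c.1 (C.hcls x, C.hcls y) :=
  exists_continuous_primitive (QuotientAddGroup.mk' _)

/-- A function on the cycles whose coboundary is the pullback of a given cocycle on homology. -/
noncomputable def cyclePrimitive (m : ℤ) :
    C.cycles m → ContinuousAddMonoidHom (extCocycles (C.H m) G) G :=
  (C.exists_cyclePrimitive G m).choose

variable {G}

theorem cyclePrimitive_add (c : extCocycles (C.H m) G) (x y : C.cycles m) :
    C.cyclePrimitive G m (x + y) c = C.cyclePrimitive G m x c + C.cyclePrimitive G m y c +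
      c.1 (C.hcls x, C.hcls y) :=
  (C.exists_cyclePrimitive G m).choose_spec c x y

variable (G) [PolishSpace G] [hC : ∀ n, Countable (C.X n)]

/-- The homomorphism from cocycles on homology to cocycles on chains that induces the co-index. -/
noncomputable def coIndexHom : extCocycles (C.H m) G →+ C.cocycles G n where
  toFun c := C.primitiveCocycle h c (fun x => C.cyclePrimitive G m x c)
    (C.cyclePrimitive_add c) n.negOnePow
  map_zero' := by
    refine Subtype.ext (AddMonoidHom.ext fun x => ?_)
    show (n.negOnePow : ℤ) • C.cyclePrimitive G m _ 0 = 0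
    rw [map_zero, smul_zero]
  map_add' c c' := by
    refine Subtype.ext (AddMonoidHom.ext fun x => ?_)
    show (n.negOnePow : ℤ) • C.cyclePrimitive G m _ (c + c') = (n.negOnePow : ℤ) •
      C.cyclePrimitive G m _ c + (n.negOnePow : ℤ) • C.cyclePrimitive G m _ c'
    rw [map_add, smul_add]

theorem cls_coIndexHom (c : extCocycles (C.H m) G) (ρ : C.cycles m → G)
    (hρ : ∀ x y, ρ (x + y) = ρ x + ρ y + c.1 (C.hcls x, C.hcls y)) (w : C.cocycles G n)
    (hw : ∀ x, w.1 x = (n.negOnePow : ℤ) • ρ ⟨_, C.d_mem_cycles h x⟩) :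
    (C.coh G n).cls (C.coIndexHom h G c) = (C.coh G n).cls w :=
  coh_cls_eq_of_primitive h n.negOnePow (ρ := fun x => C.cyclePrimitive G m x c)
    (C.cyclePrimitive_add c) hρ (w := C.coIndexHom h G c) (fun _ => rfl) hw

/-- The co-index homomorphism, on the level of cocycles. -/
noncomputable def coIndex : PolishCover.StrictHom (extCover (C.H m) G) (C.coh G n) where
  toHom := C.coIndexHom h G
  cont := by
    refine Continuous.subtype_mk (continuous_into_hom fun x => ?_) _
    exact (ContinuousMapClass.map_continuous (C.cyclePrimitive G m _)).const_smul
      (n.negOnePow : ℤ)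
  le_comap := by
    rintro _ ⟨f, rfl⟩
    -- For the coboundary of `f`, the function `-f ∘ hcls` is an admissible `ρ`. It vanishes on
    -- boundaries, so the co-index is represented by `0`.
    have hf : ∀ x y : C.cycles m, -f.1 (C.hcls (x + y)) = -f.1 (C.hcls x) + -f.1 (C.hcls y) +
        (extCobMap (C.H m) G f).1 (C.hcls x, C.hcls y) := fun x y => by
      show _ = _ + _ + (f.1 (C.hcls x) + f.1 (C.hcls y) - f.1 (C.hcls (x + y)))
      abel
    refine (QuotientAddGroup.eq_zero_iff (N := (C.coh G n).sub)
      (C.coIndexHom h G (extCobMap (C.H m) G f))).1 (C.cls_coIndexHom h G _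
        (fun x => -f.1 (C.hcls x)) hf 0 fun x => ?_)
    have h2 : C.hcls (⟨_, C.d_mem_cycles h x⟩ : C.cycles m) = 0 :=
      (C.hcls_eq_zero_iff h).2 ⟨x, rfl⟩
    rw [h2, show f.1 0 = 0 from f.2, neg_zero, smul_zero]
    rfl

variable {G}

theorem coIndex_map_cls (c : extCocycles (C.H m) G) (ρ : C.cycles m → G)
    (hρ : ∀ x y, ρ (x + y) = ρ x + ρ y + c.1 (C.hcls x, C.hcls y)) (w : C.cocycles G n)
    (hw : ∀ x, w.1 x = (n.negOnePow : ℤ) • ρ ⟨_, C.d_mem_cycles h x⟩) :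
    (C.coIndex h G).map ((extCover (C.H m) G).cls c) = (C.coh G n).cls w :=
  C.cls_coIndexHom h G c ρ hρ w hw

variable (G)

/-- The left inverse of the co-index homomorphism, on the level of cocycles. -/
noncomputable def coIndexRetraction :
    PolishCover.StrictHom (C.coh G n) (extCover (C.H m) G) where
  toHom := (C.boundaryCocycle h).comp ((C.onBoundaries h).comp (C.cocycles G n).subtype)
  cont := by
    refine Continuous.subtype_mk (continuous_pi fun p => ?_) _
    exact ((continuous_eval_hom _).comp continuous_subtype_val).const_smul (n.negOnePow : ℤ)
  le_comap := by
    intro (z : C.cocycles G n) hz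
    have hz' : z.1 ∈ C.coboundaries G n := hz
    obtain ⟨y, hy⟩ := (C.mem_coboundaries h).1 hz'
    have hβ : ∀ b, C.onBoundaries h z.1 b = (n.negOnePow : ℤ) • y b.1 := fun b => by
      show (n.negOnePow : ℤ) • z.1 _ = _
      rw [hy, d_boundarySection]
    -- When the cochain is `y ∘ ∂`, the homomorphism on boundaries extends to `±y` on all chains.
    -- Its cocycle is therefore the coboundary of `±y` evaluated on the representatives.
    refine ⟨⟨fun a => (n.negOnePow : ℤ) • y (C.cycleRep a).1, ?_⟩, ?_⟩
    · show _ • y (C.cycleRep 0).1 = 0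
      rw [cycleRep_zero]
      simp
    · refine Subtype.ext (funext fun p => ?_)
      have h1 : C.hcls (C.cycleRep p.1 + C.cycleRep p.2) = p.1 + p.2 :=
        C.hcls_cycleRep_add _ _
      show _ = C.onBoundaries h z.1 (C.repDiff h (C.cycleRep p.1 + C.cycleRep p.2))
      rw [hβ]
      show _ • y _ + _ • y _ - _ • y _ = _ • y ((C.cycleRep p.1).1 + (C.cycleRep p.2).1 - _)
      rw [h1, map_sub, map_add, smul_sub, smul_add]

/-- The right inverse of the index homomorphism, on the level of cocycles. -/
noncomputable def indexSection : PolishCover.StrictHom (homCover (C.H n) G) (C.coh G n) where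
  toHom := (AddMonoidHom.compHom' ((QuotientAddGroup.mk' _).comp (C.cycleProj h))).codRestrict
    (C.cocycles G n) fun f => by
      refine (C.mem_cocycles rfl).2 fun x => ?_
      have h0 : C.hcls (C.cycleProj h (C.d rfl x)) = 0 := by
        refine (C.hcls_eq_zero_iff rfl).2 ⟨x, ?_⟩
        rw [cycleProj_of_d_eq_zero]
        exact C.d_d _ _ _
      show f (C.hcls (C.cycleProj h (C.d rfl x))) = 0
      rw [h0, map_zero]
  cont := Continuous.subtype_mk (f := fun f : C.H n →+ G =>
    f.comp ((QuotientAddGroup.mk' _).comp (C.cycleProj h)))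
    (continuous_into_hom fun x => continuous_eval_hom _) _
  le_comap := fun f hf => by
    obtain rfl : f = 0 := hf
    exact zero_mem _

variable {G}

/-- Evaluating `ρ` on `t a + t b` in two ways, directly and as `t (a + b)` plus a boundary, shows
that the retracted cocycle differs from `c` by the coboundary of `ρ ∘ t`. -/
theorem coIndexRetraction_coIndex (x : (extCover (C.H m) G).Q) :
    (C.coIndexRetraction h G).map ((C.coIndex h G).map x) = x := by
  obtain ⟨(c : extCocycles (C.H m) G), rfl⟩ := (extCover (C.H m) G).cls_surjective x
  refine (PolishCover.cls_eq_iff (extCover (C.H m) G)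
    (x := (C.coIndexRetraction h G).toHom ((C.coIndex h G).toHom c)) (y := c)).2 ?_
  have h0 : C.cyclePrimitive G m 0 c = 0 := by
    have := C.cyclePrimitive_add c 0 0
    rw [show C.hcls (0 : C.cycles m) = 0 from rfl, c.2.1] at this
    simpa using this
  refine ⟨⟨fun a => C.cyclePrimitive G m (C.cycleRep a) c, ?_⟩, ?_⟩
  · show C.cyclePrimitive G m (C.cycleRep 0) c = 0
    rw [cycleRep_zero, h0]
  · refine Subtype.ext (funext fun p => ?_)
    have h1 : C.hcls (C.cycleRep p.1 + C.cycleRep p.2) = p.1 + p.2 :=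
        C.hcls_cycleRep_add _ _
    let b := C.repDiff h (C.cycleRep p.1 + C.cycleRep p.2)
    have hb : b.1 ∈ C.cycles m := by
      obtain ⟨e, he⟩ := b.2
      rw [← he]
      exact C.d_mem_cycles h e
    have h2 : C.cycleRep p.1 + C.cycleRep p.2 = C.cycleRep (p.1 + p.2) + ⟨b.1, hb⟩ := by
      apply Subtype.ext
      show _ + _ = (C.cycleRep (p.1 + p.2)).1 +
        ((C.cycleRep p.1).1 + (C.cycleRep p.2).1 - (C.cycleRep (C.hcls _)).1)
      rw [h1]
      abel
    have h3 := C.cyclePrimitive_add c (C.cycleRep p.1) (C.cycleRep p.2)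
    have h4 : C.hcls (⟨b.1, hb⟩ : C.cycles m) = 0 := (C.hcls_eq_zero_iff h).2 b.2
    -- No cocycle term arises on splitting off the boundary, since `c` is normalized.
    rw [h2, cyclePrimitive_add, h4, c.2.1, hcls_cycleRep, hcls_cycleRep, add_zero] at h3
    show C.cyclePrimitive G m (C.cycleRep p.1) c + C.cyclePrimitive G m (C.cycleRep p.2) c -
      C.cyclePrimitive G m (C.cycleRep (p.1 + p.2)) c = C.onBoundaries h
        (C.primitiveCocycle h c (fun x => C.cyclePrimitive G m x c) (C.cyclePrimitive_add c)
          n.negOnePow).1 b - c.1 p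
    rw [C.onBoundaries_primitive h c _ (C.cyclePrimitive_add c) b ⟨b.1, hb⟩ rfl]
    have h5 : c.1 p = C.cyclePrimitive G m (C.cycleRep (p.1 + p.2)) c +
        C.cyclePrimitive G m ⟨b.1, hb⟩ c - (C.cyclePrimitive G m (C.cycleRep p.1) c +
        C.cyclePrimitive G m (C.cycleRep p.2) c) := by
      rw [h3]
      abel
    rw [h5]
    abel

theorem index_indexSection (x : (homCover (C.H n) G).Q) :
    (C.index G n).map ((C.indexSection h G).map x) = x := by
  obtain ⟨(f : C.H n →+ G), rfl⟩ := (homCover (C.H n) G).cls_surjective x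
  refine congrArg (homCover (C.H n) G).cls (AddMonoidHom.ext (f := (C.index G n).toHom
    ((C.indexSection h G).toHom f)) (g := f) fun a => ?_)
  obtain ⟨x, rfl⟩ := C.hcls_surjective n a
  show f (C.hcls (C.cycleProj h x.1)) = f (C.hcls x)
  rw [cycleProj_cycle]

/-- Subtracting from `z` its composite with the projection onto cycles leaves `z ∘ s ∘ ∂`, with `s`
the section of `∂`. This is `(-1)^n ρ ∘ ∂` for `ρ = β ∘ repDiff`, where `β` is the homomorphism on
boundaries attached to `z`. -/
theorem coIndex_add_indexSection (x : (C.coh G n).Q) :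
    (C.coIndex h G).map ((C.coIndexRetraction h G).map x) +
      (C.indexSection h G).map ((C.index G n).map x) = x := by
  obtain ⟨z, rfl⟩ := (C.coh G n).cls_surjective x
  have hz : ∀ x, (z.1 - ((C.indexSection h G).toHom ((C.index G n).toHom z)).1) x =
      (n.negOnePow : ℤ) • C.onBoundaries h z.1 (C.repDiff h ⟨_, C.d_mem_cycles h x⟩) := by
    intro x
    have h1 : C.repDiff h ⟨_, C.d_mem_cycles h x⟩ = ⟨C.d h x, x, rfl⟩ := by
      apply Subtype.ext
      show C.d h x - (C.cycleRep (C.hcls _)).1 = C.d h x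
      rw [(C.hcls_eq_zero_iff h).2 ⟨x, rfl⟩, cycleRep_zero]
      simp
    show z.1 x - z.1 (C.cycleProj h x).1 = (n.negOnePow : ℤ) • (n.negOnePow : ℤ) •
      z.1 (C.boundarySection h _)
    rw [Int.negOnePow_smul_smul, h1, coe_cycleProj, map_sub, sub_sub_cancel]
  have := C.coIndex_map_cls h _ (fun x => C.onBoundaries h z.1 (C.repDiff h x))
    (C.onBoundaries_repDiff_add h _) (z - (C.indexSection h G).toHom ((C.index G n).toHom z)) hz
  exact (congrArg (· + (C.indexSection h G).map ((C.index G n).map ((C.coh G n).cls z))) this).trans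
    (sub_add_cancel ((C.coh G n).cls z) _)

/-- A formal consequence of the splitting: applied to a co-index, the decomposition leaves no room
for the second summand, and the section of `index` is injective. -/
theorem index_coIndex (x : (extCover (C.H m) G).Q) :
    (C.index G n).map ((C.coIndex h G).map x) = 0 := by
  obtain ⟨(c : extCocycles (C.H m) G), rfl⟩ := (extCover (C.H m) G).cls_surjective x
  have h1 := C.coIndex_add_indexSection h ((C.coIndex h G).map ((extCover (C.H m) G).cls c))
  rw [coIndexRetraction_coIndex, add_eq_left] at h1
  rw [← C.index_indexSection h ((C.index G n).map _), h1, map_zero]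

theorem coIndex_injective : Function.Injective (C.coIndex h G).map :=
  Function.LeftInverse.injective (C.coIndexRetraction_coIndex h)

theorem index_surjective : Function.Surjective (C.index G n).map :=
  Function.RightInverse.surjective (C.index_indexSection (sub_add_cancel n 1))

theorem exact_coIndex_index : Function.Exact (C.coIndex h G).map (C.index G n).map := by
  intro x
  constructor
  · intro hx
    have := C.coIndex_add_indexSection h x
    rw [hx, map_zero, add_zero] at this
    exact ⟨_, this⟩
  · rintro ⟨y, rfl⟩
    exact C.index_coIndex h y

variable (G)

/-- The restriction of the co-index homomorphism to the asymptotic groups. -/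
noncomputable def coIndexInf : (pextCover (C.H m) G).Q ≃+ (C.coh G n).asymptotic.Q where
  toFun := (C.coIndex h G).asymptotic.map
  invFun := (C.coIndexRetraction h G).asymptotic.map
  left_inv x := (extCover (C.H m) G).asymptoticIncl_injective <|
    ((C.coIndexRetraction h G).asymptoticIncl_map _).trans <|
      (congrArg _ ((C.coIndex h G).asymptoticIncl_map x)).trans (C.coIndexRetraction_coIndex h _)
  right_inv x := by
    refine (C.coh G n).asymptoticIncl_injective <|
      ((C.coIndex h G).asymptoticIncl_map _).trans <|
        (congrArg _ ((C.coIndexRetraction h G).asymptoticIncl_map x)).trans ?_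
    have h1 := C.coIndex_add_indexSection h ((C.coh G n).asymptoticIncl.map x)
    -- The trivial subgroup of `Hom(H_n, G)` is closed, so the index term of the decomposition
    -- vanishes on the asymptotic group.
    have h2 := (C.index G n).asymptoticIncl_map_eq_zero
      (isClosed_singleton (x := (0 : C.H n →+ G))) x
    rwa [h2, map_zero, add_zero] at h1
  map_add' := map_add _

variable {G}

theorem asymptoticIncl_coIndexInf (x : (pextCover (C.H m) G).Q) :
    (C.coh G n).asymptoticIncl.map (C.coIndexInf h G x) =
      (C.coIndex h G).map ((extCover (C.H m) G).asymptoticIncl.map x) :=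
  PolishCover.StrictHom.asymptoticIncl_map _ x

end UCT

end ChainCx

/-! ### Long exact sequences of degreewise split short exact sequences. -/

namespace ChainCx

/-- A short exact sequence of chain complexes with a splitting in each degree. -/
structure SplitExact (A B C : ChainCx.{u}) where
  i : Map A B
  j : Map B C
  q : ∀ n, B.X n →+ A.X n
  t : ∀ n, C.X n →+ B.X n
  q_i : ∀ n x, q n (i.f n x) = x
  j_t : ∀ n x, j.f n (t n x) = x
  j_i : ∀ n x, j.f n (i.f n x) = 0
  i_q_add_t_j : ∀ n x, i.f n (q n x) + t n (j.f n x) = x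

namespace SplitExact

variable {A B C : ChainCx.{u}} (S : SplitExact A B C) {m n : ℤ} (h : m + 1 = n)

theorem q_t (x : C.X n) : S.q n (S.t n x) = 0 := by
  have := S.i_q_add_t_j n (S.t n x)
  rw [S.j_t, add_eq_right] at this
  rw [← S.q_i n (S.q n (S.t n x)), this, map_zero]

theorem i_q_of_j_eq_zero {x : B.X n} (hx : S.j.f n x = 0) : S.i.f n (S.q n x) = x := by
  have := S.i_q_add_t_j n x
  rwa [hx, map_zero, add_zero] at this

theorem i_injective : Function.Injective (S.i.f n) :=
  Function.LeftInverse.injective (S.q_i n)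

/-- The degree `-1` map `q ∂ t` from the quotient complex to the subcomplex. -/
def conn : C.X n →+ A.X m := (S.q m).comp ((B.d h).comp (S.t n))

/-- The map `conn` measures the failure of the degreewise section `t` to be a chain map: `∂ t - t ∂`
lies in the kernel of `j`, and `q` vanishes on the image of `t`. -/
theorem i_conn (x : C.X n) : S.i.f m (S.conn h x) = B.d h (S.t n x) - S.t m (C.d h x) := by
  have h1 : S.j.f m (B.d h (S.t n x) - S.t m (C.d h x)) = 0 := by
    rw [map_sub, S.j_t, S.j.comm, S.j_t, sub_self]
  have h2 : S.conn h x = S.q m (B.d h (S.t n x) - S.t m (C.d h x)) := by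
    rw [map_sub, S.q_t, sub_zero]
    rfl
  rw [h2, S.i_q_of_j_eq_zero h1]

/-- Apply the injective map `i` and expand: only `∂ t ∂` survives, with opposite signs. This is the
source of the sign in the morphism of UCT sequences. -/
theorem conn_d {l : ℤ} (h' : l + 1 = m) (x : C.X n) :
    S.conn h' (C.d h x) = -A.d h' (S.conn h x) := by
  apply S.i_injective
  rw [map_neg, S.i.comm, S.i_conn, S.i_conn, map_sub, C.d_d, B.d_d, map_zero]
  abel

/-- Dually, `conn` is the failure of the retraction `q` to be a chain map. For a cocycle `z`, which
kills boundaries, it shows that `z ∘ conn` comes from the extension `z ∘ q`. -/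
theorem conn_j (x : B.X n) : S.conn h (S.j.f n x) = S.q m (B.d h x) - A.d h (S.q n x) := by
  have h1 : S.t n (S.j.f n x) = x - S.i.f n (S.q n x) :=
    eq_sub_of_add_eq' (S.i_q_add_t_j n x)
  show S.q m (B.d h (S.t n (S.j.f n x))) = _
  rw [h1, map_sub, map_sub, ← S.i.comm, S.q_i]

/-- The connecting homomorphism in homology, on cycles. -/
def connCycles : C.cycles n →+ A.cycles m :=
  ((S.conn h).comp (C.cycles n).subtype).codRestrict (A.cycles m) fun x => by
    rw [A.mem_cycles (sub_add_cancel m 1), ← neg_eq_zero]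
    show -A.d _ (S.conn h x.1) = 0
    rw [← S.conn_d h, (C.mem_cycles h).1 x.2, map_zero]

/-- The connecting homomorphism in homology. -/
def connH : C.H n →+ A.H m :=
  QuotientAddGroup.map _ _ (S.connCycles h) (by
    rintro x ⟨y, hy⟩
    refine (A.mem_boundaries h).2 ⟨-S.conn rfl y, ?_⟩
    show _ = S.conn h x.1
    rw [map_neg, ← S.conn_d rfl h]
    exact congrArg _ hy)

theorem connH_hcls (x : B.X n) (hx : S.j.f n x ∈ C.cycles n) (y : A.cycles m)
    (hy : S.i.f m y.1 = B.d h x) : S.connH h (C.hcls ⟨_, hx⟩) = A.hcls y := by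
  refine (A.hcls_eq_iff h (x := S.connCycles h ⟨_, hx⟩)).2 ⟨-S.q n x, ?_⟩
  show _ = S.conn h (S.j.f n x) - y.1
  rw [conn_j, ← hy, S.q_i, map_neg]
  abel

theorem exact_H_i_j : Function.Exact (S.i.onH n) (S.j.onH n) := by
  intro a
  obtain ⟨x, rfl⟩ := B.hcls_surjective n a
  constructor
  · intro hx
    obtain ⟨b, hb⟩ := (C.hcls_eq_zero_iff rfl (x := S.j.onCycles n x)).1 hx
    have hb' : C.d rfl b = S.j.f n x.1 := hb
    -- If `j x = ∂ b`, correcting `x` by `∂ t b` keeps its homology class and moves it into the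
    -- image of `i`.
    have h1 : S.j.f n (x.1 - B.d rfl (S.t _ b)) = 0 := by
      rw [map_sub, S.j.comm, S.j_t, hb', sub_self]
    have h2 : S.q n (x.1 - B.d rfl (S.t _ b)) ∈ A.cycles n := by
      rw [A.mem_cycles (sub_add_cancel n 1)]
      apply S.i_injective
      rw [S.i.comm, S.i_q_of_j_eq_zero h1, map_sub, B.d_d, (B.mem_cycles _).1 x.2, sub_zero,
        map_zero]
    refine ⟨A.hcls ⟨_, h2⟩, (B.hcls_eq_iff rfl (x := S.i.onCycles n ⟨_, h2⟩)).2
      ⟨-S.t _ b, ?_⟩⟩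
    show _ = S.i.f n (S.q n _) - x.1
    rw [S.i_q_of_j_eq_zero h1, map_neg]
    abel
  · rintro ⟨b, hb⟩
    obtain ⟨y, rfl⟩ := A.hcls_surjective n b
    rw [← hb]
    refine congrArg (C.hcls (n := n)) (a₁ := S.j.onCycles n (S.i.onCycles n y)) (a₂ := 0)
      (Subtype.ext (S.j_i n y.1))

theorem exact_H_j_conn : Function.Exact (S.j.onH n) (S.connH h) := by
  intro a
  obtain ⟨x, rfl⟩ := C.hcls_surjective n a
  constructor
  · intro hx
    obtain ⟨b, hb⟩ := (A.hcls_eq_zero_iff h (x := S.connCycles h x)).1 hx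
    have hb' : A.d h b = S.conn h x.1 := hb
    have h1 : S.t n x.1 - S.i.f n b ∈ B.cycles n := by
      rw [B.mem_cycles h, map_sub, ← S.i.comm, hb', S.i_conn, (C.mem_cycles h).1 x.2, map_zero,
        sub_zero, sub_self]
    refine ⟨B.hcls ⟨_, h1⟩, congrArg (C.hcls (n := n)) (a₁ := S.j.onCycles n ⟨_, h1⟩)
      (Subtype.ext ?_)⟩
    show S.j.f n (_ - _) = x.1
    rw [map_sub, S.j_i, S.j_t, sub_zero]
  · rintro ⟨b, hb⟩
    obtain ⟨y, rfl⟩ := B.hcls_surjective n b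
    rw [← hb]
    exact S.connH_hcls h y.1 (S.j.onCycles n y).2 0 (by
      rw [(B.mem_cycles h).1 y.2]
      exact map_zero _)

theorem exact_H_conn_i : Function.Exact (S.connH h) (S.i.onH m) := by
  intro a
  obtain ⟨x, rfl⟩ := A.hcls_surjective m a
  constructor
  · intro hx
    obtain ⟨b, hb⟩ := (B.hcls_eq_zero_iff h (x := S.i.onCycles m x)).1 hx
    have hb' : B.d h b = S.i.f m x.1 := hb
    have h1 : S.j.f n b ∈ C.cycles n := by
      rw [C.mem_cycles h, ← S.j.comm, hb', S.j_i]
    exact ⟨C.hcls ⟨_, h1⟩, S.connH_hcls h b h1 x hb'.symm⟩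
  · rintro ⟨b, hb⟩
    obtain ⟨y, rfl⟩ := C.hcls_surjective n b
    rw [← hb]
    refine (B.hcls_eq_zero_iff h (x := S.i.onCycles m (S.connCycles h y))).2 ⟨S.t n y.1, ?_⟩
    show _ = S.i.f m (S.conn h y.1)
    rw [S.i_conn, (C.mem_cycles h).1 y.2, map_zero, sub_zero]

variable (G : Type v) [AddCommGroup G]

/-- The connecting homomorphism in cohomology, on cocycles. -/
def connCocycles : A.cocycles G m →+ C.cocycles G n :=
  ((AddMonoidHom.compHom' (S.conn h)).comp (A.cocycles G m).subtype).codRestrict (C.cocycles G n)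
    fun z => by
      refine (C.mem_cocycles rfl).2 fun x => ?_
      show z.1 (S.conn h (C.d rfl x)) = 0
      rw [S.conn_d rfl h, map_neg, (A.mem_cocycles h).1 z.2, neg_zero]

variable {G}

theorem connCocycles_j (z : A.cocycles G m) (x : B.X n) :
    (S.connCocycles h G z).1 (S.j.f n x) = (z.1.comp (S.q m)) (B.d h x) := by
  show z.1 (S.conn h (S.j.f n x)) = z.1 _
  rw [conn_j, map_sub, (A.mem_cocycles h).1 z.2, sub_zero]

variable [TopologicalSpace G] [IsTopologicalAddGroup G] [PolishSpace G] [∀ n, Countable (C.X n)]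

/-- Two extensions of `z` differ by a cochain vanishing on the image of `i`; composed with `t`, it
gives a cochain on the quotient that bounds `w - w'`. -/
theorem coh_cls_eq_of_connecting {z : A.cocycles G m} {e e' : B.X m →+ G}
    (he : ∀ y, e (S.i.f m y) = z.1 y) (he' : ∀ y, e' (S.i.f m y) = z.1 y)
    {w w' : C.cocycles G n} (hw : ∀ x, w.1 (S.j.f n x) = e (B.d h x))
    (hw' : ∀ x, w'.1 (S.j.f n x) = e' (B.d h x)) :
    (C.coh G n).cls w = (C.coh G n).cls w' := by
  refine (coh_cls_eq_iff h).2 ⟨(e - e').comp (S.t m), fun x => ?_⟩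
  rw [← S.j_t n x, hw, hw', S.j_t]
  show e _ - e' _ = e _ - e' _
  have h1 : B.d h (S.t n x) = S.i.f m (S.conn h x) + S.t m (C.d h x) := by
    rw [S.i_conn]
    abel
  rw [h1, map_add, map_add, he, he']
  abel

variable (G) [∀ n, Countable (A.X n)]

/-- The connecting homomorphism in cohomology. -/
def connCoh : PolishCover.StrictHom (A.coh G m) (C.coh G n) where
  toHom := S.connCocycles h G
  cont := Continuous.subtype_mk (f := fun z : A.cocycles G m => z.1.comp (S.conn h))
    (continuous_into_hom fun x =>
      (continuous_eval_hom (S.conn h x)).comp continuous_subtype_val) _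
  le_comap := by
    intro (z : A.cocycles G m) hz
    have hz' : z.1 ∈ A.coboundaries G m := hz
    obtain ⟨y, hy⟩ := (A.mem_coboundaries (sub_add_cancel m 1)).1 hz'
    refine (QuotientAddGroup.eq_zero_iff (N := (C.coh G n).sub) (S.connCocycles h G z)).1 ?_
    refine S.coh_cls_eq_of_connecting h (z := z) (e := z.1.comp (S.q m))
      (e' := y.comp ((S.q _).comp (B.d (sub_add_cancel m 1)))) (w := S.connCocycles h G z)
      (w' := 0) (fun x => congrArg z.1 (S.q_i m x)) (fun x => ?_) (S.connCocycles_j h z)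
      fun x => ?_
    · show y (S.q _ (B.d _ (S.i.f m x))) = z.1 x
      rw [← S.i.comm, S.q_i, hy]
    · show 0 = y (S.q _ (B.d _ (B.d h x)))
      rw [B.d_d, map_zero, map_zero]

variable {G}

theorem connCoh_cls (z : A.cocycles G m) (e : B.X m →+ G) (w : C.cocycles G n)
    (he : ∀ y, e (S.i.f m y) = z.1 y) (hw : ∀ x, w.1 (S.j.f n x) = e (B.d h x)) :
    (S.connCoh h G).map ((A.coh G m).cls z) = (C.coh G n).cls w :=
  S.coh_cls_eq_of_connecting h (z := z) (e := z.1.comp (S.q m)) (e' := e)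
    (w := S.connCocycles h G z) (w' := w) (fun x => congrArg z.1 (S.q_i m x)) he
    (S.connCocycles_j h z) hw

/-- Pulling `ρ` back along the connecting map on cycles gives an admissible function for the
pulled-back cocycle. The sign from anticommutation with `∂`, which passes through `ρ` because `ρ` is
odd on boundaries, cancels against `(-1)^(m+1) = -(-1)^m`. -/
theorem connCoh_coIndex [∀ n, Module.Free ℤ (A.X n)] [∀ n, Module.Free ℤ (C.X n)] {l : ℤ}
    (h' : l + 1 = m) (x : (extCover (A.H l) G).Q) :
    (S.connCoh h G).map ((A.coIndex h' G).map x) =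
      (C.coIndex h G).map ((extMap G (S.connH h')).map x) := by
  obtain ⟨(c : extCocycles (A.H l) G), rfl⟩ := (extCover (A.H l) G).cls_surjective x
  refine (C.coIndex_map_cls h ((extMap G (S.connH h')).toHom c)
    (fun x => A.cyclePrimitive G l (S.connCycles h' x) c) (fun x y => ?_)
    (S.connCocycles h G (A.coIndexHom h' G c)) fun x => ?_).symm
  · rw [map_add]
    exact A.cyclePrimitive_add c _ _
  · have h1 : S.connCycles h' ⟨_, C.d_mem_cycles h x⟩ =
        -⟨_, A.d_mem_cycles h' (S.conn h x)⟩ := Subtype.ext (S.conn_d h h' x)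
    have h0 : A.cyclePrimitive G l 0 c = 0 := by
      have := A.cyclePrimitive_add c 0 0
      rw [show A.hcls (0 : A.cycles l) = 0 from rfl, c.2.1] at this
      simpa using this
    have h2 : A.cyclePrimitive G l (-⟨_, A.d_mem_cycles h' (S.conn h x)⟩) c =
        -A.cyclePrimitive G l ⟨_, A.d_mem_cycles h' (S.conn h x)⟩ c := by
      have := A.cyclePrimitive_add c (-⟨_, A.d_mem_cycles h' (S.conn h x)⟩)
        ⟨_, A.d_mem_cycles h' (S.conn h x)⟩
      rw [neg_add_cancel, h0, (A.hcls_eq_zero_iff h' (x := ⟨_, A.d_mem_cycles h' (S.conn h x)⟩)).2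
        ⟨_, rfl⟩, c.2.1, add_zero] at this
      exact eq_neg_of_add_eq_zero_left this.symm
    show (m.negOnePow : ℤ) • A.cyclePrimitive G l ⟨_, A.d_mem_cycles h' (S.conn h x)⟩ c = _
    subst h
    rw [h1, h2, Int.negOnePow_succ, smul_neg, Units.val_neg, neg_smul, neg_neg]

theorem index_connCoh (x : (A.coh G m).Q) :
    (C.index G n).map ((S.connCoh h G).map x) =
      (homMap G (S.connH h)).map ((A.index G m).map x) := by
  obtain ⟨(z : A.cocycles G m), rfl⟩ := (A.coh G m).cls_surjective x
  refine congrArg (homCover (C.H n) G).cls (AddMonoidHom.ext (f := (C.index G n).toHom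
    ((S.connCoh h G).toHom z)) (g := (homMap G (S.connH h)).toHom ((A.index G m).toHom z))
    fun a => ?_)
  obtain ⟨x, rfl⟩ := C.hcls_surjective n a
  rfl

variable [∀ n, Countable (B.X n)]

theorem exact_coh_j_i : Function.Exact (S.j.onCoh G n).map (S.i.onCoh G n).map := by
  intro a
  obtain ⟨(z : B.cocycles G n), rfl⟩ := (B.coh G n).cls_surjective a
  constructor
  · intro hz
    obtain ⟨y, hy⟩ := (coh_cls_eq_zero_iff (sub_add_cancel n 1) (z := (S.i.onCoh G n).toHom z)).1 hz
    have hy' : ∀ x, z.1 (S.i.f n x) = y (A.d (sub_add_cancel n 1) x) := hy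
    -- Extending `y` by `q` and subtracting its coboundary makes the cocycle vanish on the image of
    -- `i`; it then factors through `j`, and `f ∘ t` is the factor.
    let f : B.X n →+ G := z.1 - (y.comp (S.q _)).comp (B.d (sub_add_cancel n 1))
    have hf : ∀ x, f x = z.1 x - y (S.q _ (B.d (sub_add_cancel n 1) x)) := fun x => rfl
    have hfi : ∀ x, f (S.i.f n x) = 0 := fun x => by
      rw [hf, hy', ← S.i.comm, S.q_i, sub_self]
    have hfj : ∀ x, f (S.t n (S.j.f n x)) = f x := fun x => by
      conv_rhs => rw [← S.i_q_add_t_j n x, map_add, hfi, zero_add]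
    let w : C.cocycles G n := ⟨f.comp (S.t n), by
      refine (C.mem_cocycles rfl).2 fun x => ?_
      show f (S.t n _) = 0
      rw [← S.j_t _ x, ← S.j.comm, hfj, hf, B.d_d, map_zero, map_zero, sub_zero,
        (B.mem_cocycles rfl).1 z.2]⟩
    refine ⟨(C.coh G n).cls w, (coh_cls_eq_iff (sub_add_cancel n 1)
      (z := (S.j.onCoh G n).toHom w)).2 ⟨-y.comp (S.q _), fun x => ?_⟩⟩
    show f (S.t n (S.j.f n x)) - z.1 x = -y (S.q _ _)
    rw [hfj, hf]
    abel
  · rintro ⟨b, hb⟩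
    obtain ⟨(w : C.cocycles G n), rfl⟩ := (C.coh G n).cls_surjective b
    rw [← hb]
    refine (coh_cls_eq_zero_iff (sub_add_cancel n 1)
      (z := (S.i.onCoh G n).toHom ((S.j.onCoh G n).toHom w))).2 ⟨0, fun x => ?_⟩
    show w.1 (S.j.f n (S.i.f n x)) = 0
    rw [S.j_i, map_zero]

theorem exact_coh_i_conn : Function.Exact (S.i.onCoh G m).map (S.connCoh h G).map := by
  intro a
  obtain ⟨(z : A.cocycles G m), rfl⟩ := (A.coh G m).cls_surjective a
  constructor
  · intro hz
    obtain ⟨y, hy⟩ := (coh_cls_eq_zero_iff h (z := S.connCocycles h G z)).1 hz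
    -- The extension `z ∘ q` has coboundary `y ∘ ∂ ∘ j`. Subtracting `y ∘ j` turns it into a cocycle
    -- without changing its restriction.
    let e : B.cocycles G m := ⟨z.1.comp (S.q m) - y.comp (S.j.f m), by
      refine (B.mem_cocycles h).2 fun x => ?_
      show (z.1.comp (S.q m)) (B.d h x) - y (S.j.f m (B.d h x)) = 0
      rw [← S.connCocycles_j h z, hy, S.j.comm, sub_self]⟩
    refine ⟨(B.coh G m).cls e, congrArg (A.coh G m).cls (a₁ := (S.i.onCoh G m).toHom e)
      (Subtype.ext (AddMonoidHom.ext fun x => ?_))⟩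
    show z.1 (S.q m (S.i.f m x)) - y (S.j.f m (S.i.f m x)) = z.1 x
    rw [S.q_i, S.j_i, map_zero, sub_zero]
  · rintro ⟨b, hb⟩
    obtain ⟨(e : B.cocycles G m), rfl⟩ := (B.coh G m).cls_surjective b
    rw [← hb]
    exact S.connCoh_cls h ((S.i.onCoh G m).toHom e) e.1 0 (fun _ => rfl)
      fun x => ((B.mem_cocycles h).1 e.2 x).symm

theorem exact_coh_conn_j : Function.Exact (S.connCoh h G).map (S.j.onCoh G n).map := by
  intro a
  obtain ⟨(w : C.cocycles G n), rfl⟩ := (C.coh G n).cls_surjective a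
  constructor
  · intro hw
    obtain ⟨y, hy⟩ := (coh_cls_eq_zero_iff h (z := (S.j.onCoh G n).toHom w)).1 hw
    have hy' : ∀ x, w.1 (S.j.f n x) = y (B.d h x) := hy
    let z : A.cocycles G m := ⟨y.comp (S.i.f m), by
      refine (A.mem_cocycles h).2 fun x => ?_
      show y (S.i.f m (A.d h x)) = 0
      rw [S.i.comm, ← hy', S.j_i, map_zero]⟩
    exact ⟨(A.coh G m).cls z, S.connCoh_cls h z y w (fun _ => rfl) hy'⟩
  · rintro ⟨b, hb⟩
    obtain ⟨(z : A.cocycles G m), rfl⟩ := (A.coh G m).cls_surjective b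
    rw [← hb]
    exact (coh_cls_eq_zero_iff h (z := (S.j.onCoh G n).toHom (S.connCocycles h G z))).2
      ⟨z.1.comp (S.q m), S.connCocycles_j h z⟩

end SplitExact

end ChainCx

theorem DivisionClosure.isClosed_zsmul {G : Type v} [AddCommGroup G] [TopologicalSpace G]
    (hG : DivisionClosure G) (k : ℤ) :
    IsClosed {x : G | ∃ g : G, x = k • g} := by
  have h : {x : G | ∃ g : G, x = k • g} = {x : G | ∃ g : G, x = k.natAbs • g} := by
    ext x
    rcases Int.natAbs_eq k with hk | hk
    · have : ∀ g : G, k • g = k.natAbs • g := fun g => by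
        conv_lhs => rw [hk]
        exact natCast_zsmul _ _
      simp only [this]
    · have : ∀ g : G, k • g = k.natAbs • -g := fun g => by
        conv_lhs => rw [hk]
        rw [neg_smul, natCast_zsmul, smul_neg]
      simp only [this]
      exact ⟨fun ⟨g, hg⟩ => ⟨-g, hg⟩, fun ⟨g, hg⟩ => ⟨-g, by rwa [neg_neg]⟩⟩
  rw [h]
  exact hG _

/-! ### Closed coboundary groups of finite complexes, and limits along exhaustions. -/

namespace ChainCx

section Closed

variable {C : ChainCx.{u}} {G : Type v} [AddCommGroup G] [TopologicalSpace G]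
  [IsTopologicalAddGroup G] [PolishSpace G] [hC : ∀ n, Countable (C.X n)]

/-- For finitely generated chain groups, the coboundaries are closed. -/
theorem isClosed_coh_sub (hG : DivisionClosure G) [hF : ∀ n, Module.Free ℤ (C.X n)]
    [hfin : ∀ n, Module.Finite ℤ (C.X n)] (n : ℤ) :
    IsClosed ((C.coh G n).sub : Set (C.coh G n).carrier) := by
  have h : n - 1 + 1 = n := sub_add_cancel n 1
  let N := LinearMap.range (C.d h).toIntLinearMap
  -- Bases adapted to the boundaries: each basis boundary is `a i` times a basis chain, and `x i`
  -- below is a chain bounded by it.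
  obtain ⟨r, S⟩ := Submodule.smithNormalForm (Module.Free.chooseBasis ℤ (C.X (n - 1))) N
  have hx : ∀ i, ∃ x, C.d h x = (S.bN i).1 := fun i => (S.bN i).2
  choose x hx using hx
  -- A cochain has the form `y ∘ ∂` exactly when it kills cycles and its value on each `x i` is
  -- divisible by `a i`. Both conditions are closed, the second by the division closure property.
  have hs : {z : C.cocycles G n | z.1 ∈ C.coboundaries G n} =
      (⋂ a : C.cycles n, {z : C.cocycles G n | z.1 a.1 = 0}) ∩
        ⋂ i, {z : C.cocycles G n | z.1 (x i) ∈ {y : G | ∃ g : G, y = S.a i • g}} := by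
    ext z
    simp only [C.mem_coboundaries h, Set.mem_inter_iff, Set.mem_iInter, Set.mem_ofPred_eq]
    constructor
    · rintro ⟨y, hy⟩
      refine ⟨fun a => ?_, fun i => ⟨y (S.bM (S.f i)), ?_⟩⟩
      · rw [hy, (C.mem_cycles h).1 a.2, map_zero]
      · rw [hy, hx, S.snf, map_zsmul]
    · rintro ⟨h1, h2⟩
      choose g hg using h2
      classical
      -- The chosen quotients `g i` prescribe `y` on the basis chains that occur in boundaries; its
      -- value on the others is irrelevant and set to `0`.
      let y : C.X (n - 1) →+ G := (S.bM.constr ℤ fun k =>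
        if hk : ∃ i, S.f i = k then g hk.choose else 0).toAddMonoidHom
      have hy : ∀ i, y (S.bM (S.f i)) = g i := fun i => by
        have hk : ∃ j, S.f j = S.f i := ⟨i, rfl⟩
        show S.bM.constr ℤ _ _ = _
        rw [Module.Basis.constr_basis, dif_pos hk]
        exact congrArg g (S.f.injective hk.choose_spec)
      refine ⟨y, fun a => ?_⟩
      let b : N := ⟨C.d h a, a, rfl⟩
      have hb : ∑ i, S.bN.repr b i • (S.bN i).1 = C.d h a := by
        have := congrArg Subtype.val (S.bN.sum_repr b)
        rwa [AddSubmonoidClass.coe_finsetSum] at this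
      have hcyc : a - ∑ i, S.bN.repr b i • x i ∈ C.cycles n := by
        rw [C.mem_cycles h, map_sub, map_sum, sub_eq_zero, ← hb]
        exact Finset.sum_congr rfl fun i _ => by rw [map_zsmul, hx]
      have h3 := h1 ⟨_, hcyc⟩
      rw [map_sub, sub_eq_zero] at h3
      rw [h3, ← hb, map_sum, map_sum]
      refine Finset.sum_congr rfl fun i _ => ?_
      rw [map_zsmul, map_zsmul, hg, S.snf, map_zsmul, hy]
  show IsClosed {z : C.cocycles G n | z.1 ∈ C.coboundaries G n}
  rw [hs]
  have he : ∀ a, Continuous fun z : C.cocycles G n => z.1 a := fun a =>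
    (continuous_eval_hom a).comp continuous_subtype_val
  exact (isClosed_iInter fun a : C.cycles n => isClosed_eq (he a.1) continuous_const).inter
    (isClosed_iInter fun i => (hG.isClosed_zsmul _).preimage (he _))

end Closed

/-- A sequence of complexes with retractions onto an exhausting sequence of direct summands. -/
structure Exhaustion (C : ChainCx.{u}) where
  cx : ℕ → ChainCx.{u}
  ι : ∀ k, Map (cx k) C
  proj : ∀ k n, C.X n →+ (cx k).X n
  proj_ι : ∀ k n x, proj k n ((ι k).f n x) = x
  ι_proj_ι : ∀ {j k} (_ : j ≤ k) n x, (ι k).f n (proj k n ((ι j).f n x)) = (ι j).f n x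
  exhaust : ∀ n x, ∃ k a, (ι k).f n a = x

namespace Exhaustion

variable {C : ChainCx.{u}} (E : C.Exhaustion) {G : Type v} [AddCommGroup G] {m n : ℤ}
  (h : m + 1 = n)

theorem exists_of_le {x : C.X n} {j k : ℕ} {a : (E.cx j).X n} (hjk : j ≤ k)
    (ha : (E.ι j).f n a = x) : (E.ι k).f n (E.proj k n x) = x := by
  rw [← ha, E.ι_proj_ι hjk]

/-- Cocycles that are compatible up to coboundaries can be glued. -/
theorem exists_glue (w : ∀ k, (E.cx k).cocycles G n)
    (hw : ∀ k, ∃ y : (E.cx k).X m →+ G, ∀ x,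
      (w (k + 1)).1 (E.proj (k + 1) n ((E.ι k).f n x)) - (w k).1 x = y ((E.cx k).d h x)) :
    ∃ z : C.cocycles G n, ∀ k, ∃ y : (E.cx k).X m →+ G, ∀ x,
      z.1 ((E.ι k).f n x) - (w k).1 x = y ((E.cx k).d h x) := by
  choose y hy using hw
  -- The projections extend each `y j` to all of `C`. Subtracting the coboundary of the accumulated
  -- sum makes the restrictions agree exactly; this is the vanishing of the obstruction in `lim¹`.
  let s : ℕ → (C.X m →+ G) := fun k => ∑ j ∈ Finset.range k, (y j).comp (E.proj j m)
  have hs : ∀ k x, s (k + 1) x = s k x + y k (E.proj k m x) := fun k x => by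
    simp only [s, Finset.sum_range_succ]
    rfl
  let w' : ∀ k, (E.cx k).X n →+ G := fun k => (w k).1 - (s k).comp ((C.d h).comp ((E.ι k).f n))
  have hw' : ∀ k x, w' k x = (w k).1 x - s k (C.d h ((E.ι k).f n x)) := fun k x => rfl
  have hsucc : ∀ k x, w' (k + 1) (E.proj (k + 1) n ((E.ι k).f n x)) = w' k x := fun k x => by
    rw [hw', hw', E.ι_proj_ι k.le_succ, hs, ← (E.ι k).comm, E.proj_ι, ← hy]
    abel
  have hle : ∀ j k, j ≤ k → ∀ x, w' k (E.proj k n ((E.ι j).f n x)) = w' j x := by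
    intro j k hjk
    induction k, hjk using Nat.le_induction with
    | base => exact fun x => by rw [E.proj_ι]
    | succ k hjk ih =>
      intro x
      rw [← E.ι_proj_ι hjk, hsucc, ih]
  choose k a ha using E.exhaust n
  -- The value at `x` can be computed at any later level, so additivity can be checked at a level
  -- common to both summands and the sum.
  have hz : ∀ x l, k x ≤ l → w' l (E.proj l n x) = w' (k x) (a x) := fun x l hl => by
    conv_lhs => rw [← ha x]
    exact hle _ _ hl _
  let z : C.X n →+ G := AddMonoidHom.mk' (fun x => w' (k x) (a x)) fun x x' => by
    let l := max (k (x + x')) (max (k x) (k x'))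
    have h1 : k (x + x') ≤ l := le_max_left _ _
    have h2 : k x ≤ l := (le_max_left _ _).trans (le_max_right _ _)
    have h3 : k x' ≤ l := (le_max_right _ _).trans (le_max_right _ _)
    rw [← hz _ l h1, ← hz _ l h2, ← hz _ l h3, map_add, map_add]
  have hzι : ∀ j x, z ((E.ι j).f n x) = w' j x := fun j x => by
    show w' (k ((E.ι j).f n x)) (a ((E.ι j).f n x)) = _
    rw [← hz _ _ (le_max_left _ j), hle j _ (le_max_right _ _)]
  refine ⟨⟨z, (C.mem_cocycles rfl).2 fun x => ?_⟩, fun j => ⟨-(s j).comp ((E.ι j).f m),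
    fun x => ?_⟩⟩
  · obtain ⟨j, b, rfl⟩ := E.exhaust _ x
    rw [← (E.ι j).comm, hzι, hw', (E.ι j).comm, C.d_d, map_zero, sub_zero,
      ((E.cx j).mem_cocycles rfl).1 (w j).2]
  · show z _ - _ = -s j _
    rw [hzι, hw', (E.ι j).comm]
    abel

variable [TopologicalSpace G] [IsTopologicalAddGroup G] [PolishSpace G]
  [∀ n, Countable (C.X n)]

/-- A cocycle whose restrictions are coboundaries is a limit of coboundaries. -/
theorem mem_closure_of_forall_coboundary (z : C.cocycles G n)
    (hz : ∀ k, ∃ y : (E.cx k).X m →+ G, ∀ x, z.1 ((E.ι k).f n x) = y ((E.cx k).d h x)) :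
    z ∈ (C.coh G n).sub.topologicalClosure := by
  choose y hy using hz
  -- The coboundary of the extension of `y k` by the projection agrees with `z` on the `k`-th
  -- subcomplex. At each chain the sequence is eventually constant, which suffices for pointwise
  -- convergence.
  let f : ℕ → C.cocycles G n := fun k => ⟨((y k).comp (E.proj k m)).comp (C.d h), by
    refine (C.mem_cocycles rfl).2 fun x => ?_
    show y k (E.proj k m (C.d h (C.d _ x))) = 0
    rw [C.d_d, map_zero, map_zero]⟩
  have hf : ∀ k x, (f k).1 x = y k (E.proj k m (C.d h x)) := fun k x => rfl
  have ht : Filter.Tendsto f Filter.atTop (𝓝 z) := by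
    refine tendsto_subtype_rng.2 ?_
    rw [nhds_induced, Filter.tendsto_comap_iff, tendsto_pi_nhds]
    intro x
    obtain ⟨j, a, ha⟩ := E.exhaust n x
    refine tendsto_const_nhds.congr' ?_
    filter_upwards [Filter.eventually_ge_atTop j] with k hk
    show z.1 x = (f k).1 x
    rw [hf, ← E.exists_of_le hk ha, hy, ← (E.ι k).comm, E.proj_ι]
  exact mem_closure_of_tendsto (X := C.cocycles G n) ht (Filter.Eventually.of_forall fun k =>
    (C.mem_coboundaries h).2 ⟨(y k).comp (E.proj k m), fun x => rfl⟩)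

end Exhaustion

end ChainCx

/-! ### Coordinate projections and finiteness of simplicial chain groups. -/

section ElementaryChains

open scoped Classical in
/-- The projection of the chains of a complex onto the chains of another complex that discards the
elementary chains outside the latter. -/
noncomputable def chainFilter {V : Type u} (K L : PreAbstractSimplicialComplex V) (n : ℤ) :
    (simplicialCx K).X n →+ (simplicialCx L).X n :=
  ((Finsupp.filterAddHom (· ∈ elemChains L n)).comp (chainGroup K n).subtype).codRestrict
    (chainGroup L n) fun x l hl => by
      have hl' : l ∈ (x.1.filter (· ∈ elemChains L n)).support := hl
      rw [Finsupp.support_filter, Finset.mem_filter] at hl'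
      exact hl'.2

theorem chainFilter_support_subset {V : Type u} (K L : PreAbstractSimplicialComplex V) (n : ℤ)
    (x : (simplicialCx K).X n) : (chainFilter K L n x).1.support ⊆ x.1.support := by
  classical
  exact (Finsupp.support_filter _ _).le.trans (Finset.filter_subset _ _)

theorem coe_chainFilter_of_mem {V : Type u} (K L : PreAbstractSimplicialComplex V) (n : ℤ)
    (x : (simplicialCx K).X n) (hx : x.1 ∈ chainGroup L n) : (chainFilter K L n x).1 = x.1 := by
  classical
  exact Finsupp.filter_eq_self_iff _ _ |>.2 fun l hl => hx (Finsupp.mem_support_iff.2 hl)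

theorem elemChains_inf {V : Type u} (K L : PreAbstractSimplicialComplex V) (n : ℤ) :
    elemChains (K ⊓ L) n = elemChains K n ∩ elemChains L n := by
  ext l
  constructor
  · rintro ⟨hl, s, hs, hsl⟩
    exact ⟨⟨hl, s, hs.1, hsl⟩, ⟨hl, s, hs.2, hsl⟩⟩
  · rintro ⟨⟨hl, s, hs, hsl⟩, -, s', hs', hsl'⟩
    obtain rfl : s = s' := Finset.ext fun v => (hsl v).trans (hsl' v).symm
    exact ⟨hl, s, ⟨hs, hs'⟩, hsl⟩

theorem elemChains_mono {V : Type u} {K L : PreAbstractSimplicialComplex V} (h : K ≤ L) (n : ℤ) :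
    elemChains K n ⊆ elemChains L n :=
  fun _ hl => ⟨hl.1, hl.2.imp fun _ hs => ⟨h hs.1, hs.2⟩⟩

theorem elemChains_finite {V : Type u} {K : PreAbstractSimplicialComplex V} (h : K.faces.Finite)
    (n : ℤ) : (elemChains K n).Finite := by
  have hU : (⋃ s ∈ K.faces, (s : Set V)).Finite := h.biUnion fun s _ => s.finite_toSet
  have := hU.to_subtype
  refine ((List.finite_length_eq (⋃ s ∈ K.faces, (s : Set V)) (n + 1).toNat).image
    (List.map Subtype.val)).subset ?_
  rintro l ⟨hl, s, hs, hsl⟩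
  have hmem : ∀ v ∈ l, v ∈ ⋃ s ∈ K.faces, (s : Set V) := fun v hv =>
    Set.mem_biUnion hs ((hsl v).2 hv)
  refine ⟨l.attach.map fun v => ⟨v.1, hmem v.1 v.2⟩, ?_, ?_⟩
  · show (l.attach.map _).length = _
    rw [List.length_map, List.length_attach]
    omega
  · rw [List.map_map]
    exact List.attach_map_subtype_val l

theorem finite_chainGroup {V : Type u} {K : PreAbstractSimplicialComplex V} (h : K.faces.Finite)
    (n : ℤ) : Module.Finite ℤ ((simplicialCx K).X n) := by
  have := (elemChains_finite h n).to_subtype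
  exact Module.Finite.equiv (Finsupp.supportedEquivFinsupp (R := ℤ) (M := ℤ) (elemChains K n)).symm

/-- A chain has finite support, and a finite set covered by a directed union lies in one member. -/
theorem exists_mem_chainGroup {V : Type u} {K : PreAbstractSimplicialComplex V}
    {L : ℕ → PreAbstractSimplicialComplex V} (hL : Monotone L)
    (hK : ∀ s ∈ K.faces, ∃ k, s ∈ (L k).faces) (n : ℤ) (x : (simplicialCx K).X n) :
    ∃ k, x.1 ∈ chainGroup (L k) n := by
  have hx : (x.1.support : Set (List V)) ⊆ ⋃ k, elemChains (L k) n := fun l hl => by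
    obtain ⟨hl, s, hs, hsl⟩ := x.2 hl
    obtain ⟨k, hk⟩ := hK s hs
    exact Set.mem_iUnion.2 ⟨k, hl, s, hk, hsl⟩
  have hd : Directed (· ⊆ ·) fun k => elemChains (L k) n :=
    Monotone.directed_le (f := fun k => elemChains (L k) n) fun _ _ h => elemChains_mono (hL h) n
  obtain ⟨k, hk⟩ := hd.exists_mem_subset_of_finset_subset_biUnion hx
  exact ⟨k, hk⟩

theorem eq_zero_of_chain_bot {V : Type u} {n : ℤ}
    (x : (simplicialCx (⊥ : PreAbstractSimplicialComplex V)).X n) : x = 0 := by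
  refine Subtype.ext (Finsupp.support_eq_empty.1 (Finset.eq_empty_iff_forall_notMem.2 ?_))
  intro l hl
  obtain ⟨-, s, hs, -⟩ := x.2 hl
  exact hs

end ElementaryChains

/-! ### Freeness and degreewise splitting of relative chains. -/

namespace SimplicialPair

variable (P : SimplicialPair.{u})

theorem relCls_surjective (n : ℤ) : Function.Surjective (P.relCls n) :=
  QuotientAddGroup.mk'_surjective _

theorem relCls_eq_zero_iff {n : ℤ} {x : (simplicialCx P.tot).X n} :
    P.relCls n x = 0 ↔ x.1 ∈ chainGroup P.sub n := by
  refine (QuotientAddGroup.eq_zero_iff x).trans ⟨?_, fun hx => ⟨⟨x.1, hx⟩, rfl⟩⟩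
  rintro ⟨y, rfl⟩
  exact y.2

theorem d_relCls {m n : ℤ} (h : m + 1 = n) (x : (simplicialCx P.tot).X n) :
    P.cx.d h (P.relCls n x) = P.relCls m ((simplicialCx P.tot).d h x) := rfl

/-- Discarding the tuples of `K'` embeds the relative chains into the free group on all tuples. -/
instance free_cx (n : ℤ) : Module.Free ℤ (P.cx.X n) := by
  classical
  let f : P.cx.X n →+ (List P.V →₀ ℤ) := QuotientAddGroup.lift _
    ((Finsupp.filterAddHom (· ∉ elemChains P.sub n)).comp (chainGroup P.tot n).subtype) (by
      rintro _ ⟨x, rfl⟩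
      refine Finsupp.filter_eq_zero_iff _ _ |>.2 fun l hl => ?_
      by_contra h0
      exact hl (x.2 (Finsupp.mem_support_iff.2 h0)))
  refine f.free_of_injective ((injective_iff_map_eq_zero f).2 fun a ha => ?_)
  obtain ⟨x, rfl⟩ := P.relCls_surjective n a
  refine P.relCls_eq_zero_iff.2 fun l hl => ?_
  by_contra h0
  exact Finsupp.mem_support_iff.1 hl (Finsupp.filter_eq_zero_iff _ _ |>.1 ha l h0)

theorem finite_cx (h : P.tot.faces.Finite) (n : ℤ) : Module.Finite ℤ (P.cx.X n) := by
  have := finite_chainGroup h n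
  exact Module.Finite.of_surjective (P.relCls n).toIntLinearMap (P.relCls_surjective n)

theorem mapJ_rel_relCls (n : ℤ) (x : (simplicialCx P.tot).X n) :
    P.mapJ.rel.f n (P.totPair.relCls n x) = P.relCls n x := rfl

theorem mapI_rel_relCls (n : ℤ) (x : (simplicialCx P.sub).X n) :
    P.mapI.rel.f n (P.subPair.relCls n x) =
      P.totPair.relCls n ((simplicialIncl P.le).f n x) := rfl

theorem mapJ_rel_surjective (n : ℤ) : Function.Surjective (P.mapJ.rel.f n) := fun a => by
  obtain ⟨x, rfl⟩ := P.relCls_surjective n a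
  exact ⟨P.totPair.relCls n x, P.mapJ_rel_relCls n x⟩

theorem mapJ_rel_mapI_rel (n : ℤ) (a : P.subPair.cx.X n) :
    P.mapJ.rel.f n (P.mapI.rel.f n a) = 0 := by
  obtain ⟨(x : (simplicialCx P.sub).X n), rfl⟩ := P.subPair.relCls_surjective n a
  exact ((congrArg _ (P.mapI_rel_relCls n x)).trans (P.mapJ_rel_relCls n _)).trans
    (P.relCls_eq_zero_iff.2 x.2)

theorem mapI_rel_injective (n : ℤ) : Function.Injective (P.mapI.rel.f n) := by
  rw [injective_iff_map_eq_zero]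
  intro a ha
  obtain ⟨(x : (simplicialCx P.sub).X n), rfl⟩ := P.subPair.relCls_surjective n a
  have h1 := (P.totPair.relCls_eq_zero_iff (x := (simplicialIncl P.le).f n x)).1
    ((P.mapI_rel_relCls n x).symm.trans ha)
  exact (P.subPair.relCls_eq_zero_iff (x := x)).2 h1

theorem exists_mapI_rel_eq (n : ℤ) (a : P.totPair.cx.X n) (ha : P.mapJ.rel.f n a = 0) :
    ∃ y, P.mapI.rel.f n y = a := by
  obtain ⟨(x : (simplicialCx P.tot).X n), rfl⟩ := P.totPair.relCls_surjective n a
  exact ⟨P.subPair.relCls n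
    ⟨x.1, P.relCls_eq_zero_iff.1 ((P.mapJ_rel_relCls n x).symm.trans ha)⟩, P.mapI_rel_relCls n _⟩

/-- Relative chains are free, so `j` has a section `t` in each degree. The retraction `q` is then
forced by `i (q x) = x - t (j x)`, and injectivity of `i` makes it additive. -/
theorem exists_splitExact : ∃ S : ChainCx.SplitExact P.subPair.cx P.totPair.cx P.cx,
    S.i = P.mapI.rel ∧ S.j = P.mapJ.rel := by
  have hi := P.mapI_rel_injective
  choose t ht using fun n => (P.mapJ.rel.f n).exists_section (P.mapJ_rel_surjective n)
  have hex : ∀ n x, ∃ y, P.mapI.rel.f n y = x - t n (P.mapJ.rel.f n x) := fun n x =>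
    P.exists_mapI_rel_eq n _ (by rw [map_sub, ht, sub_self])
  choose q hq using hex
  let q' : ∀ n, P.totPair.cx.X n →+ P.subPair.cx.X n := fun n =>
    AddMonoidHom.mk' (q n) fun x y => hi n (by
      rw [map_add, hq, hq, hq, map_add, map_add]
      abel)
  have hqi : ∀ n x, q' n (P.mapI.rel.f n x) = x := fun n x =>
    hi n ((hq n _).trans (by rw [mapJ_rel_mapI_rel, map_zero, sub_zero]))
  have hqt : ∀ n x, P.mapI.rel.f n (q' n x) + t n (P.mapJ.rel.f n x) = x := fun n x =>
    (congrArg (· + t n (P.mapJ.rel.f n x)) (hq n x)).trans (sub_add_cancel x _)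
  exact ⟨⟨P.mapI.rel, P.mapJ.rel, q', t, hqi, ht, P.mapJ_rel_mapI_rel, hqt⟩, rfl, rfl⟩

/-- The splittings of the short exact sequence of chain complexes of a pair. -/
noncomputable def splitExact : ChainCx.SplitExact P.subPair.cx P.totPair.cx P.cx :=
  P.exists_splitExact.choose

theorem splitExact_i : P.splitExact.i = P.mapI.rel := P.exists_splitExact.choose_spec.1

theorem splitExact_j : P.splitExact.j = P.mapJ.rel := P.exists_splitExact.choose_spec.2

end SimplicialPair

/-! ### Functoriality and homotopy invariance of cohomology. -/

namespace PolyPair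

instance free_cx (P : PolyPair.{u}) (n : ℤ) : Module.Free ℤ (P.cx.X n) :=
  P.toSimplicialPair.free_cx n

variable {P Q R : PolyPair.{u}} (G : Type v) [AddCommGroup G] [TopologicalSpace G]
  [IsTopologicalAddGroup G] [PolishSpace G]

theorem onCoh_comp (ψ : Q.ChainMap R) (φ : P.ChainMap Q) (n : ℤ) (x : (R.coh G n).Q) :
    (ChainMap.onCoh (ψ.comp φ : P.ChainMap R) G n).map x =
      (φ.onCoh G n).map ((ψ.onCoh G n).map x) := by
  obtain ⟨(z : R.cx.cocycles G n), rfl⟩ := (R.coh G n).cls_surjective x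
  refine congrArg (P.coh G n).cls (Subtype.ext (AddMonoidHom.ext fun a => ?_)
    (a1 := (ChainMap.onCoh (ψ.comp φ : P.ChainMap R) G n).toHom z)
    (a2 := (φ.onCoh G n).toHom ((ψ.onCoh G n).toHom z)))
  obtain ⟨a, rfl⟩ := P.relCls_surjective n a
  rfl

theorem onCoh_eq_of_homotopic {φ ψ : P.ChainMap Q} (hφ : SimplicialPair.Map.Homotopic φ ψ) (n : ℤ)
    (x : (Q.coh G n).Q) : (φ.onCoh G n).map x = (ψ.onCoh G n).map x := by
  obtain ⟨(z : Q.cx.cocycles G n), rfl⟩ := (Q.coh G n).cls_surjective x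
  obtain ⟨D, D₁, hD, hb, -⟩ := hφ
  have h : n - 1 + 1 = n := sub_add_cancel n 1
  -- The cochain `-z ∘ D` descends to relative chains because the homotopy maps `C(K')` into
  -- `C(L')`. The sign reflects that the homotopy relation gives `ψ - φ`.
  let y : P.cx.X (n - 1) →+ G := QuotientAddGroup.lift (simplicialIncl P.le |>.f (n - 1)).range
    (-(z.1.comp ((Q.relCls n).comp (D h)))) (by
      rintro _ ⟨y, rfl⟩
      have h0 : Q.relCls n (D h ((simplicialIncl P.le).f (n - 1) y)) = 0 :=
        Q.relCls_eq_zero_iff.2 (by rw [hD]; exact (D₁ h y).2)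
      show -z.1 (Q.relCls n (D h ((simplicialIncl P.le).f (n - 1) y))) = 0
      rw [h0, map_zero, neg_zero])
  have hy : ∀ a, y (P.relCls (n - 1) a) = -z.1 (Q.relCls n (D h a)) := fun a => rfl
  refine (ChainCx.coh_cls_eq_iff h (z := (φ.onCoh G n).toHom z)
    (w := (ψ.onCoh G n).toHom z)).2 ⟨y, fun a => ?_⟩
  obtain ⟨a, rfl⟩ := P.relCls_surjective n a
  rw [P.d_relCls, hy]
  show z.1 (Q.relCls n (φ.big.f n a)) - z.1 (Q.relCls n (ψ.big.f n a)) = _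
  rw [← map_sub, ← map_sub, ← neg_sub, ← hb h rfl a, map_neg, map_neg, map_add, map_add,
    ← Q.d_relCls, (Q.cx.mem_cocycles rfl).1 z.2, zero_add]

/-! ### Cofiltrations, their saturations and the map `Local`. -/

namespace Cofiltration

variable (F : P.Cofiltration)

/-- The cofiltration with the same complexes `Kₘ` and the subcomplexes `Kₘ ∩ K'`. -/
def saturation : P.Cofiltration where
  tot := F.tot
  sub k := F.tot k ⊓ P.sub
  le _ _ hs := hs.1
  finite := F.finite
  tot_mono := F.tot_mono
  sub_mono := fun _ _ h _ hs => ⟨F.tot_mono h hs.1, hs.2⟩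
  tot_union := F.tot_union
  sub_union s := ⟨fun hs => ((F.tot_union s).1 (P.le hs)).imp fun _ hm => ⟨hm, hs⟩,
    fun ⟨_, hm⟩ => hm.2⟩

theorem tot_le (k : ℕ) : F.tot k ≤ P.tot := fun s hs => (F.tot_union s).2 ⟨k, hs⟩

/-- The inclusions between the pairs of a cofiltration. -/
noncomputable def transition {m k : ℕ} (h : m ≤ k) : (F.pair m).ChainMap (F.pair k) :=
  SimplicialPair.Map.incl (F.le m) (F.le k) (F.tot_mono h) (F.sub_mono h)

theorem sub_le_saturation (m : ℕ) : F.sub m ≤ F.saturation.sub m :=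
  fun s hs => ⟨F.le m hs, (F.sub_union s).2 ⟨m, hs⟩⟩

/-- The inclusion of a pair of the cofiltration into the pair of its saturation. -/
noncomputable def toSaturation (m : ℕ) : (F.pair m).ChainMap (F.saturation.pair m) :=
  SimplicialPair.Map.incl (F.le m) (F.saturation.le m) le_rfl (F.sub_le_saturation m)

/-- The complex `K_m ∩ K'` is finite and exhausted by the increasing `K'_k`, so one of them contains
it. Hence the cofiltration and its saturation are interleaved. -/
theorem exists_saturation_le (m : ℕ) : ∃ k, m ≤ k ∧ F.saturation.sub m ≤ F.sub k := by
  have hfin : {s | s ∈ (F.saturation.sub m).faces}.Finite :=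
    (F.finite m).subset fun s hs => hs.1
  have hs : ∀ s : {s | s ∈ (F.saturation.sub m).faces}, ∃ k, s.1 ∈ (F.sub k).faces :=
    fun s => (F.sub_union s.1).1 s.2.2
  choose k hk using hs
  have := hfin.to_subtype
  obtain ⟨l, hl⟩ := (Set.finite_range k).bddAbove
  exact ⟨max m l, le_max_left _ _, fun s hs =>
    F.sub_mono ((hl ⟨⟨s, hs⟩, rfl⟩).trans (le_max_right _ _)) (hk ⟨s, hs⟩)⟩

/-- The inclusion of a pair of the saturation into a pair of the cofiltration. -/
noncomputable def ofSaturation {m k : ℕ} (h : m ≤ k) (hs : F.saturation.sub m ≤ F.sub k) :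
    (F.saturation.pair m).ChainMap (F.pair k) :=
  SimplicialPair.Map.incl (F.saturation.le m) (F.le k) (F.tot_mono h) hs

/-- The retractions onto the chain groups of the pairs in the saturation of a cofiltration. -/
noncomputable def saturationProj (k : ℕ) (n : ℤ) : P.cx.X n →+ (F.saturation.pair k).cx.X n :=
  QuotientAddGroup.lift (simplicialIncl P.le |>.f n).range
    (((F.saturation.pair k).relCls n).comp (chainFilter P.tot (F.tot k) n)) (by
    rintro _ ⟨x, rfl⟩
    refine (F.saturation.pair k).relCls_eq_zero_iff.2 fun l hl => ?_
    -- This is where saturation matters: truncating a chain of `K'` to `K_k` leaves a chain of `K_k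
    -- ∩ K'`, which need not be one of `K'_k`.
    show l ∈ elemChains (F.tot k ⊓ P.sub) n
    rw [elemChains_inf]
    refine ⟨(chainFilter P.tot (F.tot k) n ((simplicialIncl P.le).f n x)).2 hl, x.2 ?_⟩
    exact chainFilter_support_subset _ _ _ _ hl)

theorem saturationProj_relCls (k : ℕ) (n : ℤ) (x : (simplicialCx P.tot).X n) :
    F.saturationProj k n (P.relCls n x) =
      (F.saturation.pair k).relCls n (chainFilter P.tot (F.tot k) n x) := rfl

theorem incl_rel_relCls (k : ℕ) (n : ℤ) (x : (simplicialCx (F.tot k)).X n) :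
    (F.incl k).rel.f n ((F.pair k).relCls n x) =
      P.relCls n ((simplicialIncl (F.tot_le k)).f n x) := rfl

/-- The exhaustion of the chain complex of a pair by the saturation of a cofiltration. -/
noncomputable def saturationExhaustion : P.cx.Exhaustion where
  cx k := (F.saturation.pair k).cx
  ι k := (F.saturation.incl k).rel
  proj k n := F.saturationProj k n
  proj_ι k n a := by
    obtain ⟨(x : (simplicialCx (F.tot k)).X n), rfl⟩ :=
      (F.saturation.pair k).relCls_surjective n a
    refine (congrArg _ (F.saturation.incl_rel_relCls k n x)).trans
      ((F.saturationProj_relCls k n _).trans (congrArg _ (Subtype.ext ?_)))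
    exact coe_chainFilter_of_mem P.tot (F.tot k) n ((simplicialIncl (F.tot_le k)).f n x) x.2
  ι_proj_ι {j k} hjk n a := by
    obtain ⟨(x : (simplicialCx (F.tot j)).X n), rfl⟩ :=
      (F.saturation.pair j).relCls_surjective n a
    refine (congrArg (fun b => (F.saturation.incl k).rel.f n (F.saturationProj k n b))
      (F.saturation.incl_rel_relCls j n x)).trans (((congrArg _
      (F.saturationProj_relCls k n _)).trans (F.saturation.incl_rel_relCls k n _)).trans
      ((congrArg _ (Subtype.ext ?_)).trans (F.saturation.incl_rel_relCls j n x).symm))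
    exact coe_chainFilter_of_mem P.tot (F.tot k) n
      ((simplicialIncl (F.tot_le j)).f n x) fun l hl => elemChains_mono (F.tot_mono hjk) n (x.2 hl)
  exhaust n a := by
    obtain ⟨x, rfl⟩ := P.relCls_surjective n a
    obtain ⟨k, hk⟩ := exists_mem_chainGroup F.tot_mono (fun s hs => (F.tot_union s).1 hs) n x
    exact ⟨k, (F.saturation.pair k).relCls n ⟨x.1, hk⟩, F.saturation.incl_rel_relCls k n ⟨x.1, hk⟩⟩

theorem isClosed_coboundaries (hG : DivisionClosure G) (n : ℤ) (k : ℕ) :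
    IsClosed (((F.pair k).coh G n).sub : Set ((F.pair k).coh G n).carrier) := by
  have : ∀ n, Module.Finite ℤ ((F.pair k).cx.X n) :=
    fun n => SimplicialPair.finite_cx (F.pair k).toSimplicialPair (F.finite k) n
  exact ChainCx.isClosed_coh_sub hG n

theorem localMap_cls_eq_zero_iff (n : ℤ) (z : P.cx.cocycles G n) :
    F.localMap G n ((P.coh G n).cls z) = 0 ↔
      ∀ k, (ChainMap.onCoh (F.incl k) G n).map ((P.coh G n).cls z) = 0 := by
  have h : ∀ k, (ChainMap.onCoh (F.incl k) G n).map ((P.coh G n).cls z) = 0 ↔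
      (ChainMap.onCoh (F.incl k) G n).toHom z ∈ ((F.pair k).coh G n).sub :=
    fun k => QuotientAddGroup.eq_zero_iff _
  simp only [h]
  refine (QuotientAddGroup.eq_zero_iff (N := (F.prodCoh G n).sub)
    (fun k => (ChainMap.onCoh (F.incl k) G n).toHom z)).trans ?_
  exact ⟨fun h k => h k trivial, fun h k _ => h k⟩

/-- One direction passes to the saturation and uses approximation by coboundaries along its
exhaustion. The other uses that each restriction is continuous and the coboundaries of the finite
pairs are closed. -/
theorem localMap_eq_zero_iff (hG : DivisionClosure G) (n : ℤ) (x : (P.coh G n).Q) :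
    F.localMap G n x = 0 ↔ ∃ y, (P.coh G n).asymptoticIncl.map y = x := by
  rw [PolishCover.exists_asymptoticIncl_map_eq]
  constructor
  · intro hx
    obtain ⟨(z : P.cx.cocycles G n), rfl⟩ := (P.coh G n).cls_surjective x
    refine ⟨z, F.saturationExhaustion.mem_closure_of_forall_coboundary (sub_add_cancel n 1) z
      fun m => ?_, rfl⟩
    obtain ⟨k, hmk, hk⟩ := F.exists_saturation_le m
    refine (ChainCx.coh_cls_eq_zero_iff (sub_add_cancel n 1)
      (z := (ChainMap.onCoh (F.saturation.incl m) G n).toHom z)).1 ?_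
    -- Restriction to the saturated pair factors through restriction to a later pair of the
    -- cofiltration.
    have h1 := onCoh_comp G (F.incl k) (F.ofSaturation hmk hk) n ((P.coh G n).cls z)
    rw [(F.localMap_cls_eq_zero_iff G n z).1 hx k, map_zero] at h1
    exact h1
  · rintro ⟨z, hz, rfl⟩
    change P.cx.cocycles G n at z
    refine (F.localMap_cls_eq_zero_iff G n z).2 fun k => ?_
    exact (ChainMap.onCoh (F.incl k) G n).asymptoticIncl_map_eq_zero
      (F.isClosed_coboundaries G hG n k) ((P.coh G n).asymptotic.cls ⟨z, hz⟩)

variable {G} in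
theorem prod_ext {n : ℤ} {x y : (F.prodCoh G n).Q}
    (h : ∀ m, F.projCoh G n m x = F.projCoh G n m y) : x = y := by
  obtain ⟨x, rfl⟩ := (F.prodCoh G n).cls_surjective x
  obtain ⟨y, rfl⟩ := (F.prodCoh G n).cls_surjective y
  exact ((F.prodCoh G n).cls_eq_iff).2 fun m _ =>
    (((F.pair m).coh G n).cls_eq_iff (x := x m) (y := y m)).1 (h m)

theorem projCoh_localMap (n : ℤ) (m : ℕ) (x : (P.coh G n).Q) :
    F.projCoh G n m (F.localMap G n x) = (ChainMap.onCoh (F.incl m) G n).map x := by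
  obtain ⟨z, rfl⟩ := (P.coh G n).cls_surjective x
  rfl

theorem mem_limCoh_iff (n : ℤ) (x : (F.prodCoh G n).Q) :
    x ∈ F.limCoh G n ↔ ∀ m, (ChainMap.onCoh (F.bond m) G n).map (F.projCoh G n (m + 1) x) =
      F.projCoh G n m x := by
  simp only [limCoh, PolishCover.limSubgroup, AddSubgroup.mem_iInf, AddMonoidHom.mem_ker]
  exact forall_congr' fun m => sub_eq_zero

/-- Surjectivity onto the limit: a compatible family is transferred to the saturated tower, its
representatives are glued there, and the result is transferred back by the interleaving. -/
theorem range_localMap (n : ℤ) : (F.localMap G n).range = F.limCoh G n := by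
  apply le_antisymm
  · rintro _ ⟨x, rfl⟩
    refine (F.mem_limCoh_iff G n _).2 fun m => ?_
    rw [projCoh_localMap, projCoh_localMap, ← onCoh_comp]
    rfl
  · intro x hx
    have hx' := (F.mem_limCoh_iff G n x).1 hx
    have hle : ∀ {m k} (h : m ≤ k),
        (ChainMap.onCoh (F.transition h) G n).map (F.projCoh G n k x) =
        F.projCoh G n m x := by
      intro m k h
      induction k, h using Nat.le_induction with
      | base =>
        obtain ⟨(z : (F.pair m).cx.cocycles G n), hz⟩ :=
          ((F.pair m).coh G n).cls_surjective (F.projCoh G n m x)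
        rw [← hz]
        refine congrArg ((F.pair m).coh G n).cls (Subtype.ext (AddMonoidHom.ext fun a => ?_)
          (a1 := (ChainMap.onCoh (F.transition le_rfl) G n).toHom z) (a2 := z))
        obtain ⟨a, rfl⟩ := (F.pair m).relCls_surjective n a
        rfl
      | succ k h ih =>
        rw [← ih, ← hx' k, ← onCoh_comp]
        rfl
    choose M hM hM' using F.exists_saturation_le
    let v : ∀ m, ((F.saturation.pair m).coh G n).Q := fun m =>
      (ChainMap.onCoh (F.ofSaturation (hM m) (hM' m)) G n).map (F.projCoh G n (M m) x)
    -- The transferred class may be computed from any later stage; comparing `v m` and `v (m + 1)`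
    -- at a common stage gives compatibility.
    have hv : ∀ m k (h : M m ≤ k), (ChainMap.onCoh (F.ofSaturation ((hM m).trans h)
        ((hM' m).trans (F.sub_mono h))) G n).map (F.projCoh G n k x) = v m := fun m k h => by
      show _ = (ChainMap.onCoh (F.ofSaturation (hM m) (hM' m)) G n).map _
      rw [← hle h, ← onCoh_comp]
      rfl
    have hvb : ∀ m, (ChainMap.onCoh (F.saturation.bond m) G n).map (v (m + 1)) = v m :=
      fun m => by
        rw [← hv m _ (le_max_left (M m) (M (m + 1))),
          ← hv (m + 1) _ (le_max_right (M m) (M (m + 1))),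
          ← onCoh_comp]
        rfl
    choose w hw using fun m => ((F.saturation.pair m).coh G n).cls_surjective (v m)
    have h : n - 1 + 1 = n := sub_add_cancel n 1
    obtain ⟨z, hz⟩ := F.saturationExhaustion.exists_glue (m := n - 1) h w fun k => by
      have h1 := hvb k
      rw [← hw, ← hw] at h1
      obtain ⟨y, hy⟩ := (ChainCx.coh_cls_eq_iff h
        (z := (ChainMap.onCoh (F.saturation.bond k) G n).toHom (w (k + 1))) (w := w k)).1 h1
      refine ⟨y, fun a => (congrArg (fun b => (w (k + 1)).1 b - (w k).1 a) ?_).trans (hy a)⟩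
      have h2 : (F.saturation.incl k).rel.f n a =
          (F.saturation.incl (k + 1)).rel.f n ((F.saturation.bond k).rel.f n a) := by
        obtain ⟨a, rfl⟩ := (F.saturation.pair k).relCls_surjective n a
        rfl
      exact (congrArg (F.saturationExhaustion.proj (k + 1) n) h2).trans
        (F.saturationExhaustion.proj_ι (k + 1) n _)
    refine ⟨(P.coh G n).cls z, F.prod_ext fun m => ?_⟩
    have h3 : (ChainMap.onCoh (F.saturation.incl m) G n).map ((P.coh G n).cls z) = v m := by
      rw [← hw]
      exact (ChainCx.coh_cls_eq_iff h
        (z := (ChainMap.onCoh (F.saturation.incl m) G n).toHom z) (w := w m)).2 (hz m)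
    rw [projCoh_localMap]
    refine (onCoh_comp G (F.saturation.incl m) (F.toSaturation m) n _).trans ?_
    rw [h3, ← hle (hM m)]
    exact (onCoh_comp G _ _ n _).symm

end Cofiltration

end PolyPair

namespace PolyPair

/-- The split exact sequence of the chain complexes of `X'`, `X` and `(X, X')`. -/
noncomputable def splitExact (P : PolyPair.{u}) :
    ChainCx.SplitExact P.subP.cx P.totP.cx P.cx :=
  P.toSimplicialPair.splitExact

theorem splitExact_i (P : PolyPair.{u}) : P.splitExact.i = P.i.rel :=
  P.toSimplicialPair.splitExact_i

theorem splitExact_j (P : PolyPair.{u}) : P.splitExact.j = P.j.rel :=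
  P.toSimplicialPair.splitExact_j

theorem splitExact_i_relCls (P : PolyPair.{u}) (n : ℤ) (x : (simplicialCx P.sub).X n) :
    P.splitExact.i.f n (P.subP.relCls n x) =
      P.totP.relCls n ((simplicialIncl P.le).f n x) := by
  rw [splitExact_i]
  exact P.mapI_rel_relCls n x

theorem splitExact_j_relCls (P : PolyPair.{u}) (n : ℤ) (x : (simplicialCx P.tot).X n) :
    P.splitExact.j.f n (P.totP.relCls n x) = P.relCls n x := by
  rw [splitExact_j]
  exact P.mapJ_rel_relCls n x

end PolyPair

/-! ### The constructed homomorphisms satisfy the usual formulas. -/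

section Formulas

variable {G : Type v} [AddCommGroup G] [TopologicalSpace G] [IsTopologicalAddGroup G]
  [PolishSpace G] (P : PolyPair.{u}) {m n : ℤ} (h : m + 1 = n)

theorem isCoIndex_coIndex : IsCoIndex P h (P.cx.coIndex h G).map := fun c ρ w hρ hw =>
  P.cx.coIndex_map_cls h c ρ hρ w fun x => hw x ⟨_, P.cx.d_mem_cycles h x⟩ rfl

theorem isConnectingHom_connH : IsConnectingHom P h (P.splitExact.connH h) := by
  intro x y hx hy hxy
  have hx' : P.splitExact.j.f n (P.totP.relCls n x) ∈ P.cx.cycles n := by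
    rw [P.splitExact_j_relCls]
    exact hx
  have h1 := P.splitExact.connH_hcls h (P.totP.relCls n x) hx' ⟨_, hy⟩
    ((P.splitExact_i_relCls m y).trans (congrArg (P.totP.relCls m) hxy))
  rw [← h1]
  exact congrArg (fun a => P.splitExact.connH h (P.cx.hcls a))
    (Subtype.ext (P.splitExact_j_relCls n x).symm)

/-- The homomorphism on the chain complex of `(X, ∅)` given by a cochain on `X`. -/
noncomputable def PolyPair.totLift (e : (simplicialCx P.tot).X m →+ G) : P.totP.cx.X m →+ G :=
  QuotientAddGroup.lift (simplicialIncl P.totP.le |>.f m).range e (by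
    rintro _ ⟨x, rfl⟩
    have h0 : (simplicialIncl P.totP.le).f m x = 0 :=
      (congrArg _ (eq_zero_of_chain_bot x)).trans (map_zero _)
    exact (congrArg e h0).trans (map_zero e))

theorem isConnectingCoh_connCoh : IsConnectingCoh P h (P.splitExact.connCoh h G).map := by
  intro z e w he hw
  refine P.splitExact.connCoh_cls h z (P.totLift e) w (fun y => ?_) fun x => ?_
  · obtain ⟨y, rfl⟩ := P.subP.relCls_surjective m y
    exact (congrArg _ (P.splitExact_i_relCls m y)).trans (he y)
  · obtain ⟨x, rfl⟩ := P.totP.relCls_surjective n x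
    exact (congrArg _ (P.splitExact_j_relCls n x)).trans (hw x)

end Formulas

/-! ### Naturality with respect to chain maps of pairs. -/

section Naturality

variable (G : Type v) [AddCommGroup G] [TopologicalSpace G] [IsTopologicalAddGroup G]
  [PolishSpace G]

/-- The homomorphisms of the universal coefficient theorem for pairs of polyhedra. -/
noncomputable def uctMaps : UCTMaps.{u} G where
  coIndex P _ _ h := (P.cx.coIndex h G).map
  coIndexInf P _ _ h := P.cx.coIndexInf h G
  dCoh P _ _ h := (P.splitExact.connCoh h G).map
  dHom P _ _ h := P.splitExact.connH h

variable {P Q : PolyPair.{u}} (φ : P.ChainMap Q) {m n : ℤ} (h : m + 1 = n)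

/-- The pullback along `φ` of a primitive `ρ` for `c` is a primitive for the pulled-back cocycle,
and any primitive computes the co-index. -/
theorem coIndex_natural (x : (Q.extH G m).Q) :
    (P.cx.coIndex h G).map ((extMap G (φ.onH m)).map x) =
      (φ.onCoh G n).map ((Q.cx.coIndex h G).map x) := by
  obtain ⟨(c : extCocycles (Q.H m) G), rfl⟩ := (Q.extH G m).cls_surjective x
  refine P.cx.coIndex_map_cls h ((extMap G (φ.onH m)).toHom c)
    (fun x => Q.cx.cyclePrimitive G m (φ.rel.onCycles m x) c) (fun x y => ?_)
    ((φ.onCoh G n).toHom (Q.cx.coIndexHom h G c)) fun x => ?_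
  · rw [map_add]
    exact Q.cx.cyclePrimitive_add c _ _
  · refine congrArg (fun y => (n.negOnePow : ℤ) • Q.cx.cyclePrimitive G m y c) (Subtype.ext ?_)
    exact (φ.rel.comm h x).symm

theorem index_natural (x : (Q.coh G n).Q) :
    P.index G n ((φ.onCoh G n).map x) = (homMap G (φ.onH n)).map (Q.index G n x) := by
  obtain ⟨(z : Q.cx.cocycles G n), rfl⟩ := (Q.coh G n).cls_surjective x
  refine congrArg (P.homH G n).cls (AddMonoidHom.ext
    (f := (P.cx.index G n).toHom ((φ.onCoh G n).toHom z))
    (g := (homMap G (φ.onH n)).toHom ((Q.cx.index G n).toHom z)) fun a => ?_)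
  obtain ⟨x, rfl⟩ := P.cx.hcls_surjective n a
  rfl

theorem coIndexInf_natural (x : (Q.pextH G m).Q) :
    P.cx.coIndexInf h G ((extMap G (φ.onH m)).asymptotic.map x) =
      (φ.onCoh G n).asymptotic.map (Q.cx.coIndexInf h G x) := by
  apply (P.coh G n).asymptoticIncl_injective
  refine (P.cx.asymptoticIncl_coIndexInf h _).trans (Eq.trans ?_
    ((φ.onCoh G n).asymptoticIncl_map _).symm)
  refine (congrArg _ ((extMap G (φ.onH m)).asymptoticIncl_map x)).trans
    ((coIndex_natural G φ h _).trans (congrArg _ (Q.cx.asymptoticIncl_coIndexInf h x).symm))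

/-- The pullback of an extension extends the pulled-back cocycle. Independence of the extension
absorbs the fact that `φ` need not respect the chosen splittings. -/
theorem connCoh_natural (x : (Q.subP.coh G m).Q) :
    (P.splitExact.connCoh h G).map ((φ.onSub.onCoh G m).map x) =
      (φ.onCoh G n).map ((Q.splitExact.connCoh h G).map x) := by
  obtain ⟨(z : Q.subP.cx.cocycles G m), rfl⟩ := (Q.subP.coh G m).cls_surjective x
  let e := (z.1.comp (Q.splitExact.q m)).comp (Q.totP.relCls m)
  have he : ∀ y, e ((simplicialIncl Q.le).f m y) = z.1 (Q.subP.relCls m y) := fun y =>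
    congrArg z.1 ((congrArg _ (Q.splitExact_i_relCls m y).symm).trans (Q.splitExact.q_i m _))
  refine isConnectingCoh_connCoh P h ((φ.onSub.onCoh G m).toHom z) (e.comp (φ.big.f m))
    ((φ.onCoh G n).toHom (Q.splitExact.connCocycles h G z)) (fun y => ?_) fun x => ?_
  · exact (congrArg e (φ.comm m y)).trans (he _)
  · refine Eq.trans ?_ (congrArg e (φ.big.comm h x).symm)
    refine Eq.trans ?_ (Q.splitExact.connCocycles_j h z (Q.totP.relCls n (φ.big.f n x)))
    exact congrArg (Q.splitExact.connCocycles h G z).1 (Q.splitExact_j_relCls n _).symm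

theorem connH_natural (x : P.H n) :
    Q.splitExact.connH h (φ.onH n x) = φ.onSub.onH m (P.splitExact.connH h x) := by
  obtain ⟨⟨x, hx⟩, rfl⟩ := P.cx.hcls_surjective n x
  obtain ⟨x, rfl⟩ := P.relCls_surjective n x
  obtain ⟨y, hy⟩ : ∃ y, (simplicialIncl P.le).f m y = (simplicialCx P.tot).d h x :=
    ⟨⟨_, P.relCls_eq_zero_iff.1 ((P.d_relCls h x).symm.trans ((P.cx.mem_cycles h).1 hx))⟩, rfl⟩
  have hy0 : (simplicialCx P.sub).d (sub_add_cancel m 1) y = 0 := by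
    have h0 := (simplicialCx P.tot).d_d h (sub_add_cancel m 1) x
    rw [← hy] at h0
    exact Subtype.ext (congrArg Subtype.val
      (a₁ := (simplicialCx P.tot).d _ ((simplicialIncl P.le).f m y)) (a₂ := 0) h0)
  have hy' : P.subP.relCls m y ∈ P.subP.cx.cycles m := by
    refine (P.subP.cx.mem_cycles (sub_add_cancel m 1)).2 ?_
    exact (congrArg (P.subP.relCls (m - 1)) hy0).trans (map_zero _)
  have hφ : Q.relCls n (φ.big.f n x) ∈ Q.cx.cycles n := (φ.rel.onCycles n ⟨_, hx⟩).2
  have hφy : Q.subP.relCls m (φ.small.f m y) ∈ Q.subP.cx.cycles m :=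
    (φ.onSub.rel.onCycles m ⟨_, hy'⟩).2
  have h1 := isConnectingHom_connH P h x y hx hy' hy
  have h2 := isConnectingHom_connH Q h (φ.big.f n x) (φ.small.f m y) hφ hφy
    ((φ.comm m y).symm.trans ((congrArg _ hy).trans (φ.big.comm h x)))
  exact h2.trans (congrArg (φ.onSub.onH m) h1).symm

theorem uctMaps_naturalAt : (uctMaps G).NaturalAt φ := by
  refine ⟨fun h x => coIndex_natural G φ h x, fun n x => index_natural G φ x,
    fun h x => coIndexInf_natural G φ h x, fun F E m t ψ hψ n x => ?_,
    fun h x => connCoh_natural G φ h x, fun h x => connH_natural φ h x⟩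
  refine (F.projCoh_localMap G n m _).trans ((PolyPair.onCoh_comp G φ (F.incl m) n x).symm.trans ?_)
  refine (PolyPair.onCoh_eq_of_homotopic G hψ n x).trans ((PolyPair.onCoh_comp G _ _ n x).trans ?_)
  exact congrArg _ (E.projCoh_localMap G n t x).symm

end Naturality

theorem mainTheorem6 (G : Type v) [AddCommGroup G] [TopologicalSpace G] [IsTopologicalAddGroup G]
    [PolishSpace G] (hG : DivisionClosure G) :
    ∃ D : UCTMaps.{u} G,
      -- the homomorphisms are given by the usual formulas
      (∀ (P : PolyPair.{u}) {m n : ℤ} (h : m + 1 = n),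
        IsCoIndex P h (D.coIndex P h) ∧ IsConnectingCoh P h (D.dCoh P h) ∧
        IsConnectingHom P h (D.dHom P h)) ∧
      -- the UCT exact sequence and its splitting
      (∀ (P : PolyPair.{u}) {m n : ℤ} (h : m + 1 = n),
        PolishCover.ContDef (D.coIndex P h) ∧ PolishCover.ContDef (P.index G n) ∧
        Function.Injective (D.coIndex P h) ∧
        Function.Exact (D.coIndex P h) (P.index G n) ∧
        Function.Surjective (P.index G n) ∧
        ∃ (r : (P.coh G n).Q →+ (P.extH G m).Q) (s : (P.homH G n).Q →+ (P.coh G n).Q),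
          PolishCover.ContDef r ∧ PolishCover.ContDef s ∧
          (∀ x, r (D.coIndex P h x) = x) ∧ (∀ x, P.index G n (s x) = x) ∧
          ∀ x, D.coIndex P h (r x) + s (P.index G n x) = x) ∧
      -- the restriction of the co-index is an isomorphism from PExt to asymptotic cohomology
      (∀ (P : PolyPair.{u}) {m n : ℤ} (h : m + 1 = n),
        PolishCover.ContDef (D.coIndexInf P h).toAddMonoidHom ∧
        PolishCover.ContDef (D.coIndexInf P h).symm.toAddMonoidHom ∧
        ∀ x, (P.coh G n).asymptoticIncl.map (D.coIndexInf P h x) =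
          D.coIndex P h ((P.extH G m).asymptoticIncl.map x)) ∧
      -- the exact sequence with PExt and the inverse limit of the cofiltration
      (∀ (P : PolyPair.{u}) (F : P.Cofiltration) {m n : ℤ} (h : m + 1 = n),
        (∀ k, IsClosed (((F.pair k).coh G n).sub : Set ((F.pair k).coh G n).carrier)) ∧
        PolishCover.ContDef (F.localMap G n) ∧
        Function.Injective
          (fun x => (P.coh G n).asymptoticIncl.map (D.coIndexInf P h x)) ∧
        Function.Exact
          (fun x => (P.coh G n).asymptoticIncl.map (D.coIndexInf P h x)) (F.localMap G n) ∧
        (F.localMap G n).range = F.limCoh G n) ∧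
      -- the long exact sequences of the pair
      (∀ (P : PolyPair.{u}) {m n : ℤ} (h : m + 1 = n),
        PolishCover.ContDef (D.dCoh P h) ∧
        Function.Exact (P.j.onCoh G n).map (P.i.onCoh G n).map ∧
        Function.Exact (P.i.onCoh G m).map (D.dCoh P h) ∧
        Function.Exact (D.dCoh P h) (P.j.onCoh G n).map ∧
        Function.Exact (P.i.onH n) (P.j.onH n) ∧
        Function.Exact (P.j.onH n) (D.dHom P h) ∧
        Function.Exact (D.dHom P h) (P.i.onH m)) ∧
      -- the connecting homomorphisms form a morphism of UCT exact sequences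
      (∀ (P : PolyPair.{u}) {l m n : ℤ} (h : l + 1 = m) (h' : m + 1 = n),
        (∀ x, D.dCoh P h' (D.coIndex P.subP h x) =
          D.coIndex P h' ((extMap G (D.dHom P h)).map x)) ∧
        ∀ x, P.index G n (D.dCoh P h' x) = (homMap G (D.dHom P h')).map (P.subP.index G m x)) ∧
      -- naturality with respect to all chain maps of pairs
      (∀ (P Q : PolyPair.{u}) (φ : P.ChainMap Q), D.NaturalAt φ) ∧
      -- in particular, naturality with respect to continuous maps of pairs
      ∀ (P Q : PolyPair.{u}) (α : P.ContMap Q) (φ : P.ChainMap Q), α.Induces φ → D.NaturalAt φ := by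
  refine ⟨uctMaps G, fun P m n h => ⟨isCoIndex_coIndex P h, isConnectingCoh_connCoh P h,
      isConnectingHom_connH P h⟩,
    fun P m n h => ⟨(P.cx.coIndex h G).contDef, (P.cx.index G n).contDef,
      P.cx.coIndex_injective h, P.cx.exact_coIndex_index h, P.cx.index_surjective,
      (P.cx.coIndexRetraction h G).map, (P.cx.indexSection h G).map,
      (P.cx.coIndexRetraction h G).contDef, (P.cx.indexSection h G).contDef,
      P.cx.coIndexRetraction_coIndex h, P.cx.index_indexSection h,
      P.cx.coIndex_add_indexSection h⟩,
    fun P m n h => ⟨(P.cx.coIndex h G).asymptotic.contDef,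
      (P.cx.coIndexRetraction h G).asymptotic.contDef, P.cx.asymptoticIncl_coIndexInf h⟩,
    fun P F m n h => ⟨F.isClosed_coboundaries G hG n,
      (PolishCover.toPi _ fun m => PolyPair.ChainMap.onCoh (F.incl m) G n).contDef,
      (P.coh G n).asymptoticIncl_injective.comp (P.cx.coIndexInf h G).injective,
      fun x => (F.localMap_eq_zero_iff G hG n x).trans
        (P.cx.coIndexInf h G).surjective.exists,
      F.range_localMap G n⟩,
    fun P m n h => ?_,
    fun P l m n h h' => ⟨P.splitExact.connCoh_coIndex h' h, P.splitExact.index_connCoh h'⟩,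
    fun P Q φ => uctMaps_naturalAt G φ, fun P Q _ φ _ => uctMaps_naturalAt G φ⟩
  -- The abstract sequences are phrased with the inclusion and projection of the chosen splitting,
  -- which are then replaced by the maps induced by `i` and `j`.
  have h1 := P.splitExact.exact_coh_j_i (G := G) (n := n)
  have h2 := P.splitExact.exact_coh_i_conn (G := G) h
  have h3 := P.splitExact.exact_coh_conn_j (G := G) h
  have h4 := P.splitExact.exact_H_i_j (n := n)
  have h5 := P.splitExact.exact_H_j_conn h
  have h6 := P.splitExact.exact_H_conn_i h
  rw [P.splitExact_i] at h1 h2 h4 h6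
  rw [P.splitExact_j] at h1 h3 h4 h5
  exact ⟨(P.splitExact.connCoh h G).contDef, h1, h2, h3, h4, h5, h6⟩
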